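/- For a finite set $S\subset\mathbb{R}^d$ let $R(S)$ be the Vietoris–Rips complex of $S$ at scale $1$, i.e. the simplicial complex whose faces are all subsets of $S$ of (Euclidean) diameter at most $1$. For a field $\mathbf{k}$ let $\tilde\beta_p(R(S);\mathbf{k})=\dim_{\mathbf{k}}\tilde H_p(R(S);\mathbf{k})$ be its reduced simplicial Betti numbers, and put $$M_{p,d}(n):=\max\{\tilde\beta_p(R(S);\mathbf{k}) : S\subset\mathbb{R}^d,\ |S|\le n\}.$$ Theorem. Let $p\ge 2$ be an integer. 1. For every $d$ and every $\delta>0$ there is an integer $N$, depending only on $p$, $d$ and $\delta$, such that $M_{p,d}(n)<\delta n^p$ for all $n\ge N$ and every field $\mathbf{k}$. 2. There is a constant $D_p$, depending only on $p$, such that $M_{p,2}(n)\le D_p\,n^{p-1}$ for all $n\geq 0$ and every field $\mathbf{k}$. -/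

import Mathlib

universe u

namespace Rips

/-! ### Reduced simplicial homology of an abstract simplicial complex over a field

Simplices are finite sets of vertices, oriented by a linear order on the vertex type.  Chains are
finite formal `k`-linear combinations of simplices, and the empty simplex spans the chains of
dimension `-1`, so that the homology is the reduced one. -/

section Homology

/-- The quotient `Z / (Z ∩ B)` of two subspaces of a vector space; it is `Z / B` if `B ≤ Z`. -/
abbrev Subquotient {k M : Type*} [Field k] [AddCommGroup M] [Module k M]
    (Z B : Submodule k M) : Type _ :=
  Z ⧸ B.submoduleOf Z

theorem finite_and_finrank_subquotient_le {k M : Type*} [Field k] [AddCommGroup M] [Module k M]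
    (Z B W : Submodule k M) (hZ : Z ≤ W) [Module.Finite k W] :
    Module.Finite k (Subquotient Z B) ∧
      Module.finrank k (Subquotient Z B) ≤ Module.finrank k W := by
  have hfc : Module.Finite k Z :=
    Module.Finite.of_injective _ (Submodule.inclusion_injective hZ)
  exact ⟨inferInstance, (Submodule.finrank_quotient_le _).trans (Submodule.finrank_mono hZ)⟩

variable {V : Type*} [LinearOrder V] (k : Type u) [Field k]

/-- The boundary operator `∂ F = ∑_{v ∈ F} (-1)^{#{w ∈ F | w < v}} (F \ {v})`.  On a simplex
`v₀ < v₁ < ⋯ < v_q` this is `∑ᵢ (-1)^i (v₀ ⋯ v̂ᵢ ⋯ v_q)`. -/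
noncomputable def boundary : (Finset V →₀ k) →ₗ[k] (Finset V →₀ k) :=
  Finsupp.linearCombination k fun F : Finset V =>
    ∑ v ∈ F, Finsupp.single (F.erase v) ((-1 : k) ^ (F.filter (· < v)).card)

/-- The chains of `Γ` spanned by the simplices with exactly `m` vertices, i.e. the chains of
dimension `m - 1`.  The empty set counts as the unique simplex with `0` vertices. -/
noncomputable def chains (Γ : PreAbstractSimplicialComplex V) (m : ℕ) :
    Submodule k (Finset V →₀ k) :=
  Finsupp.supported k k {F : Finset V | (F ∈ Γ.faces ∨ F = ∅) ∧ F.card = m}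

/-- The cycles of `Γ` of dimension `m - 1`. -/
noncomputable def cycles (Γ : PreAbstractSimplicialComplex V) (m : ℕ) :
    Submodule k (Finset V →₀ k) :=
  chains k Γ m ⊓ LinearMap.ker (boundary k)

/-- The boundaries of `Γ` of dimension `m - 1`. -/
noncomputable def boundaries (Γ : PreAbstractSimplicialComplex V) (m : ℕ) :
    Submodule k (Finset V →₀ k) :=
  (chains k Γ (m + 1)).map (boundary k)

/-- The reduced homology `H̃_p(Γ; k)`: cycles modulo boundaries in dimension `p`
(simplices with `p + 1` vertices). -/
abbrev ReducedHomology (p : ℕ) (Γ : PreAbstractSimplicialComplex V) : Type _ :=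
  Subquotient (cycles k Γ (p + 1)) (boundaries k Γ (p + 1))

/-- The reduced Betti number `β̃_p(Γ; k) = dim_k H̃_p(Γ; k)`. -/
noncomputable def bettiNumber (p : ℕ) (Γ : PreAbstractSimplicialComplex V) : ℕ :=
  Module.finrank k (ReducedHomology k p Γ)

theorem boundary_single (F : Finset V) (a : k) :
    boundary k (Finsupp.single F a) =
      a • ∑ v ∈ F, Finsupp.single (F.erase v) ((-1 : k) ^ (F.filter (· < v)).card) := by
  simp [boundary, Finsupp.linearCombination_single]

theorem sign_pair (F : Finset V) {u v : V} (hu : u ∈ F) (huv : u < v) :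
    (-1 : k) ^ (F.filter (· < v)).card * (-1 : k) ^ ((F.erase v).filter (· < u)).card +
      (-1 : k) ^ (F.filter (· < u)).card * (-1 : k) ^ ((F.erase u).filter (· < v)).card = 0 := by
  have h1 : (F.erase v).filter (· < u) = F.filter (· < u) := by
    ext w
    simp only [Finset.mem_filter, Finset.mem_erase]
    constructor
    · tauto
    · rintro ⟨h, h'⟩
      exact ⟨⟨(h'.trans huv).ne, h⟩, h'⟩
  have h2 : (F.filter (· < v)).card = ((F.erase u).filter (· < v)).card + 1 := by
    rw [Finset.filter_erase, Finset.card_erase_add_one]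
    simp [hu, huv]
  rw [h1, h2, pow_succ]
  ring

theorem boundary_boundary (c : Finset V →₀ k) : boundary k (boundary k c) = 0 := by
  induction c using Finsupp.induction_linear with
  | zero => simp
  | add f g hf hg => simp [hf, hg]
  | single F a =>
    rw [boundary_single, map_smul, map_sum]
    simp only [boundary_single, Finset.smul_sum, Finsupp.smul_single, smul_eq_mul]
    rw [Finset.sum_sigma']
    refine Finset.sum_involution (fun x _ => ⟨x.2, x.1⟩) ?_ ?_ ?_ ?_
    · rintro ⟨v, u⟩ h
      simp only [Finset.mem_sigma, Finset.mem_erase] at h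
      obtain ⟨hv, huv, hu⟩ := h
      dsimp only
      rw [Finset.erase_right_comm (a := u) (b := v), ← Finsupp.single_add, ← mul_add]
      rcases lt_or_gt_of_ne huv with h | h
      · rw [sign_pair k F hu h]
        simp
      · rw [add_comm, sign_pair k F hv h]
        simp
    · rintro ⟨v, u⟩ h _ he
      simp only [Finset.mem_sigma, Finset.mem_erase] at h
      exact h.2.1 (congrArg Sigma.fst he)
    · rintro ⟨v, u⟩ h
      simp only [Finset.mem_sigma, Finset.mem_erase] at h ⊢
      exact ⟨h.2.2, h.2.1.symm, h.1⟩
    · rintro ⟨v, u⟩ _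
      rfl

theorem boundary_mem_chains {Γ : PreAbstractSimplicialComplex V} {m : ℕ} {c : Finset V →₀ k}
    (hc : c ∈ chains k Γ (m + 1)) : boundary k c ∈ chains k Γ m := by
  rw [boundary, Finsupp.linearCombination_apply]
  refine Submodule.sum_mem _ fun F hF => Submodule.smul_mem _ _ (Submodule.sum_mem _ fun v hv => ?_)
  obtain ⟨hF1, hF2⟩ := (Finsupp.mem_supported k c).1 hc hF
  refine Finsupp.single_mem_supported k _ ⟨?_, by rw [Finset.card_erase_of_mem hv, hF2]; rfl⟩
  rcases (F.erase v).eq_empty_or_nonempty with h | h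
  · exact Or.inr h
  · refine Or.inl ((Γ.isRelLowerSet_faces (hF1.resolve_right ?_)).2 (Finset.erase_subset _ _) h)
    exact Finset.ne_empty_of_mem hv

theorem boundaries_le_cycles (Γ : PreAbstractSimplicialComplex V) (m : ℕ) :
    boundaries k Γ m ≤ cycles k Γ m := by
  rintro _ ⟨c, hc, rfl⟩
  exact ⟨boundary_mem_chains k hc, boundary_boundary k c⟩

/-- If all faces of `Γ` lie in the finite set `S`, its homology is finite-dimensional, of
dimension at most the number of subsets of `S`. -/
theorem finite_and_bettiNumber_le (p : ℕ) (Γ : PreAbstractSimplicialComplex V) (S : Finset V)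
    (hS : ∀ F ∈ Γ.faces, F ⊆ S) :
    Module.Finite k (ReducedHomology k p Γ) ∧ bettiNumber k p Γ ≤ 2 ^ S.card := by
  have hle : cycles k Γ (p + 1) ≤ Finsupp.supported k k (S.powerset : Set (Finset V)) := by
    refine inf_le_left.trans (Finsupp.supported_mono ?_)
    rintro F ⟨h | rfl, -⟩
    · simpa using hS F h
    · simp
  let e := Finsupp.supportedEquivFinsupp (M := k) (R := k) (S.powerset : Set (Finset V))
  have hfin : Module.Finite k (Finsupp.supported k k (S.powerset : Set (Finset V))) :=
    Module.Finite.equiv e.symm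
  have hrank : Module.finrank k (Finsupp.supported k k (S.powerset : Set (Finset V))) =
      2 ^ S.card := by
    rw [e.finrank_eq, Module.finrank_finsupp_self]
    simp
  rw [← hrank]
  exact finite_and_finrank_subquotient_le _ _ _ hle

end Homology

/-! ### Vietoris–Rips complexes and their extremal Betti numbers -/

/-- The Vietoris–Rips complex `R^ε(S)`: the faces are the (nonempty) subsets of the finite set `S`
of diameter at most `ε`. -/
def ripsComplex {V : Type*} [PseudoMetricSpace V] (ε : ℝ) (S : Finset V) :
    PreAbstractSimplicialComplex V where
  faces := {F | F.Nonempty ∧ F ⊆ S ∧ Metric.diam (F : Set V) ≤ ε}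
  isRelLowerSet_faces := by
    rintro F ⟨hne, hS, hd⟩
    refine ⟨hne, fun G hGF hG => ⟨hG, hGF.trans hS, le_trans ?_ hd⟩⟩
    exact Metric.diam_mono (by exact_mod_cast hGF) F.finite_toSet.isBounded

/-- The lexicographic order on the points of `ℝ^d`, used only to orient simplices. -/
noncomputable abbrev lexOrder (d : ℕ) : LinearOrder (EuclideanSpace ℝ (Fin d)) :=
  LinearOrder.lift' (fun x => toLex (fun i => x i)) fun x y h => by
    ext i
    exact congrFun (toLex_inj.1 h) i

/-- The reduced Betti number `β̃_p(R(S); k)` of `R(S) = R^1(S)` for a finite `S ⊂ ℝ^d`. -/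
noncomputable def ripsBetti (k : Type u) [Field k] (p : ℕ) {d : ℕ}
    (S : Finset (EuclideanSpace ℝ (Fin d))) : ℕ :=
  letI := lexOrder d
  bettiNumber k p (ripsComplex 1 S)

/-- `M_{p,d}(n) = max {β̃_p(R(S); k) : S ⊂ ℝ^d, |S| ≤ n}`; the maximum is attained, see
`isGreatest_maxBetti`. -/
noncomputable def maxBetti (k : Type u) [Field k] (p d n : ℕ) : ℕ :=
  sSup {b | ∃ S : Finset (EuclideanSpace ℝ (Fin d)), S.card ≤ n ∧ ripsBetti k p S = b}

theorem isGreatest_maxBetti (k : Type u) [Field k] (p d n : ℕ) :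
    IsGreatest {b | ∃ S : Finset (EuclideanSpace ℝ (Fin d)), S.card ≤ n ∧ ripsBetti k p S = b}
      (maxBetti k p d n) := by
  have hbdd : BddAbove
      {b | ∃ S : Finset (EuclideanSpace ℝ (Fin d)), S.card ≤ n ∧ ripsBetti k p S = b} := by
    refine ⟨2 ^ n, ?_⟩
    rintro b ⟨S, hS, rfl⟩
    let := lexOrder d
    exact (finite_and_bettiNumber_le k p (ripsComplex 1 S) S fun F hF => hF.2.1).2.trans
      (Nat.pow_le_pow_right (by norm_num) hS)
  exact ⟨Nat.sSup_mem ⟨_, ∅, by simp, rfl⟩ hbdd, fun b hb => le_csSup hbdd hb⟩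

end Rips

/-! The complex `R(S)` is the clique complex of the graph joining points at distance at most one.
Deleting a vertex changes each Betti number by at most the Betti number, one dimension lower, of its
link, and the link is again a clique complex on at most `n` points. So a bound for `p = 2` gains one
factor `n` per dimension, and everything reduces to `p = 2`.

For `p = 2`, cut space into small cells, each a clique, so that every neighbourhood meets at most
`C` cells. Call an edge between two cells critical if some pair of points from these cells is not
adjacent. Without critical edges, points of a cell are twins: a vertex with a twin has a cone as
link, and once each cell holds at most one point all links have at most `C` vertices. This gives a
linear bound (`homologyRank_partialGraph_empty_le`). The critical edges are removed one pair of
cells at a time, and in a pair by decreasing `κ`. Removing an edge costs at most the reduced zeroth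
Betti number of its link. This is at most `C`, and it vanishes unless the edge has an isolated
witness or a split link (`homologyRank_link_eq_zero`). It remains to count these bad edges for a
suitable `κ` (`homologyRank_three_flag_le`).

In any dimension take `κ` lexicographic. Isolated edges with the same witness and the same pair of
cells form a half-induced matching, and linearly many of these cover only `o(n^2)` pairs, by
Szemerédi's regularity lemma. Split edges contain no 4-cycle between two cells, so there are
`O(n^(3/2))` of them.

In the plane take `κ` to be the distance. A split edge is determined by one endpoint, the other cell
and a direction. If the witness cell is fully adjacent to the cell of an endpoint, the isolated edge
is determined by the other endpoint and that cell. Otherwise the three cells form an almost regular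
triangle, and the edge is determined up to boundedly many choices by a single point, namely the
witness or a point of the second cell (`exists_injOn_of_mutuallyNearest`). Hence there are only
linearly many bad edges. -/

namespace Rips

/-! ### Contractions and the exact-sequence inequality for Betti numbers. -/

section Homology

variable {V : Type*} [LinearOrder V] (k : Type u) [Field k]

/-- The dimension of the reduced homology in dimension `m - 1`, so that `m = 0` is allowed. -/
noncomputable def homologyRank (m : ℕ) (Γ : PreAbstractSimplicialComplex V) : ℕ :=
  Module.finrank k (Subquotient (cycles k Γ m) (boundaries k Γ m))

/-- The contraction `F ↦ ± F \ {v}` of simplices by a vertex `v`. -/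
noncomputable def contract (v : V) : (Finset V →₀ k) →ₗ[k] (Finset V →₀ k) :=
  Finsupp.linearCombination k fun F : Finset V =>
    if v ∈ F then Finsupp.single (F.erase v) ((-1 : k) ^ (F.filter (· < v)).card) else 0

theorem contract_single (v : V) (F : Finset V) (a : k) :
    contract k v (Finsupp.single F a) =
      if v ∈ F then Finsupp.single (F.erase v) (a * (-1 : k) ^ (F.filter (· < v)).card) else 0 := by
  rw [contract, Finsupp.linearCombination_single]
  split_ifs <;> simp

/-- Deleting two vertices in either order gives opposite signs (`sign_pair`), so contraction is a
chain map up to sign. This identifies the chains of a complex modulo those avoiding `v` with the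
shifted chains of the link of `v`. -/
theorem contract_boundary (v : V) (c : Finset V →₀ k) :
    contract k v (boundary k c) = -boundary k (contract k v c) := by
  induction c using Finsupp.induction_linear with
  | zero => simp
  | add f g hf hg => simp only [map_add, hf, hg, neg_add]
  | single F a =>
    rw [boundary_single, contract_single, map_smul, map_sum]
    simp only [contract_single]
    by_cases hv : v ∈ F
    · rw [if_pos hv, boundary_single, ← Finset.add_sum_erase _ _ hv, if_neg (by simp), zero_add,
        Finset.smul_sum, Finset.smul_sum, ← Finset.sum_neg_distrib]
      refine Finset.sum_congr rfl fun u hu => ?_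
      obtain ⟨huv, hu⟩ := Finset.mem_erase.1 hu
      rw [if_pos (by simp [hv, huv.symm]), Finset.erase_right_comm, Finsupp.smul_single,
        Finsupp.smul_single, ← Finsupp.single_neg]
      congr 1
      have key : (-1 : k) ^ (F.filter (· < v)).card * (-1 : k) ^ ((F.erase v).filter (· < u)).card +
          (-1 : k) ^ (F.filter (· < u)).card * (-1 : k) ^ ((F.erase u).filter (· < v)).card = 0 := by
        rcases lt_or_gt_of_ne huv with h | h
        · exact sign_pair k F hu h
        · rw [add_comm]
          exact sign_pair k F hv h
      simp only [smul_eq_mul]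
      linear_combination a * key
    · rw [if_neg hv, map_zero, neg_zero, Finset.sum_eq_zero, smul_zero]
      intro u hu
      rw [if_neg fun h => hv (Finset.mem_of_mem_erase h)]

theorem contract_apply (v : V) (c : Finset V →₀ k) (F : Finset V) (hv : v ∉ F) :
    contract k v c F = (-1 : k) ^ (F.filter (· < v)).card * c (insert v F) := by
  induction c using Finsupp.induction_linear with
  | zero => simp
  | add f g hf hg => simp only [map_add, Finsupp.add_apply, hf, hg, mul_add]
  | single E a =>
    rw [contract_single]
    by_cases hE : E = insert v F
    · subst hE
      have h2 : (insert v F).filter (· < v) = F.filter (· < v) := by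
        rw [Finset.filter_insert, if_neg (lt_irrefl v)]
      simp [hv, h2, mul_comm]
    · rw [Finsupp.single_apply, if_neg hE, mul_zero]
      split_ifs with h
      · rw [Finsupp.single_apply, if_neg]
        rintro rfl
        exact hE (Finset.insert_erase h).symm
      · rfl

variable {k}

omit [LinearOrder V] in
theorem finite_chains {Γ : PreAbstractSimplicialComplex V} {S : Finset V}
    (hS : ∀ F ∈ Γ.faces, F ⊆ S) (m : ℕ) : Module.Finite k (chains k Γ m) := by
  have hle : chains k Γ m ≤ Finsupp.supported k k (S.powerset : Set (Finset V)) := by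
    refine Finsupp.supported_mono ?_
    rintro F ⟨h | rfl, -⟩
    · simpa using hS F h
    · simp
  let e := Finsupp.supportedEquivFinsupp (M := k) (R := k) (S.powerset : Set (Finset V))
  have hfin : Module.Finite k (Finsupp.supported k k (S.powerset : Set (Finset V))) :=
    Module.Finite.equiv e.symm
  exact Submodule.finiteDimensional_of_le hle

theorem homologyRank_add_finrank_boundaries {Γ : PreAbstractSimplicialComplex V} {S : Finset V}
    (hS : ∀ F ∈ Γ.faces, F ⊆ S) (m : ℕ) :
    homologyRank k m Γ + Module.finrank k (boundaries k Γ m) =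
      Module.finrank k (cycles k Γ m) := by
  have := finite_chains (k := k) hS m
  have : Module.Finite k (cycles k Γ m) := Submodule.finiteDimensional_of_le inf_le_left
  have h := Submodule.finrank_quotient_add_finrank (R := k) (M := cycles k Γ m)
    ((boundaries k Γ m).submoduleOf (cycles k Γ m))
  rwa [(Submodule.submoduleOfEquivOfLe (boundaries_le_cycles k Γ m)).finrank_eq] at h

theorem homologyRank_eq_zero {Γ : PreAbstractSimplicialComplex V} {m : ℕ}
    (h : cycles k Γ m ≤ boundaries k Γ m) : homologyRank k m Γ = 0 := by
  have : (boundaries k Γ m).submoduleOf (cycles k Γ m) = ⊤ := by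
    rw [Submodule.submoduleOf, Submodule.comap_subtype_eq_top]
    exact h
  have : Subsingleton (Subquotient (cycles k Γ m) (boundaries k Γ m)) :=
    Submodule.Quotient.subsingleton_iff.2 this
  exact Module.finrank_zero_of_subsingleton

/-- The inequality behind the long exact sequence of a pair `Γ' ⊆ Γ` whose relative chain complex
is identified by `φ` with the shifted chain complex of `L`. -/
theorem homologyRank_le_add {Γ Γ' L : PreAbstractSimplicialComplex V} {S : Finset V}
    (hΓ : ∀ F ∈ Γ.faces, F ⊆ S) (hΓ' : Γ'.faces ⊆ Γ.faces) (hL : ∀ F ∈ L.faces, F ⊆ S)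
    {m j : ℕ} (φ : (Finset V →₀ k) →ₗ[k] (Finset V →₀ k)) (s : k)
    (hφ : ∀ c, φ (boundary k c) = s • boundary k (φ c)) (hs : s ≠ 0)
    (hmap : ∀ c ∈ chains k Γ (m + j), φ c ∈ chains k L m)
    (hsurj : ∀ y ∈ chains k L (m + 1), ∃ c ∈ chains k Γ (m + j + 1), φ c = y)
    (hker : ∀ c ∈ chains k Γ (m + j), φ c = 0 → c ∈ chains k Γ' (m + j)) :
    homologyRank k (m + j) Γ ≤ homologyRank k (m + j) Γ' + homologyRank k m L := by
  set Z := cycles k Γ (m + j)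
  set B := boundaries k Γ (m + j)
  set Z' := cycles k Γ' (m + j)
  set B' := boundaries k Γ' (m + j)
  have hmono : ∀ i, chains k Γ' i ≤ chains k Γ i := fun i =>
    Finsupp.supported_mono fun F hF => ⟨hF.1.imp_left (@hΓ' F), hF.2⟩
  have hZ'Z : Z' ≤ Z := inf_le_inf_right _ (hmono _)
  have hB'B : B' ≤ B := Submodule.map_mono (hmono _)
  have hBZ : B ≤ Z := boundaries_le_cycles k Γ _
  have hB'Z' : B' ≤ Z' := boundaries_le_cycles k Γ' _
  have := finite_chains (k := k) hΓ (m + j)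
  have : Module.Finite k Z := Submodule.finiteDimensional_of_le inf_le_left
  have : Module.Finite k Z' := Submodule.finiteDimensional_of_le hZ'Z
  have : Module.Finite k B := Submodule.finiteDimensional_of_le hBZ
  have := finite_chains (k := k) hL m
  have : Module.Finite k (cycles k L m) := Submodule.finiteDimensional_of_le inf_le_left
  have hφZ : ∀ z ∈ Z, φ z ∈ cycles k L m := by
    rintro z ⟨hz, hz0⟩
    refine ⟨hmap z hz, ?_⟩
    have h := hφ z
    rw [LinearMap.mem_ker.1 hz0, map_zero] at h
    exact LinearMap.mem_ker.2 ((smul_eq_zero.1 h.symm).resolve_left hs)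
  let ψ : Z →ₗ[k] Subquotient (cycles k L m) (boundaries k L m) :=
    (Submodule.mkQ _).comp (φ.restrict hφZ)
  -- Exactness in the middle: if `φ z` bounds in `L`, lift the bounding chain to `c` in `Γ`; then `z
  -- - s⁻¹ • ∂c` is a cycle killed by `φ`, hence a cycle of `Γ'`. The rest is a dimension count
  -- using `B' ≤ Z' ⊓ B`.
  have hkerψ : (LinearMap.ker ψ).map Z.subtype ≤ Z' ⊔ B := by
    rintro _ ⟨z, hz, rfl⟩
    have hz' : φ z ∈ boundaries k L m := by
      have := (Submodule.Quotient.mk_eq_zero _).1 (LinearMap.mem_ker.1 hz)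
      exact this
    obtain ⟨y, hy, hyz⟩ := hz'
    obtain ⟨c, hc, rfl⟩ := hsurj y hy
    have hcB : boundary k c ∈ B := ⟨c, hc, rfl⟩
    have hcZ := hBZ hcB
    have hd : Z.subtype z - s⁻¹ • boundary k c ∈ Z :=
      Z.sub_mem z.2 (Z.smul_mem _ hcZ)
    have h0 : φ (Z.subtype z - s⁻¹ • boundary k c) = 0 := by
      rw [map_sub, map_smul, hφ, smul_smul, inv_mul_cancel₀ hs, one_smul, hyz]
      exact sub_self _
    have hd' : Z.subtype z - s⁻¹ • boundary k c ∈ Z' := ⟨hker _ hd.1 h0, hd.2⟩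
    rw [← sub_add_cancel (Z.subtype z) (s⁻¹ • boundary k c)]
    exact Submodule.add_mem_sup hd' (B.smul_mem _ hcB)
  have h1 := LinearMap.finrank_range_add_finrank_ker (K := k) (V := Z)
    (V₂ := Subquotient (cycles k L m) (boundaries k L m)) ψ
  have h2 : Module.finrank k (LinearMap.range ψ) ≤ homologyRank k m L :=
    Submodule.finrank_le _
  have h3 : Module.finrank k (LinearMap.ker ψ) ≤ Module.finrank k (Z' ⊔ B : Submodule k _) := by
    rw [← Submodule.finrank_map_subtype_eq]
    exact Submodule.finrank_mono hkerψ
  have h4 := Submodule.finrank_sup_add_finrank_inf_eq Z' B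
  have h5 : Module.finrank k B' ≤ Module.finrank k (Z' ⊓ B : Submodule k _) :=
    Submodule.finrank_mono (le_inf hB'Z' hB'B)
  have h6 : homologyRank k (m + j) Γ + Module.finrank k B = Module.finrank k Z :=
    homologyRank_add_finrank_boundaries hΓ (m + j)
  have h7 : homologyRank k (m + j) Γ' + Module.finrank k B' = Module.finrank k Z' :=
    homologyRank_add_finrank_boundaries (fun F hF => hΓ F (hΓ' hF)) (m + j)
  omega

/-! ### Clique complexes -/

/-- The complex of the nonempty cliques of `G` in the finite set `S`. -/
def flag (G : SimpleGraph V) (S : Finset V) : PreAbstractSimplicialComplex V where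
  faces := {F | F.Nonempty ∧ F ⊆ S ∧ G.IsClique (F : Set V)}
  isRelLowerSet_faces := by
    rintro F ⟨hne, hS, hc⟩
    exact ⟨hne, fun E hEF hE => ⟨hE, hEF.trans hS, hc.subset (by exact_mod_cast hEF)⟩⟩

omit [LinearOrder V] in
theorem flag_subset (G : SimpleGraph V) (S : Finset V) : ∀ F ∈ (flag G S).faces, F ⊆ S :=
  fun _ hF => hF.2.1

omit [LinearOrder V] in
theorem mem_chains_flag {G : SimpleGraph V} {S : Finset V} {m : ℕ} {c : Finset V →₀ k} :
    c ∈ chains k (flag G S) m ↔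
      ∀ F, c F ≠ 0 → F ⊆ S ∧ G.IsClique (F : Set V) ∧ F.card = m := by
  rw [chains, Finsupp.mem_supported]
  constructor
  · intro h F hF
    obtain ⟨h1 | rfl, h2⟩ := h (Finsupp.mem_support_iff.2 hF)
    · exact ⟨h1.2.1, h1.2.2, h2⟩
    · exact ⟨Finset.empty_subset _, by simp, h2⟩
  · intro h F hF
    obtain ⟨h1, h2, h3⟩ := h F (Finsupp.mem_support_iff.1 hF)
    refine ⟨?_, h3⟩
    rcases F.eq_empty_or_nonempty with h | h
    · exact Or.inr h
    · exact Or.inl ⟨h, h1, h2⟩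

omit [LinearOrder V] in
theorem chains_induction {Γ : PreAbstractSimplicialComplex V} {m : ℕ}
    {p : (Finset V →₀ k) → Prop} (zero : p 0) (add : ∀ x y, p x → p y → p (x + y))
    (single : ∀ F a, Finsupp.single F (1 : k) ∈ chains k Γ m → p (Finsupp.single F a))
    (c : Finset V →₀ k) (hc : c ∈ chains k Γ m) : p c := by
  rw [← Finsupp.sum_single c, Finsupp.sum]
  refine Finset.sum_induction _ p add zero fun F hF => single F _ ?_
  exact Finsupp.single_mem_supported k _ ((Finsupp.mem_supported k c).1 hc hF)

theorem single_mem_chains_flag {G : SimpleGraph V} {S F : Finset V} {m : ℕ} (h1 : F ⊆ S)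
    (h2 : G.IsClique (F : Set V)) (h3 : F.card = m) (a : k) :
    Finsupp.single F a ∈ chains k (flag G S) m := by
  rw [mem_chains_flag]
  intro E hE
  obtain rfl : F = E := by
    by_contra h
    exact hE (Finsupp.single_eq_of_ne (Ne.symm h))
  exact ⟨h1, h2, h3⟩

omit [LinearOrder V] in
theorem of_single_mem_chains_flag {G : SimpleGraph V} {S F : Finset V} {m : ℕ}
    (h : Finsupp.single F (1 : k) ∈ chains k (flag G S) m) :
    F ⊆ S ∧ G.IsClique (F : Set V) ∧ F.card = m :=
  mem_chains_flag.1 h F (by simp)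

open scoped Classical in
/-- The common neighbours in `S` of `v`, i.e. the vertices of its link. -/
noncomputable def nbrs (G : SimpleGraph V) (S : Finset V) (v : V) : Finset V :=
  S.filter (G.Adj v)

omit [LinearOrder V] in
theorem mem_nbrs {G : SimpleGraph V} {S : Finset V} {v w : V} :
    w ∈ nbrs G S v ↔ w ∈ S ∧ G.Adj v w := by
  simp [nbrs]

theorem contract_mem_chains {G : SimpleGraph V} {S : Finset V} {v : V} {m : ℕ}
    {c : Finset V →₀ k} (hc : c ∈ chains k (flag G S) (m + 1)) :
    contract k v c ∈ chains k (flag G (nbrs G S v)) m := by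
  refine chains_induction (p := fun c => contract k v c ∈ chains k (flag G (nbrs G S v)) m)
    (by simp) (fun x y hx hy => by rw [map_add]; exact Submodule.add_mem _ hx hy) ?_ c hc
  intro F a hF
  obtain ⟨h1, h2, h3⟩ := of_single_mem_chains_flag hF
  rw [contract_single]
  split_ifs with hv
  · refine single_mem_chains_flag (fun w hw => ?_) (h2.subset ?_) ?_ _
    · obtain ⟨hwv, hw⟩ := Finset.mem_erase.1 hw
      exact mem_nbrs.2 ⟨h1 hw, h2 hv hw hwv.symm⟩
    · exact_mod_cast Finset.erase_subset _ _
    · rw [Finset.card_erase_of_mem hv, h3]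
      rfl
  · exact Submodule.zero_mem _

/-- Cone each simplex of the link with `v`, using the sign that the contraction cancels. Cliqueness
survives because the link consists of neighbours of `v`. -/
theorem exists_contract_eq {G : SimpleGraph V} {S : Finset V} {v : V} (hv : v ∈ S) {m : ℕ}
    {y : Finset V →₀ k} (hy : y ∈ chains k (flag G (nbrs G S v)) m) :
    ∃ c ∈ chains k (flag G S) (m + 1), contract k v c = y := by
  refine chains_induction (p := fun y => ∃ c ∈ chains k (flag G S) (m + 1), contract k v c = y)
    ⟨0, by simp⟩ ?_ ?_ y hy
  · rintro _ _ ⟨c, hc, rfl⟩ ⟨d, hd, rfl⟩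
    exact ⟨c + d, Submodule.add_mem _ hc hd, map_add _ _ _⟩
  · intro F a hF
    obtain ⟨h1, h2, h3⟩ := of_single_mem_chains_flag hF
    have hvF : v ∉ F := fun h => (mem_nbrs.1 (h1 h)).2.ne rfl
    refine ⟨Finsupp.single (insert v F) (a * (-1 : k) ^ ((insert v F).filter (· < v)).card),
      single_mem_chains_flag ?_ ?_ ?_ _, ?_⟩
    · exact Finset.insert_subset hv fun w hw => (mem_nbrs.1 (h1 hw)).1
    · rw [Finset.coe_insert]
      exact h2.insert fun w hw _ => (mem_nbrs.1 (h1 hw)).2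
    · rw [Finset.card_insert_of_notMem hvF, h3]
    · rw [contract_single, if_pos (Finset.mem_insert_self _ _), Finset.erase_insert hvF, mul_assoc,
        ← pow_add, Even.neg_one_pow ⟨_, rfl⟩, mul_one]

theorem apply_eq_zero_of_contract_eq_zero {v : V} {c : Finset V →₀ k} (h : contract k v c = 0)
    {F : Finset V} (hv : v ∈ F) : c F = 0 := by
  have := contract_apply k v c (F.erase v) (Finset.notMem_erase v F)
  rw [h, Finset.insert_erase hv, Finsupp.zero_apply] at this
  exact (mul_eq_zero.1 this.symm).resolve_left (pow_ne_zero _ (neg_ne_zero.2 one_ne_zero))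

/-- Removing a vertex changes the Betti numbers by at most those of its link. -/
theorem homologyRank_flag_le_erase (G : SimpleGraph V) {S : Finset V} {v : V} (hv : v ∈ S)
    (m : ℕ) : homologyRank k (m + 1) (flag G S) ≤
      homologyRank k (m + 1) (flag G (S.erase v)) + homologyRank k m (flag G (nbrs G S v)) := by
  refine homologyRank_le_add (S := S) (flag_subset G S) ?_ ?_ (contract k v) (-1) ?_
    (neg_ne_zero.2 one_ne_zero) (fun c hc => contract_mem_chains hc)
    (fun y hy => exists_contract_eq hv hy) ?_
  · rintro F ⟨h1, h2, h3⟩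
    exact ⟨h1, h2.trans (Finset.erase_subset _ _), h3⟩
  · exact fun F hF w hw => (mem_nbrs.1 (hF.2.1 hw)).1
  · intro c
    rw [contract_boundary, neg_one_smul]
  · intro c hc h0
    rw [mem_chains_flag] at hc ⊢
    intro F hF
    obtain ⟨h1, h2⟩ := hc F hF
    refine ⟨fun w hw => Finset.mem_erase.2 ⟨?_, h1 hw⟩, h2⟩
    rintro rfl
    exact hF (apply_eq_zero_of_contract_eq_zero h0 hw)

/-- Removing an edge changes the Betti numbers by at most those of its link. -/
theorem homologyRank_flag_le_deleteEdge (G : SimpleGraph V) {S : Finset V} {u v : V}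
    (hu : u ∈ S) (hv : v ∈ S) (huv : G.Adj u v) (m : ℕ) :
    homologyRank k (m + 2) (flag G S) ≤ homologyRank k (m + 2) (flag (G.deleteEdges {s(u, v)}) S) +
      homologyRank k m (flag G (nbrs G (nbrs G S v) u)) := by
  refine homologyRank_le_add (S := S) (flag_subset G S) ?_ ?_ ((contract k u).comp (contract k v)) 1
    ?_ one_ne_zero (fun c hc => contract_mem_chains (contract_mem_chains hc)) ?_ ?_
  · rintro F ⟨h1, h2, h3⟩
    exact ⟨h1, h2, h3.mono (SimpleGraph.deleteEdges_le _)⟩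
  · exact fun F hF w hw => (mem_nbrs.1 (mem_nbrs.1 (hF.2.1 hw)).1).1
  · intro c
    simp only [LinearMap.comp_apply, contract_boundary, map_neg, neg_neg, one_smul]
  · intro y hy
    obtain ⟨c, hc, rfl⟩ := exists_contract_eq (mem_nbrs.2 ⟨hu, huv.symm⟩) hy
    obtain ⟨d, hd, rfl⟩ := exists_contract_eq hv hc
    exact ⟨d, hd, rfl⟩
  · intro c hc h0
    rw [mem_chains_flag] at hc ⊢
    intro F hF
    obtain ⟨h1, h2, h3⟩ := hc F hF
    refine ⟨h1, fun a ha b hb hab => ?_, h3⟩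
    rw [SimpleGraph.deleteEdges_adj]
    refine ⟨h2 ha hb hab, fun h => hF ?_⟩
    have huF : u ∈ F ∧ v ∈ F := by
      rcases Sym2.eq_iff.1 (Set.mem_singleton_iff.1 h) with ⟨rfl, rfl⟩ | ⟨rfl, rfl⟩
      · exact ⟨ha, hb⟩
      · exact ⟨hb, ha⟩
    have hz := apply_eq_zero_of_contract_eq_zero (v := u) (c := contract k v c) h0
      (F := F.erase v) (Finset.mem_erase.2 ⟨huv.ne, huF.1⟩)
    rw [contract_apply k v c _ (Finset.notMem_erase v F), Finset.insert_erase huF.2] at hz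
    exact (mul_eq_zero.1 hz).resolve_left (pow_ne_zero _ (neg_ne_zero.2 one_ne_zero))

theorem homologyRank_flag_empty (G : SimpleGraph V) (m : ℕ) :
    homologyRank k (m + 1) (flag G ∅) = 0 := by
  refine homologyRank_eq_zero fun c hc => ?_
  have : c = 0 := by
    by_contra h
    obtain ⟨F, hF⟩ := Finsupp.ne_iff.1 h
    obtain ⟨h1, -, h3⟩ := mem_chains_flag.1 hc.1 F hF
    rw [Finset.subset_empty.1 h1] at h3
    simp at h3
  rw [this]
  exact Submodule.zero_mem _

theorem boundary_single_vertex (v : V) :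
    boundary k (Finsupp.single {v} 1) = Finsupp.single ∅ 1 := by
  rw [boundary_single]
  simp [Finset.filter_singleton]

theorem homologyRank_zero_flag (G : SimpleGraph V) {S : Finset V} (hS : S.Nonempty) :
    homologyRank k 0 (flag G S) = 0 := by
  obtain ⟨v, hv⟩ := hS
  refine homologyRank_eq_zero fun c hc => ?_
  have : c = c ∅ • boundary k (Finsupp.single {v} 1) := by
    rw [boundary_single_vertex]
    ext F
    by_cases hF : F = ∅
    · simp [hF]
    · rw [Finsupp.smul_single, Finsupp.single_eq_of_ne hF]
      by_contra h
      exact hF (Finset.card_eq_zero.1 (mem_chains_flag.1 hc.1 F h).2.2)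
  rw [this]
  refine Submodule.smul_mem _ _ ⟨_, single_mem_chains_flag (G := G) (S := S) ?_ ?_ ?_ 1, rfl⟩
  · simpa using hv
  · simp
  · simp

omit [LinearOrder V] in
theorem exists_sub_smul_mem {G : SimpleGraph V} {S : Finset V} {r : V}
    {B : Submodule k (Finset V →₀ k)}
    (h : ∀ v ∈ S, Finsupp.single {v} (1 : k) - Finsupp.single {r} 1 ∈ B)
    {c : Finset V →₀ k} (hc : c ∈ chains k (flag G S) 1) :
    ∃ a : k, c - a • Finsupp.single {r} 1 ∈ B := by
  refine chains_induction (p := fun c => ∃ a : k, c - a • Finsupp.single {r} 1 ∈ B)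
    ⟨0, by rw [zero_smul, sub_zero]; exact B.zero_mem⟩ ?_ ?_ c hc
  · rintro x y ⟨a, ha⟩ ⟨b, hb⟩
    refine ⟨a + b, ?_⟩
    rw [add_smul, add_sub_add_comm]
    exact B.add_mem ha hb
  · intro F a hF
    obtain ⟨h1, -, h3⟩ := of_single_mem_chains_flag hF
    obtain ⟨v, rfl⟩ := Finset.card_eq_one.1 h3
    refine ⟨a, ?_⟩
    have := B.smul_mem a (h v (h1 (Finset.mem_singleton_self v)))
    rwa [smul_sub, Finsupp.smul_single, smul_eq_mul, mul_one] at this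

/-- A clique complex with nonzero reduced homology in dimension `0` is disconnected. -/
theorem exists_separation (G : SimpleGraph V) {S : Finset V}
    (h : homologyRank k 1 (flag G S) ≠ 0) :
    ∃ A ⊆ S, A.Nonempty ∧ (S \ A).Nonempty ∧ ∀ a ∈ A, ∀ b ∈ S \ A, ¬ G.Adj a b := by
  classical
  rcases S.eq_empty_or_nonempty with rfl | ⟨r, hr⟩
  · exact absurd (homologyRank_flag_empty G 0) h
  -- The vertices homologous to the base vertex `r`, i.e. its connected component. If `A` were all
  -- of `S`, every cycle would be a boundary plus a multiple of `r`, and the augmentation forces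
  -- that multiple to vanish.
  let A := S.filter fun v =>
    Finsupp.single {v} (1 : k) - Finsupp.single {r} 1 ∈ boundaries k (flag G S) 1
  have hA : ∀ {v}, v ∈ A ↔ v ∈ S ∧
      Finsupp.single {v} (1 : k) - Finsupp.single {r} 1 ∈ boundaries k (flag G S) 1 :=
    fun {v} => by simp [A]
  refine ⟨A, Finset.filter_subset _ _, ⟨r, hA.2 ⟨hr, by simp⟩⟩, ?_, ?_⟩
  · by_contra hne
    have hall : ∀ v ∈ S, v ∈ A := fun v hv => by
      by_contra hvA
      exact hne ⟨v, Finset.mem_sdiff.2 ⟨hv, hvA⟩⟩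
    refine h (homologyRank_eq_zero fun c hc => ?_)
    obtain ⟨a, ha⟩ := exists_sub_smul_mem (fun v hv => (hA.1 (hall v hv)).2) hc.1
    have h0 := LinearMap.mem_ker.1 (boundaries_le_cycles k _ _ ha).2
    rw [map_sub, LinearMap.mem_ker.1 hc.2, map_smul, boundary_single_vertex,
      zero_sub, neg_eq_zero, Finsupp.smul_single, smul_eq_mul, mul_one,
      Finsupp.single_eq_zero] at h0
    rwa [h0, zero_smul, sub_zero] at ha
  · intro a ha b hb hab
    obtain ⟨hbS, hbA⟩ := Finset.mem_sdiff.1 hb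
    obtain ⟨haS, haA⟩ := hA.1 ha
    refine hbA (hA.2 ⟨hbS, ?_⟩)
    have hne := hab.ne
    have hclique : G.IsClique (({a, b} : Finset V) : Set V) := by
      rw [Finset.coe_pair, SimpleGraph.isClique_pair]
      exact fun _ => hab
    have hmem : Finsupp.single {a, b} (1 : k) ∈ chains k (flag G S) 2 :=
      single_mem_chains_flag (by
        intro w hw
        rcases Finset.mem_insert.1 hw with rfl | hw
        · exact haS
        · rwa [Finset.mem_singleton.1 hw]) hclique (Finset.card_pair hne) 1
    have h1 : boundary k (Finsupp.single {a, b} (1 : k)) ∈ boundaries k (flag G S) 1 :=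
      ⟨_, hmem, rfl⟩
    have hea : ({a, b} : Finset V).erase a = {b} := by
      ext w
      simp only [Finset.mem_erase, Finset.mem_insert, Finset.mem_singleton]
      constructor
      · tauto
      · rintro rfl
        exact ⟨hne.symm, Or.inr rfl⟩
    have heb : ({a, b} : Finset V).erase b = {a} := by
      ext w
      simp only [Finset.mem_erase, Finset.mem_insert, Finset.mem_singleton]
      constructor
      · tauto
      · rintro rfl
        exact ⟨hne, Or.inl rfl⟩
    rw [boundary_single, one_smul, Finset.sum_pair hne, hea, heb] at h1
    have key : Finsupp.single {b} (1 : k) - Finsupp.single {a} 1 ∈ boundaries k (flag G S) 1 := by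
      rcases lt_or_gt_of_ne hne with hlt | hlt
      · have e1 : ({a, b} : Finset V).filter (· < a) = ∅ := by
          ext w
          simp only [Finset.mem_filter, Finset.mem_insert, Finset.mem_singleton,
            Finset.notMem_empty, iff_false]
          rintro ⟨rfl | rfl, hw⟩
          · exact lt_irrefl _ hw
          · exact lt_asymm hlt hw
        have e2 : ({a, b} : Finset V).filter (· < b) = {a} := by
          ext w
          simp only [Finset.mem_filter, Finset.mem_insert, Finset.mem_singleton]
          constructor
          · rintro ⟨rfl | rfl, hw⟩
            · rfl
            · exact absurd hw (lt_irrefl _)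
          · rintro rfl
            exact ⟨Or.inl rfl, hlt⟩
        rw [e1, e2] at h1
        simpa [sub_eq_add_neg, Finsupp.single_neg] using h1
      · have e1 : ({a, b} : Finset V).filter (· < a) = {b} := by
          ext w
          simp only [Finset.mem_filter, Finset.mem_insert, Finset.mem_singleton]
          constructor
          · rintro ⟨rfl | rfl, hw⟩
            · exact absurd hw (lt_irrefl _)
            · rfl
          · rintro rfl
            exact ⟨Or.inr rfl, hlt⟩
        have e2 : ({a, b} : Finset V).filter (· < b) = ∅ := by
          ext w
          simp only [Finset.mem_filter, Finset.mem_insert, Finset.mem_singleton,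
            Finset.notMem_empty, iff_false]
          rintro ⟨rfl | rfl, hw⟩
          · exact lt_asymm hlt hw
          · exact lt_irrefl _ hw
        rw [e1, e2] at h1
        have := Submodule.neg_mem _ h1
        simpa [sub_eq_add_neg, Finsupp.single_neg, add_comm] using this
    have := Submodule.add_mem _ key haA
    rwa [sub_add_sub_cancel] at this

/-- Add the vertices one by one: only a vertex without neighbours can raise the rank, by one, and
such a vertex opens a new cell. -/
theorem homologyRank_one_flag_le_card_image {ι : Type*} [DecidableEq ι] (G : SimpleGraph V)
    (cell : V → ι) {S : Finset V} (hcell : ∀ x ∈ S, ∀ y ∈ S, cell x = cell y → x ≠ y → G.Adj x y) :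
    homologyRank k 1 (flag G S) ≤ (S.image cell).card := by
  induction S using Finset.induction_on with
  | empty => simp [homologyRank_flag_empty G 0]
  | insert v S hv ih =>
    have h := homologyRank_flag_le_erase (k := k) G (Finset.mem_insert_self v S) 0
    rw [Finset.erase_insert hv] at h
    have ih := ih fun x hx y hy =>
      hcell x (Finset.mem_insert_of_mem hx) y (Finset.mem_insert_of_mem hy)
    by_cases hne : (nbrs G (insert v S) v).Nonempty
    · rw [homologyRank_zero_flag G hne] at h
      exact (h.trans ih).trans
        (Finset.card_le_card (Finset.image_subset_image (Finset.subset_insert v S)))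
    · have h1 : homologyRank k 0 (flag G (nbrs G (insert v S) v)) ≤ 1 := by
        rw [Finset.not_nonempty_iff_eq_empty.1 hne]
        have := (finite_and_finrank_subquotient_le (k := k) (cycles k (flag G ∅) 0)
          (boundaries k (flag G ∅) 0) (Submodule.span k {Finsupp.single ∅ 1}) ?_).2
        · exact this.trans ((finrank_span_le_card _).trans (by simp))
        · intro c hc
          refine Submodule.mem_span_singleton.2 ⟨c ∅, ?_⟩
          ext F
          by_cases hF : F = ∅
          · simp [hF]
          · rw [Finsupp.smul_single, Finsupp.single_eq_of_ne hF]
            by_contra h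
            exact hF (Finset.card_eq_zero.1 (mem_chains_flag.1 hc.1 F (Ne.symm h)).2.2)
      have h2 : cell v ∉ S.image cell := by
        intro hmem
        obtain ⟨w, hw, hwv⟩ := Finset.mem_image.1 hmem
        refine hne ⟨w, mem_nbrs.2 ⟨Finset.mem_insert_of_mem hw, ?_⟩⟩
        exact hcell v (Finset.mem_insert_self _ _) w (Finset.mem_insert_of_mem hw) hwv.symm
          fun h => hv (h ▸ hw)
      rw [Finset.image_insert, Finset.card_insert_of_notMem h2]
      exact h.trans (Nat.add_le_add ih h1)

theorem homologyRank_flag_le_two_pow (G : SimpleGraph V) (S : Finset V) (m : ℕ) :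
    homologyRank k (m + 1) (flag G S) ≤ 2 ^ S.card :=
  (finite_and_bettiNumber_le k m (flag G S) S (flag_subset G S)).2

/-- The clique complex of a graph with a dominating vertex has no reduced homology. -/
theorem homologyRank_flag_of_cone (G : SimpleGraph V) {S : Finset V} {a : V} (ha : a ∈ S)
    (hcone : ∀ w ∈ S, w ≠ a → G.Adj a w) (m : ℕ) : homologyRank k m (flag G S) = 0 := by
  induction hn : S.card using Nat.strong_induction_on generalizing S m with
  | _ n ih =>
    rcases m with _ | m
    · exact homologyRank_zero_flag G ⟨a, ha⟩
    -- Any other vertex `v` can be removed, since both the remaining complex and the link of `v` are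
    -- cones with apex `a`.
    by_cases hS : ∃ v ∈ S, v ≠ a
    · obtain ⟨v, hv, hva⟩ := hS
      have hc := Finset.card_erase_lt_of_mem hv
      have h := homologyRank_flag_le_erase (k := k) G hv m
      rw [ih _ (hn ▸ hc) (Finset.mem_erase.2 ⟨hva.symm, ha⟩)
        (fun w hw => hcone w (Finset.mem_of_mem_erase hw)) (m + 1) rfl] at h
      have hsub : nbrs G S v ⊆ S.erase v := fun w hw =>
        Finset.mem_erase.2 ⟨(mem_nbrs.1 hw).2.ne', (mem_nbrs.1 hw).1⟩
      rw [ih _ (hn ▸ (Finset.card_le_card hsub).trans_lt hc)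
        (mem_nbrs.2 ⟨ha, (hcone v hv hva).symm⟩)
        (fun w hw => hcone w (mem_nbrs.1 hw).1) m rfl] at h
      omega
    · by_contra hne
      rcases m with _ | m
      · obtain ⟨A, hA, ⟨x, hx⟩, ⟨y, hy⟩, -⟩ := exists_separation G hne
        obtain ⟨hyS, hyA⟩ := Finset.mem_sdiff.1 hy
        have e1 : x = a := by_contra fun h => hS ⟨x, hA hx, h⟩
        have e2 : y = a := by_contra fun h => hS ⟨y, hyS, h⟩
        exact hyA (e2 ▸ e1 ▸ hx)
      · have h := homologyRank_flag_le_erase (k := k) G ha (m + 1)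
        have e1 : S.erase a = ∅ := by
          rw [Finset.eq_empty_iff_forall_notMem]
          exact fun w hw => hS ⟨w, Finset.mem_of_mem_erase hw, Finset.ne_of_mem_erase hw⟩
        have e2 : nbrs G S a = ∅ := by
          rw [Finset.eq_empty_iff_forall_notMem]
          exact fun w hw => hS ⟨w, (mem_nbrs.1 hw).1, (mem_nbrs.1 hw).2.ne'⟩
        rw [e1, e2, homologyRank_flag_empty, homologyRank_flag_empty] at h
        exact hne (Nat.le_zero.1 h)

end Homology

end Rips

namespace Rips

/-! ### Removing the edges between critical pairs of cells -/

section Cells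

variable {V ι L : Type*} (R : SimpleGraph V) (S : Finset V) (cell : V → ι)

/-- All vertices of the cell of `x` are adjacent to all vertices of the cell of `y`. -/
def FullyAdjacent (x y : V) : Prop :=
  ∀ x' ∈ S, ∀ y' ∈ S, cell x' = cell x → cell y' = cell y → x' ≠ y' → R.Adj x' y'

variable {R S cell}

theorem FullyAdjacent.symm {x y : V} (h : FullyAdjacent R S cell x y) :
    FullyAdjacent R S cell y x :=
  fun x' hx' y' hy' h1 h2 hne => (h y' hy' x' hx' h2 h1 hne.symm).symm

theorem FullyAdjacent.congr {x y x' y' : V} (h : FullyAdjacent R S cell x y)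
    (hx : cell x' = cell x) (hy : cell y' = cell y) : FullyAdjacent R S cell x' y' :=
  fun a ha b hb h1 h2 => h a ha b hb (h1.trans hx) (h2.trans hy)

variable (R S cell)

/-- The graph of all edges between fully adjacent cells and of the edges in `Q`. -/
def partialGraph (Q : Finset (V × V)) : SimpleGraph V where
  Adj x y := R.Adj x y ∧ (FullyAdjacent R S cell x y ∨ (x, y) ∈ Q ∨ (y, x) ∈ Q)
  symm := ⟨fun _ _ h => ⟨h.1.symm, h.2.imp FullyAdjacent.symm Or.symm⟩⟩
  loopless := ⟨fun _ h => h.1.ne rfl⟩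

variable [LinearOrder ι]

open scoped Classical in
/-- The edges of `R` between different cells that are not fully adjacent, oriented by the order of
the cells. -/
noncomputable def criticalEdges : Finset (V × V) :=
  (S ×ˢ S).filter fun e => cell e.1 < cell e.2 ∧ R.Adj e.1 e.2 ∧ ¬ FullyAdjacent R S cell e.1 e.2

variable [LinearOrder L] (κ : V → V → L)

/-- There is a common neighbour of `u` and `v` outside of their cells that is not adjacent to
any common neighbour in the cells of `u` and `v` which precedes `u` and `v`. -/
def IsolatedWitness (u v w : V) : Prop :=
  w ∈ S ∧ cell w ≠ cell u ∧ cell w ≠ cell v ∧ R.Adj w u ∧ R.Adj w v ∧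
    (∀ u' ∈ S, cell u' = cell u → R.Adj u' v → κ u' v < κ u v → ¬ R.Adj w u') ∧
    ∀ v' ∈ S, cell v' = cell v → R.Adj u v' → κ u v' < κ u v → ¬ R.Adj w v'

/-- The common neighbours preceding `u` and `v` in their cells are mutually nonadjacent. -/
def SplitLink (u v : V) : Prop :=
  (∃ u' ∈ S, cell u' = cell u ∧ R.Adj u' v ∧ κ u' v < κ u v) ∧
  (∃ v' ∈ S, cell v' = cell v ∧ R.Adj u v' ∧ κ u v' < κ u v) ∧
  ∀ u' ∈ S, cell u' = cell u → R.Adj u' v → κ u' v < κ u v →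
    ∀ v' ∈ S, cell v' = cell v → R.Adj u v' → κ u v' < κ u v →
      R.Adj u' v' → κ u v ≤ κ u' v'

open scoped Classical in
/-- The critical edges whose link is disconnected when they are removed. -/
noncomputable def badEdges : Finset (V × V) :=
  (criticalEdges R S cell).filter fun e =>
    (∃ w, IsolatedWitness R S cell κ e.1 e.2 w) ∨ SplitLink R S cell κ e.1 e.2

/-- The order in which critical edges are removed, the greatest first. -/
def edgeKey (e : V × V) : (ι ×ₗ ι) ×ₗ L :=
  toLex (toLex (cell e.1, cell e.2), κ e.1 e.2)

variable {R S cell κ}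

theorem mem_criticalEdges {u v : V} : (u, v) ∈ criticalEdges R S cell ↔
    (u ∈ S ∧ v ∈ S) ∧ cell u < cell v ∧ R.Adj u v ∧ ¬ FullyAdjacent R S cell u v := by
  simp [criticalEdges]

/-- Between different pairs of cells the order ignores `κ`. Hence, relative to an edge being
removed, all critical edges of another pair of cells are still present or all are gone. -/
theorem edgeKey_le_of_cell_lt {a b : V × V} (h : edgeKey cell κ a ≤ edgeKey cell κ b)
    {c : V × V} (h1 : cell c.1 = cell a.1) (h2 : cell c.2 = cell a.2)
    (hne : cell a.1 ≠ cell b.1 ∨ cell a.2 ≠ cell b.2) : edgeKey cell κ c ≤ edgeKey cell κ b := by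
  unfold edgeKey at *
  rw [Prod.Lex.toLex_le_toLex] at h ⊢
  rcases h with h | h
  · rw [h1, h2]
    exact Or.inl h
  · have := toLex_inj.1 h.1
    rw [Prod.mk.injEq] at this
    tauto

theorem edgeKey_le_of_lt {a b : V × V} (h1 : cell a.1 = cell b.1) (h2 : cell a.2 = cell b.2)
    (h : κ a.1 a.2 ≤ κ b.1 b.2) : edgeKey cell κ a ≤ edgeKey cell κ b := by
  unfold edgeKey
  rw [Prod.Lex.toLex_le_toLex, h1, h2]
  exact Or.inr ⟨rfl, h⟩

theorem le_of_edgeKey_le {a b : V × V} (h1 : cell a.1 = cell b.1) (h2 : cell a.2 = cell b.2)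
    (h : edgeKey cell κ a ≤ edgeKey cell κ b) : κ a.1 a.2 ≤ κ b.1 b.2 := by
  unfold edgeKey at h
  rw [Prod.Lex.toLex_le_toLex, h1, h2] at h
  rcases h with h | h
  · exact absurd h (lt_irrefl _)
  · exact h.2

end Cells

/-! ### Cost of removing the critical edges. -/

section Elimination

variable {V ι L : Type*} [LinearOrder V] [LinearOrder ι] [LinearOrder L]
  {k : Type u} [Field k] {R : SimpleGraph V} {S : Finset V} {cell : V → ι} {κ : V → V → L}

omit [LinearOrder V] in
theorem flag_congr {G H : SimpleGraph V} {S : Finset V}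
    (h : ∀ x ∈ S, ∀ y ∈ S, G.Adj x y ↔ H.Adj x y) : flag G S = flag H S := by
  have : (flag G S).faces = (flag H S).faces := by
    ext F
    refine and_congr_right fun _ => and_congr_right fun hF => ?_
    refine forall₂_congr fun a ha => forall₂_congr fun b hb => forall_congr' fun _ => ?_
    exact h a (hF ha) b (hF hb)
  cases hG : flag G S
  cases hH : flag H S
  simpa [hG, hH] using this

omit [LinearOrder V] in
theorem nbrs_mono_left {G H : SimpleGraph V} (h : G ≤ H) {S T : Finset V} (hST : S ⊆ T) (v : V) :
    nbrs G S v ⊆ nbrs H T v := fun _ hw =>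
  mem_nbrs.2 ⟨hST (mem_nbrs.1 hw).1, h (mem_nbrs.1 hw).2⟩

/-- Two vertices of one cell are twins, so either lies in the link of the other as a cone apex and
can be removed for free. Once cells are singletons, a link has at most `C` vertices, so a removal
costs at most `2 ^ C`. -/
theorem homologyRank_partialGraph_empty_le {C : ℕ}
    (hcell : ∀ x ∈ S, ∀ y ∈ S, cell x = cell y → x ≠ y → R.Adj x y)
    (hC : ∀ v ∈ S, ((nbrs R S v).image cell).card ≤ C) {T : Finset V} (hT : T ⊆ S) :
    homologyRank k 3 (flag (partialGraph R S cell ∅) T) ≤ 2 ^ C * T.card := by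
  induction hn : T.card using Nat.strong_induction_on generalizing T with
  | _ n ih =>
    subst hn
    rcases T.eq_empty_or_nonempty with rfl | ⟨v₀, hv₀⟩
    · rw [homologyRank_flag_empty]
      exact Nat.zero_le _
    set G := partialGraph R S cell ∅
    have hGR : G ≤ R := fun _ _ h => h.1
    have hfull : ∀ {x y}, G.Adj x y → FullyAdjacent R S cell x y := fun {x y} h => by
      simpa using h.2
    have hstep : ∀ v ∈ T, homologyRank k 2 (flag G (nbrs G T v)) ≤ 2 ^ C →
        homologyRank k 3 (flag G T) ≤ 2 ^ C * T.card := by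
      intro v hv hle
      have h := homologyRank_flag_le_erase (k := k) G hv 2
      have h' := ih _ (Finset.card_erase_lt_of_mem hv) ((Finset.erase_subset v T).trans hT) rfl
      have hc := Finset.card_erase_add_one hv
      calc _ ≤ 2 ^ C * (T.erase v).card + 2 ^ C := h.trans (Nat.add_le_add h' hle)
        _ = 2 ^ C * T.card := by rw [← hc]; ring
    by_cases hinj : ∃ v ∈ T, ∃ a ∈ T, v ≠ a ∧ cell v = cell a
    · obtain ⟨v, hv, a, ha, hva, hc⟩ := hinj
      refine hstep v hv ?_
      rw [homologyRank_flag_of_cone G (a := a)]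
      · exact Nat.zero_le _
      · refine mem_nbrs.2 ⟨ha, hcell v (hT hv) a (hT ha) hc hva, Or.inl ?_⟩
        intro x hx y hy h1 h2 hne
        exact hcell x hx y hy (h1.trans (hc.trans h2.symm)) hne
      · intro w hw hwa
        obtain ⟨hwT, hvw⟩ := mem_nbrs.1 hw
        have hf := (hfull hvw).congr hc.symm rfl
        exact ⟨hf a (hT ha) w (hT hwT) rfl rfl hwa.symm, Or.inl hf⟩
    · refine hstep v₀ hv₀ ((homologyRank_flag_le_two_pow G _ 1).trans
        (Nat.pow_le_pow_right two_pos ?_))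
      refine le_trans ?_ (hC v₀ (hT hv₀))
      rw [← Finset.card_image_of_injOn (f := cell) (s := nbrs G T v₀)]
      · exact Finset.card_le_card (Finset.image_subset_image (nbrs_mono_left hGR hT v₀))
      · intro x hx y hy hxy
        by_contra hne
        exact hinj ⟨x, (mem_nbrs.1 hx).1, y, (mem_nbrs.1 hy).1, hne, hxy⟩

/-- The link of `uv` meets the cells of `u` and `v` exactly in the points preceding `u` and `v`, and
each of these two sets is a clique. If the link is disconnected, either some part misses both
cliques, which yields an isolated witness, or the cliques lie in different parts, which yields a
split link. -/
theorem homologyRank_link_eq_zero {u v : V} (he : (u, v) ∈ criticalEdges R S cell)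
    (hκ : ∀ u ∈ S, ∀ v ∈ S, ∀ u' ∈ S, ∀ v' ∈ S, κ u v = κ u' v' → u = u' ∧ v = v')
    (hcell : ∀ x ∈ S, ∀ y ∈ S, cell x = cell y → x ≠ y → R.Adj x y)
    (hA : ∀ w, ¬ IsolatedWitness R S cell κ u v w) (hB : ¬ SplitLink R S cell κ u v)
    {G : SimpleGraph V} (hG : G = partialGraph R S cell
      ((criticalEdges R S cell).filter fun e => edgeKey cell κ e ≤ edgeKey cell κ (u, v))) :
    homologyRank k 1 (flag G (nbrs G (nbrs G S v) u)) = 0 := by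
  by_contra hne
  obtain ⟨⟨hu, hv⟩, hlt, huv, hcrit⟩ := mem_criticalEdges.1 he
  obtain ⟨A, hAT, ⟨x, hx⟩, ⟨y, hy⟩, hAB⟩ := exists_separation G hne
  set T := nbrs G (nbrs G S v) u
  have hT : ∀ {w}, w ∈ T ↔ w ∈ S ∧ G.Adj v w ∧ G.Adj u w := fun {w} => by
    simp only [T, mem_nbrs, and_assoc]
  have hsame : ∀ {x y}, x ∈ S → y ∈ S → cell x = cell y → x ≠ y → G.Adj x y := by
    intro x y hx hy h hxy
    rw [hG]
    exact ⟨hcell x hx y hy h hxy, Or.inl fun a ha b hb h1 h2 =>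
      hcell a ha b hb (h1.trans (h.trans h2.symm))⟩
  have hadj : ∀ {u' v'}, u' ∈ S → v' ∈ S → cell u' = cell u → cell v' = cell v →
      (G.Adj u' v' ↔ R.Adj u' v' ∧ κ u' v' ≤ κ u v) := by
    intro u' v' hu' hv' h1 h2
    have hcr : R.Adj u' v' → (u', v') ∈ criticalEdges R S cell := fun h => by
      refine mem_criticalEdges.2 ⟨⟨hu', hv'⟩, by rwa [h1, h2], h, fun hf => ?_⟩
      exact hcrit (hf.congr h1.symm h2.symm)
    rw [hG]
    constructor
    · rintro ⟨h, h' | h' | h'⟩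
      · exact absurd (h'.congr h1.symm h2.symm) hcrit
      · exact ⟨h, le_of_edgeKey_le (a := (u', v')) (b := (u, v)) h1 h2 (Finset.mem_filter.1 h').2⟩
      · have := (mem_criticalEdges.1 (Finset.mem_filter.1 h').1).2.1
        rw [h1, h2] at this
        exact absurd this (lt_asymm hlt)
    · rintro ⟨h, h'⟩
      exact ⟨h, Or.inr (Or.inl (Finset.mem_filter.2 ⟨hcr h,
        edgeKey_le_of_lt (a := (u', v')) (b := (u, v)) h1 h2 h'⟩))⟩
  let PU : V → Prop := fun u' => u' ∈ S ∧ cell u' = cell u ∧ R.Adj u' v ∧ κ u' v < κ u v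
  let PV : V → Prop := fun v' => v' ∈ S ∧ cell v' = cell v ∧ R.Adj u v' ∧ κ u v' < κ u v
  have hPU : ∀ {u'}, PU u' → u' ∈ T := by
    rintro u' ⟨h1, h2, h3, h4⟩
    refine hT.2 ⟨h1, ((hadj h1 hv h2 rfl).2 ⟨h3, h4.le⟩).symm, hsame hu h1 h2.symm ?_⟩
    rintro rfl
    exact lt_irrefl _ h4
  have hPV : ∀ {v'}, PV v' → v' ∈ T := by
    rintro v' ⟨h1, h2, h3, h4⟩
    refine hT.2 ⟨h1, hsame hv h1 h2.symm ?_, (hadj hu h1 rfl h2).2 ⟨h3, h4.le⟩⟩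
    rintro rfl
    exact lt_irrefl _ h4
  have hTU : ∀ {w}, w ∈ T → cell w = cell u → PU w := by
    intro w hw h
    obtain ⟨h1, h2, h3⟩ := hT.1 hw
    obtain ⟨h4, h5⟩ := (hadj h1 hv h rfl).1 h2.symm
    exact ⟨h1, h, h4, lt_of_le_of_ne h5 fun h => h3.ne (hκ _ h1 _ hv _ hu _ hv h).1.symm⟩
  have hTV : ∀ {w}, w ∈ T → cell w = cell v → PV w := by
    intro w hw h
    obtain ⟨h1, h2, h3⟩ := hT.1 hw
    obtain ⟨h4, h5⟩ := (hadj hu h1 rfl h).1 h3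
    exact ⟨h1, h, h4, lt_of_le_of_ne h5 fun h => h2.ne (hκ _ hu _ h1 _ hu _ hv h).2.symm⟩
  have hsep : ∀ {a b}, a ∈ T → b ∈ T → G.Adj a b → (a ∈ A ↔ b ∈ A) := by
    intro a b ha hb hab
    by_contra hiff
    by_cases haA : a ∈ A
    · exact hAB a haA b (Finset.mem_sdiff.2 ⟨hb, fun hbA => hiff (by tauto)⟩) hab
    · exact hAB b (by tauto) a (Finset.mem_sdiff.2 ⟨ha, haA⟩) hab.symm
  have hUU : ∀ {a b}, PU a → PU b → (a ∈ A ↔ b ∈ A) := by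
    intro a b ha hb
    by_cases hab : a = b
    · rw [hab]
    · exact hsep (hPU ha) (hPU hb) (hsame ha.1 hb.1 (ha.2.1.trans hb.2.1.symm) hab)
  have hVV : ∀ {a b}, PV a → PV b → (a ∈ A ↔ b ∈ A) := by
    intro a b ha hb
    by_cases hab : a = b
    · rw [hab]
    · exact hsep (hPV ha) (hPV hb) (hsame ha.1 hb.1 (ha.2.1.trans hb.2.1.symm) hab)
  -- A vertex `w` of the link on a side without preceding points lies outside both cells, and it is
  -- an isolated witness.
  have hwit : ∀ w ∈ T, (∀ a, PU a ∨ PV a → ¬ (a ∈ A ↔ w ∈ A)) → False := by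
    intro w hw hno
    obtain ⟨h1, h2, h3⟩ := hT.1 hw
    have hwu : cell w ≠ cell u := fun h => hno w (Or.inl (hTU hw h)) Iff.rfl
    have hwv : cell w ≠ cell v := fun h => hno w (Or.inr (hTV hw h)) Iff.rfl
    -- An `R`-edge from `w` to the cell of `z` survives in `G`: its pair of cells is that of the
    -- surviving edge `zw` and differs from that of `uv`, so its key is also below that of `uv`.
    have hRG : ∀ {z z'}, z' ∈ S → cell z' = cell z → z = u ∨ z = v → G.Adj z w → R.Adj w z' →
        G.Adj w z' := by
      intro z z' hz' hc hz hzw hwz'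
      rw [hG] at hzw ⊢
      have hzcell : cell w ≠ cell z := by rcases hz with rfl | rfl <;> assumption
      have hcr : ¬ FullyAdjacent R S cell z w →
          (z', w) ∈ criticalEdges R S cell ∨ (w, z') ∈ criticalEdges R S cell := by
        intro hnf
        rcases lt_or_gt_of_ne hzcell with h | h
        · refine Or.inr (mem_criticalEdges.2 ⟨⟨h1, hz'⟩, hc ▸ h, hwz', fun hf => ?_⟩)
          exact hnf (hf.symm.congr hc.symm rfl)
        · refine Or.inl (mem_criticalEdges.2 ⟨⟨hz', h1⟩, hc ▸ h, hwz'.symm, fun hf => ?_⟩)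
          exact hnf (hf.congr hc.symm rfl)
      refine ⟨hwz', ?_⟩
      by_cases hf : FullyAdjacent R S cell z w
      · exact Or.inl (hf.symm.congr rfl hc)
      right
      rcases hzw.2 with h | h | h
      · exact absurd h hf
      · obtain ⟨hm, hk⟩ := Finset.mem_filter.1 h
        have hlt' := (mem_criticalEdges.1 hm).2.1
        refine Or.inr (Finset.mem_filter.2 ⟨?_, ?_⟩)
        · refine (hcr hf).resolve_right fun h' => ?_
          have := (mem_criticalEdges.1 h').2.1
          rw [hc] at this
          exact lt_asymm hlt' this
        · exact edgeKey_le_of_cell_lt hk hc rfl (Or.inr hwv)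
      · obtain ⟨hm, hk⟩ := Finset.mem_filter.1 h
        have hlt' := (mem_criticalEdges.1 hm).2.1
        refine Or.inl (Finset.mem_filter.2 ⟨?_, ?_⟩)
        · refine (hcr hf).resolve_left fun h' => ?_
          have := (mem_criticalEdges.1 h').2.1
          rw [hc] at this
          exact lt_asymm hlt' this
        · exact edgeKey_le_of_cell_lt hk rfl hc (Or.inl hwu)
    have hGR : G ≤ R := by
      rw [hG]
      exact fun _ _ h => h.1
    refine hA w ⟨h1, hwu, hwv, (hGR h3).symm, (hGR h2).symm, ?_, ?_⟩
    · intro u' hu' hc ha hk hw'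
      exact hno u' (Or.inl ⟨hu', hc, ha, hk⟩)
        (hsep (hPU ⟨hu', hc, ha, hk⟩) hw (hRG hu' hc (Or.inl rfl) h3 hw').symm)
    · intro v' hv' hc ha hk hw'
      exact hno v' (Or.inr ⟨hv', hc, ha, hk⟩)
        (hsep (hPV ⟨hv', hc, ha, hk⟩) hw (hRG hv' hc (Or.inr rfl) h2 hw').symm)
  obtain ⟨hyT, hyA⟩ := Finset.mem_sdiff.1 hy
  have hsplit : ∀ {a b}, PU a → PV b → (a ∈ A ↔ b ∈ A) := by
    intro a b ha hb
    by_contra hiff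
    refine hB ⟨⟨a, ha⟩, ⟨b, hb⟩, ?_⟩
    intro u' h1 h2 h3 h4 v' h5 h6 h7 h8 h9
    by_contra hlt'
    have hu' : PU u' := ⟨h1, h2, h3, h4⟩
    have hv' : PV v' := ⟨h5, h6, h7, h8⟩
    have := hsep (hPU hu') (hPV hv') ((hadj h1 h5 h2 h6).2 ⟨h9, (not_le.1 hlt').le⟩)
    exact hiff ((hUU ha hu').trans (this.trans (hVV hv' hb)))
  refine hwit x (hAT hx) fun a ha hax => hwit y hyT fun b hb hby => ?_
  have haA : a ∈ A := hax.2 hx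
  have hbA : b ∉ A := fun h => hyA (hby.1 h)
  rcases ha with ha | ha <;> rcases hb with hb | hb
  · exact hbA ((hUU ha hb).1 haA)
  · exact hbA ((hsplit ha hb).1 haA)
  · exact hbA ((hsplit hb ha).2 haA)
  · exact hbA ((hVV ha hb).1 haA)

-- Peel off the edge of greatest key. Keys are injective, so the graph at the moment when a smaller
-- edge is removed does not involve the peeled one.
open scoped Classical in
theorem homologyRank_partialGraph_le_sum
    (hκ : ∀ u ∈ S, ∀ v ∈ S, ∀ u' ∈ S, ∀ v' ∈ S, κ u v = κ u' v' → u = u' ∧ v = v')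
    {f : V × V → ℕ} {E : Finset (V × V)} (hE : E ⊆ criticalEdges R S cell)
    (hf : ∀ e ∈ E, ∀ G, G = partialGraph R S cell
      (E.filter fun e' => edgeKey cell κ e' ≤ edgeKey cell κ e) →
      homologyRank k 1 (flag G (nbrs G (nbrs G S e.2) e.1)) ≤ f e) :
    homologyRank k 3 (flag (partialGraph R S cell E) S) ≤
      homologyRank k 3 (flag (partialGraph R S cell ∅) S) + ∑ e ∈ E, f e := by
  induction E using Finset.induction_on_max_value (edgeKey cell κ) with
  | empty => simp
  | insert a s ha hmax ih =>
    obtain ⟨u, v⟩ := a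
    have hs : s ⊆ criticalEdges R S cell := (Finset.subset_insert _ _).trans hE
    have hae := hE (Finset.mem_insert_self _ s)
    obtain ⟨⟨hu, hv⟩, hlt, huv, hcrit⟩ := mem_criticalEdges.1 hae
    have hinj : ∀ e ∈ s, ¬ edgeKey cell κ (u, v) ≤ edgeKey cell κ e := by
      rintro ⟨u', v'⟩ he hle
      obtain ⟨⟨hu', hv'⟩, -⟩ := mem_criticalEdges.1 (hs he)
      have heq := le_antisymm hle (hmax _ he)
      have := (Prod.mk.injEq _ _ _ _ ▸ (toLex_inj.1 heq) :
        (toLex (cell u, cell v) = toLex (cell u', cell v')) ∧ κ u v = κ u' v').2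
      obtain ⟨rfl, rfl⟩ := hκ _ hu _ hv _ hu' _ hv' this
      exact ha he
    have ih := ih hs fun e he G hG => by
      refine hf e (Finset.mem_insert_of_mem he) G ?_
      rw [hG, Finset.filter_insert, if_neg (hinj e he)]
    have hfull : (insert (u, v) s).filter (fun e' => edgeKey cell κ e' ≤ edgeKey cell κ (u, v)) =
        insert (u, v) s := by
      refine Finset.filter_true_of_mem fun e he => ?_
      rcases Finset.mem_insert.1 he with rfl | he
      · exact le_rfl
      · exact hmax e he
    have hlink := hf (u, v) (Finset.mem_insert_self _ _) _ (by rw [hfull])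
    have hadj : (partialGraph R S cell (insert (u, v) s)).Adj u v :=
      ⟨huv, Or.inr (Or.inl (Finset.mem_insert_self _ _))⟩
    have hdel : (partialGraph R S cell (insert (u, v) s)).deleteEdges {s(u, v)} =
        partialGraph R S cell s := by
      ext x y
      rw [SimpleGraph.deleteEdges_adj, Set.mem_singleton_iff, Sym2.eq_iff]
      constructor
      · rintro ⟨⟨h1, h2⟩, h3⟩
        refine ⟨h1, h2.imp_right (Or.imp ?_ ?_)⟩
        · intro h
          refine (Finset.mem_insert.1 h).resolve_left fun h => h3 (Or.inl ?_)
          exact Prod.mk.inj h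
        · intro h
          refine (Finset.mem_insert.1 h).resolve_left fun h => h3 (Or.inr ?_)
          exact (Prod.mk.inj h).symm
      · rintro ⟨h1, h2⟩
        refine ⟨⟨h1, h2.imp_right (Or.imp (Finset.mem_insert_of_mem ·)
          (Finset.mem_insert_of_mem ·))⟩, ?_⟩
        have hno : (v, u) ∉ s := fun h => lt_asymm hlt (mem_criticalEdges.1 (hs h)).2.1
        rintro (⟨rfl, rfl⟩ | ⟨rfl, rfl⟩)
        · rcases h2 with h | h | h
          · exact hcrit h
          · exact ha h
          · exact hno h
        · rcases h2 with h | h | h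
          · exact hcrit h.symm
          · exact hno h
          · exact ha h
    have h := homologyRank_flag_le_deleteEdge (k := k) _ hu hv hadj 1
    rw [hdel] at h
    rw [Finset.sum_insert ha]
    have h' : homologyRank k 3 (flag (partialGraph R S cell (insert (u, v) s)) S) ≤
        homologyRank k 3 (flag (partialGraph R S cell s) S) + f (u, v) :=
      h.trans (Nat.add_le_add_left hlink _)
    omega

/-- The second Betti number of a clique complex is bounded by the number of bad edges, if every
neighbourhood meets a bounded number of cells and every cell is a clique. -/
theorem homologyRank_three_flag_le {C : ℕ}
    (hκ : ∀ u ∈ S, ∀ v ∈ S, ∀ u' ∈ S, ∀ v' ∈ S, κ u v = κ u' v' → u = u' ∧ v = v')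
    (hcell : ∀ x ∈ S, ∀ y ∈ S, cell x = cell y → x ≠ y → R.Adj x y)
    (hC : ∀ v ∈ S, ((nbrs R S v).image cell).card ≤ C) :
    homologyRank k 3 (flag R S) ≤ 2 ^ C * S.card + C * (badEdges R S cell κ).card := by
  classical
  have hflag : flag R S = flag (partialGraph R S cell (criticalEdges R S cell)) S := by
    refine flag_congr fun x hx y hy => ⟨fun h => ⟨h, ?_⟩, fun h => h.1⟩
    by_cases hf : FullyAdjacent R S cell x y
    · exact Or.inl hf
    right
    rcases lt_trichotomy (cell x) (cell y) with hlt | heq | hlt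
    · exact Or.inl (mem_criticalEdges.2 ⟨⟨hx, hy⟩, hlt, h, hf⟩)
    · exact absurd (fun a ha b hb h1 h2 => hcell a ha b hb (h1.trans (heq.trans h2.symm))) hf
    · exact Or.inr (mem_criticalEdges.2 ⟨⟨hy, hx⟩, hlt, h.symm, fun h => hf h.symm⟩)
  rw [hflag]
  refine (homologyRank_partialGraph_le_sum (κ := κ)
    (f := fun e => if e ∈ badEdges R S cell κ then C else 0) hκ subset_rfl ?_).trans ?_
  · rintro ⟨u, v⟩ he G hG
    dsimp only
    split_ifs with hbad
    · have hGR : G ≤ R := by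
        rw [hG]
        exact fun _ _ h => h.1
      have hu := (mem_criticalEdges.1 he).1.1
      have hsub : nbrs G (nbrs G S v) u ⊆ nbrs R S u :=
        nbrs_mono_left hGR (fun w hw => (mem_nbrs.1 hw).1) u
      refine (homologyRank_one_flag_le_card_image G cell ?_).trans
        ((Finset.card_le_card (Finset.image_subset_image hsub)).trans (hC u hu))
      intro x hx y hy hxy hne
      rw [hG]
      have hx := (mem_nbrs.1 (hsub hx)).1
      have hy := (mem_nbrs.1 (hsub hy)).1
      exact ⟨hcell x hx y hy hxy hne, Or.inl fun a ha b hb h1 h2 =>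
        hcell a ha b hb (h1.trans (hxy.trans h2.symm))⟩
    · rw [badEdges, Finset.mem_filter, not_and] at hbad
      have := hbad he
      push Not at this
      exact (homologyRank_link_eq_zero he hκ hcell this.1 this.2 hG).le
  · refine Nat.add_le_add (homologyRank_partialGraph_empty_le hcell hC subset_rfl) ?_
    rw [← Finset.sum_filter, Finset.sum_const, smul_eq_mul, mul_comm]
    refine Nat.mul_le_mul_left _ (Finset.card_le_card fun e he => (Finset.mem_filter.1 he).2)

end Elimination

end Rips

namespace Rips

/-! ### A consequence of Szemerédi's regularity lemma -/

section Regularity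

open Finset

theorem card_filter_card_lt_le {β γ : Type*} [LinearOrder γ] [DecidableEq β] (T : Finset β)
    {g : β → γ} (hg : Set.InjOn g T) {t : ℝ} (ht : 0 ≤ t) :
    ((T.filter fun e => (((T.filter fun e' => g e' < g e).card : ℕ) : ℝ) < t).card : ℝ) ≤ t + 1 := by
  set F := T.filter fun e => (((T.filter fun e' => g e' < g e).card : ℕ) : ℝ) < t
  rcases F.eq_empty_or_nonempty with h | h
  · rw [h, card_empty, Nat.cast_zero]
    linarith
  obtain ⟨e, he, hmax⟩ := F.exists_max_image g h
  obtain ⟨heT, het⟩ := mem_filter.1 he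
  have hsub : F.erase e ⊆ T.filter fun e' => g e' < g e := by
    intro x hx
    obtain ⟨hxe, hx⟩ := mem_erase.1 hx
    have hxT := (mem_filter.1 hx).1
    exact mem_filter.2 ⟨hxT, lt_of_le_of_ne (hmax x hx) fun h => hxe (hg hxT heT h)⟩
  have h1 := card_le_card hsub
  have h2 := card_erase_add_one he
  have h3 : (F.card : ℝ) ≤ (T.filter fun e' => g e' < g e).card + 1 := by
    rw [← h2]
    exact_mod_cast Nat.add_le_add_right h1 1
  linarith

variable {α : Type*} [Fintype α] [LinearOrder α]

/-- Order the matching by first coordinates. A pair that is neither among the first ones starting in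
its part `U` nor among the last ones ending in its part `V` leaves an `ε`-fraction `X` of `U` before
it and `Y` of `V` after it. There is no edge between `X` and `Y`, which contradicts regularity and
positive density of `(U, V)`. The exceptional pairs number at most `ε |U| + 1` per part, for each of
the two ends. -/
theorem card_class_inter_regularityReduced_le {P : Finpartition (univ : Finset α)}
    (G : SimpleGraph α) [DecidableRel G.Adj] {ε δ : ℝ} (hε : 0 < ε) (hδ : ε ≤ δ)
    (T : Finset (α × α)) (hadj : ∀ e ∈ T, (G.regularityReduced P ε δ).Adj e.1 e.2)
    (h1 : ∀ e ∈ T, ∀ e' ∈ T, e.1 < e'.1 → ¬ G.Adj e.1 e'.2)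
    (h2 : ∀ e ∈ T, ∀ e' ∈ T, e.1 = e'.1 → e = e') :
    (T.card : ℝ) ≤ 2 * (ε * Fintype.card α + P.parts.card) := by
  classical
  let TU : Finset α → Finset (α × α) := fun U => T.filter fun e => e.1 ∈ U
  let TV : Finset α → Finset (α × α) := fun U => T.filter fun e => e.2 ∈ U
  let LU : Finset α → Finset (α × α) := fun U => (TU U).filter fun e =>
    ((((TU U).filter fun e' => e'.1 < e.1).card : ℕ) : ℝ) < ε * U.card
  let LV : Finset α → Finset (α × α) := fun U => (TV U).filter fun e =>
    ((((TV U).filter fun e' => OrderDual.toDual e'.1 < OrderDual.toDual e.1).card : ℕ) : ℝ) <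
      ε * U.card
  have hinj : Set.InjOn Prod.fst (T : Set (α × α)) := fun e he e' he' h => h2 e he e' he' h
  have hLU : ∀ U, ((LU U).card : ℝ) ≤ ε * U.card + 1 := fun U =>
    card_filter_card_lt_le (TU U) (hinj.mono fun e he => (mem_filter.1 he).1) (by positivity)
  have hLV : ∀ U, ((LV U).card : ℝ) ≤ ε * U.card + 1 := fun U =>
    card_filter_card_lt_le (g := fun e => OrderDual.toDual e.1) (TV U)
      (fun e he e' he' h => h2 e (mem_filter.1 he).1 e' (mem_filter.1 he').1
        (OrderDual.toDual_inj.1 h)) (by positivity)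
  have hcover : T ⊆ P.parts.biUnion LU ∪ P.parts.biUnion LV := by
    intro e he
    by_contra hno
    rw [mem_union, mem_biUnion, mem_biUnion, not_or] at hno
    obtain ⟨hno1, hno2⟩ := hno
    obtain ⟨hGe, U, hU, V, hV, heU, heV, -, hunif, hdens⟩ := hadj e he
    have hX : ε * U.card ≤ (((TU U).filter fun e' => e'.1 < e.1).card : ℕ) := by
      by_contra h
      exact hno1 ⟨U, hU, mem_filter.2 ⟨mem_filter.2 ⟨he, heU⟩, not_le.1 h⟩⟩
    have hY : ε * V.card ≤ (((TV V).filter fun e' => e.1 < e'.1).card : ℕ) := by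
      by_contra h
      exact hno2 ⟨V, hV, mem_filter.2 ⟨mem_filter.2 ⟨he, heV⟩, not_le.1 h⟩⟩
    set X := ((TU U).filter fun e' => e'.1 < e.1).image Prod.fst
    set Y := ((TV V).filter fun e' => e.1 < e'.1).image Prod.snd
    have hXc : X.card = ((TU U).filter fun e' => e'.1 < e.1).card :=
      card_image_of_injOn (hinj.mono fun e he => (mem_filter.1 (mem_filter.1 he).1).1)
    have hYc : Y.card = ((TV V).filter fun e' => e.1 < e'.1).card := by
      refine card_image_of_injOn fun a ha b hb hab => ?_
      have haT := (mem_filter.1 (mem_filter.1 ha).1).1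
      have hbT := (mem_filter.1 (mem_filter.1 hb).1).1
      have hab : a.2 = b.2 := hab
      rcases lt_trichotomy a.1 b.1 with h | h | h
      · exact absurd (hab ▸ (hadj a haT).1) (h1 a haT b hbT h)
      · exact h2 a haT b hbT h
      · exact absurd (hab ▸ (hadj b hbT).1) (h1 b hbT a haT h)
    have hXU : X ⊆ U := by
      intro x hx
      obtain ⟨a, ha, rfl⟩ := mem_image.1 hx
      exact (mem_filter.1 (mem_filter.1 ha).1).2
    have hYV : Y ⊆ V := by
      intro x hx
      obtain ⟨a, ha, rfl⟩ := mem_image.1 hx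
      exact (mem_filter.1 (mem_filter.1 ha).1).2
    have hempty : G.interedges X Y = ∅ := by
      rw [eq_empty_iff_forall_notMem]
      rintro ⟨x, y⟩ hxy
      obtain ⟨hx, hy, hxy⟩ := (SimpleGraph.mk_mem_interedges_iff G).1 hxy
      obtain ⟨a, ha, rfl⟩ := mem_image.1 hx
      obtain ⟨b, hb, rfl⟩ := mem_image.1 hy
      obtain ⟨ha, ha'⟩ := mem_filter.1 ha
      obtain ⟨hb, hb'⟩ := mem_filter.1 hb
      exact h1 a (mem_filter.1 ha).1 b (mem_filter.1 hb).1 (ha'.trans hb') hxy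
    have h := hunif hXU hYV (by rw [hXc, mul_comm]; exact hX) (by rw [hYc, mul_comm]; exact hY)
    rw [SimpleGraph.edgeDensity_def G X Y, hempty, card_empty] at h
    simp only [Nat.cast_zero, zero_div, Rat.cast_zero, zero_sub, abs_neg] at h
    have := le_abs_self (G.edgeDensity U V : ℝ)
    linarith
  have hsum : ∀ L : Finset α → Finset (α × α), (∀ U, ((L U).card : ℝ) ≤ ε * U.card + 1) →
      ((P.parts.biUnion L).card : ℝ) ≤ ε * Fintype.card α + P.parts.card := by
    intro L hL
    calc ((P.parts.biUnion L).card : ℝ) ≤ ((∑ U ∈ P.parts, (L U).card : ℕ) : ℝ) := by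
          exact_mod_cast card_biUnion_le
      _ = ∑ U ∈ P.parts, ((L U).card : ℝ) := by push_cast; rfl
      _ ≤ ∑ U ∈ P.parts, (ε * U.card + 1) := sum_le_sum fun U _ => hL U
      _ = ε * Fintype.card α + P.parts.card := by
        rw [sum_add_distrib, ← mul_sum, ← Nat.cast_sum, P.sum_card_parts, card_univ]
        simp
  have h3 : (T.card : ℝ) ≤ (P.parts.biUnion LU).card + (P.parts.biUnion LV).card := by
    exact_mod_cast (card_le_card hcover).trans (card_union_le _ _)
  have h4 := hsum LU hLU
  have h5 := hsum LV hLV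
  linarith

omit [LinearOrder α] in
theorem card_adj_not_regularityReduced_lt [DecidableEq α] [Nonempty α] {G : SimpleGraph α}
    [DecidableRel G.Adj] {P : Finpartition (univ : Finset α)} {ε : ℝ} (hε : 0 < ε)
    (hP : P.IsEquipartition) (hPε : P.IsUniform G (ε / 8)) (hP' : 4 / ε ≤ P.parts.card) :
    (((univ ×ˢ univ).filter fun e : α × α =>
      G.Adj e.1 e.2 ∧ ¬ (G.regularityReduced P (ε / 8) (ε / 4)).Adj e.1 e.2).card : ℝ) <
      2 * ε * (Fintype.card α ^ 2 : ℕ) := by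
  refine lt_of_le_of_lt (le_of_eq ?_)
    (SimpleGraph.regularityReduced_edges_card_aux hε hP hPε hP')
  rw [univ_product_univ, mul_sub, filter_and_not, cast_card_sdiff]
  · norm_cast
    rw [SimpleGraph.two_mul_card_edgeFinset, SimpleGraph.two_mul_card_edgeFinset]
  · intro e he
    exact mem_filter.2 ⟨mem_univ _, SimpleGraph.regularityReduced_le (mem_filter.1 he).2⟩

/-- A set of pairs that is the union of linearly many half-induced matchings is sparse. -/
theorem exists_card_le_of_half_induced_matchings {ε : ℝ} (hε : 0 < ε) :
    ∃ N : ℕ, ∀ {α ι : Type*} [Fintype α] [LinearOrder α] [DecidableEq ι] (B : Finset (α × α))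
      (f : α × α → ι), N ≤ Fintype.card α → (∀ e ∈ B, e.1 ≠ e.2) →
      (∀ e ∈ B, ∀ e' ∈ B, f e = f e' → e.1 < e'.1 → (e.1, e'.2) ∉ B ∧ (e'.2, e.1) ∉ B) →
      (∀ e ∈ B, ∀ e' ∈ B, f e = f e' → e.1 = e'.1 → e = e') →
      (B.card : ℝ) ≤ 2 * ε * Fintype.card α ^ 2 +
        (B.image f).card * (ε * Fintype.card α) := by
  set M := SzemerediRegularity.bound (ε / 8) ⌈4 / ε⌉₊
  -- The first bound makes the regularity lemma applicable and `α` nonempty; the second absorbs the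
  -- number of parts, at most `M`, into `ε * Fintype.card α`.
  refine ⟨max (⌈4 / ε⌉₊ + 1) ⌈2 * M / (ε / 8)⌉₊, ?_⟩
  intro α ι _ _ _ B f hN hne h1 h2
  classical
  have hN1 : ⌈4 / ε⌉₊ + 1 ≤ Fintype.card α := (le_max_left _ _).trans hN
  have hN2 : 2 * M / (ε / 8) ≤ Fintype.card α :=
    (Nat.le_ceil _).trans (by exact_mod_cast (le_max_right _ _).trans hN)
  have : Nonempty α := Fintype.card_pos_iff.1 (by omega)
  let G : SimpleGraph α := SimpleGraph.fromRel fun x y => (x, y) ∈ B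
  obtain ⟨P, hP1, hP2, hP3, hP4⟩ := szemeredi_regularity G (by positivity : 0 < ε / 8)
    ((Nat.le_succ _).trans hN1)
  have hP' : 4 / ε ≤ P.parts.card := (Nat.le_ceil _).trans (by exact_mod_cast hP2)
  have hred := card_adj_not_regularityReduced_lt hε hP1 hP4 hP'
  set Gr := G.regularityReduced P (ε / 8) (ε / 4)
  have hBadj : ∀ e ∈ B, G.Adj e.1 e.2 := fun e he =>
    (SimpleGraph.fromRel_adj _ _ _).2 ⟨hne e he, Or.inl he⟩
  have hB1 : ((B.filter fun e => ¬ Gr.Adj e.1 e.2).card : ℝ) ≤ 2 * ε * Fintype.card α ^ 2 := by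
    have : B.filter (fun e => ¬ Gr.Adj e.1 e.2) ⊆ (univ ×ˢ univ).filter fun e : α × α =>
        G.Adj e.1 e.2 ∧ ¬ Gr.Adj e.1 e.2 := by
      intro e he
      obtain ⟨he, he'⟩ := mem_filter.1 he
      exact mem_filter.2 ⟨mem_product.2 ⟨mem_univ _, mem_univ _⟩, hBadj e he, he'⟩
    have h := card_le_card this
    have h' : ((B.filter fun e => ¬ Gr.Adj e.1 e.2).card : ℝ) ≤ _ := Nat.cast_le.2 h
    refine h'.trans (hred.le.trans (le_of_eq ?_))
    push_cast
    ring
  have hclass : ∀ c, (((B.filter fun e => Gr.Adj e.1 e.2).filter fun e => f e = c).card : ℝ) ≤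
      ε * Fintype.card α := by
    intro c
    have h := card_class_inter_regularityReduced_le (P := P) G (by positivity : 0 < ε / 8)
      (by linarith : ε / 8 ≤ ε / 4) ((B.filter fun e => Gr.Adj e.1 e.2).filter fun e => f e = c)
      (fun e he => (mem_filter.1 (mem_filter.1 he).1).2) ?_ ?_
    · have hP3' : (P.parts.card : ℝ) ≤ M := by exact_mod_cast hP3
      rw [div_le_iff₀ (by positivity)] at hN2
      have hn : (0 : ℝ) ≤ Fintype.card α := Nat.cast_nonneg _
      nlinarith
    · intro e he e' he' hlt hadj
      obtain ⟨he, hc⟩ := mem_filter.1 he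
      obtain ⟨he', hc'⟩ := mem_filter.1 he'
      have := h1 e (mem_filter.1 he).1 e' (mem_filter.1 he').1 (hc.trans hc'.symm) hlt
      rcases ((SimpleGraph.fromRel_adj _ _ _).1 hadj).2 with h | h
      · exact this.1 h
      · exact this.2 h
    · intro e he e' he'
      obtain ⟨he, hc⟩ := mem_filter.1 he
      obtain ⟨he', hc'⟩ := mem_filter.1 he'
      exact h2 e (mem_filter.1 he).1 e' (mem_filter.1 he').1 (hc.trans hc'.symm)
  have hB2 : ((B.filter fun e => Gr.Adj e.1 e.2).card : ℝ) ≤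
      (B.image f).card * (ε * Fintype.card α) := by
    rw [card_eq_sum_card_fiberwise (f := f) (t := B.image f)
      fun e he => mem_image_of_mem f (mem_filter.1 he).1]
    push_cast
    refine (sum_le_sum fun c _ => hclass c).trans ?_
    rw [sum_const, nsmul_eq_mul]
  rw [← card_filter_add_card_filter_not (s := B) fun e => Gr.Adj e.1 e.2]
  push_cast
  linarith

end Regularity

/-! ### Bad edges in the lexicographic order -/

section Lexicographic

open Finset

variable {V ι : Type*} [LinearOrder V] [LinearOrder ι] {R : SimpleGraph V} {S : Finset V}
  {cell : V → ι}

/-- The lexicographic order on pairs. -/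
def lexKey (u v : V) : V ×ₗ V := toLex (u, v)

theorem lexKey_lt_left {u u' : V} (h : u' < u) (v v' : V) : lexKey u' v' < lexKey u v :=
  Prod.Lex.toLex_lt_toLex.2 (Or.inl h)

theorem lexKey_lt_right (u : V) {v v' : V} (h : v' < v) : lexKey u v' < lexKey u v :=
  Prod.Lex.toLex_lt_toLex.2 (Or.inr ⟨rfl, h⟩)

open scoped Classical in
variable (R S cell) in
/-- The critical edges with an isolated witness. -/
noncomputable def isolatedEdges {L : Type*} [LinearOrder L] (κ : V → V → L) : Finset (V × V) :=
  (criticalEdges R S cell).filter fun e => ∃ w, IsolatedWitness R S cell κ e.1 e.2 w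

open scoped Classical in
variable (R S cell) in
/-- The critical edges with a split link. -/
noncomputable def splitEdges {L : Type*} [LinearOrder L] (κ : V → V → L) : Finset (V × V) :=
  (criticalEdges R S cell).filter fun e => SplitLink R S cell κ e.1 e.2

omit [LinearOrder V] in
theorem card_badEdges_le {L : Type*} [LinearOrder L] (κ : V → V → L) :
    (badEdges R S cell κ).card ≤
      (isolatedEdges R S cell κ).card + (splitEdges R S cell κ).card := by
  classical
  rw [badEdges, filter_or]
  exact card_union_le _ _

omit [LinearOrder V] in
theorem mem_isolatedEdges {L : Type*} [LinearOrder L] {κ : V → V → L} {u v : V} :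
    (u, v) ∈ isolatedEdges R S cell κ ↔ ((u ∈ S ∧ v ∈ S) ∧ cell u < cell v ∧ R.Adj u v ∧
      ¬ FullyAdjacent R S cell u v) ∧ ∃ w, IsolatedWitness R S cell κ u v w := by
  classical
  rw [isolatedEdges, mem_filter, mem_criticalEdges]

omit [LinearOrder V] in
theorem mem_splitEdges {L : Type*} [LinearOrder L] {κ : V → V → L} {u v : V} :
    (u, v) ∈ splitEdges R S cell κ ↔ ((u ∈ S ∧ v ∈ S) ∧ cell u < cell v ∧ R.Adj u v ∧
      ¬ FullyAdjacent R S cell u v) ∧ SplitLink R S cell κ u v := by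
  classical
  rw [splitEdges, mem_filter, mem_criticalEdges]

omit [LinearOrder V] in
theorem exists_isolatedWitness_choice {L : Type*} [LinearOrder L] (κ : V → V → L) :
    ∃ f : V × V → V, ∀ e ∈ isolatedEdges R S cell κ,
      IsolatedWitness R S cell κ e.1 e.2 (f e) := by
  classical
  refine ⟨fun e => if h : ∃ w, IsolatedWitness R S cell κ e.1 e.2 w then h.choose else e.1,
    fun e he => ?_⟩
  have h := (mem_isolatedEdges.1 he).2
  dsimp only
  rw [dif_pos h]
  exact h.choose_spec

omit [LinearOrder V] in
theorem card_biUnion_cells_le {C : ℕ} (hC : ∀ v ∈ S, ((nbrs R S v).image cell).card ≤ C)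
    {β : Type*} (T : Finset β) (g : β → V × ι × ι)
    (hg : ∀ e ∈ T, (g e).1 ∈ S ∧ (g e).2.1 ∈ (nbrs R S (g e).1).image cell ∧
      (g e).2.2 ∈ (nbrs R S (g e).1).image cell) [DecidableEq V] :
    (T.image g).card ≤ S.card * C ^ 2 := by
  have hsub : T.image g ⊆ S.biUnion fun w => ({w} : Finset V) ×ˢ
      ((nbrs R S w).image cell ×ˢ (nbrs R S w).image cell) := by
    intro x hx
    obtain ⟨e, he, rfl⟩ := mem_image.1 hx
    obtain ⟨h1, h2, h3⟩ := hg e he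
    refine mem_biUnion.2 ⟨_, h1, mem_product.2 ⟨mem_singleton_self _, mem_product.2 ⟨h2, h3⟩⟩⟩
  refine (card_le_card hsub).trans (card_biUnion_le_card_mul _ _ _ fun w hw => ?_)
  rw [card_product, card_product, card_singleton, one_mul, sq]
  exact Nat.mul_le_mul (hC w hw) (hC w hw)

/-- Group the edges by witness and pair of cells, at most `|S| * C ^ 2` classes. In a class, if `u <
u'` and `u` were adjacent to `v'`, then `u` would precede `u'` as a neighbour of `v'` while being
adjacent to the witness. So the classes are half-induced matchings. -/
theorem exists_card_isolatedEdges_lexKey_le (C : ℕ) {δ : ℝ} (hδ : 0 < δ) :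
    ∃ K : ℝ, 0 ≤ K ∧ ∀ {V ι : Type} [LinearOrder V] [LinearOrder ι] {R : SimpleGraph V}
      {S : Finset V} {cell : V → ι}, (∀ v ∈ S, ((nbrs R S v).image cell).card ≤ C) →
      ((isolatedEdges R S cell lexKey).card : ℝ) ≤ δ * S.card ^ 2 + K * S.card := by
  -- Chosen so that `2 * ε * n ^ 2`, plus `ε * n` for each of `n * C ^ 2` classes, equals `δ * n ^
  -- 2`. For fewer than `N` points the trivial bound `n ^ 2 ≤ N * n` is used.
  set ε := δ / (2 + C ^ 2)
  have hε : 0 < ε := by positivity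
  obtain ⟨N, hN⟩ := exists_card_le_of_half_induced_matchings.{0, 0} hε
  refine ⟨N, Nat.cast_nonneg _, ?_⟩
  intro V ι _ _ R S cell hC
  set A := isolatedEdges R S cell (lexKey : V → V → V ×ₗ V)
  have hn : (0 : ℝ) ≤ S.card := Nat.cast_nonneg _
  have hAS : A ⊆ S ×ˢ S := fun e he => mem_product.2 (mem_isolatedEdges.1 he).1.1
  by_cases hSN : N ≤ S.card
  · obtain ⟨w, hw⟩ := exists_isolatedWitness_choice (R := R) (S := S) (cell := cell)
      (lexKey : V → V → V ×ₗ V)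
    let f : V × V → V × ι × ι := fun e => (w e, cell e.1, cell e.2)
    let j : S × S → V × V := fun e => (e.1.1, e.2.1)
    have hj : Function.Injective j := fun a b h => by
      obtain ⟨h1, h2⟩ := Prod.mk.inj h
      exact Prod.ext (Subtype.ext h1) (Subtype.ext h2)
    let B : Finset (S × S) := univ.filter fun e => j e ∈ A
    have hB : ∀ {e}, e ∈ B ↔ j e ∈ A := fun {e} => by simp [B]
    have hBA : B.card = A.card := by
      refine card_bij (fun e _ => j e) (fun e he => hB.1 he) (fun _ _ _ _ h => hj h) ?_
      intro e he
      obtain ⟨h1, h2⟩ := mem_product.1 (hAS he)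
      exact ⟨(⟨e.1, h1⟩, ⟨e.2, h2⟩), hB.2 he, rfl⟩
    have himage : (B.image (f ∘ j)).card ≤ S.card * C ^ 2 := by
      refine card_biUnion_cells_le hC B (f ∘ j) fun e he => ?_
      have hwit := hw _ (hB.1 he)
      exact ⟨hwit.1, mem_image_of_mem _ (mem_nbrs.2 ⟨e.1.2, hwit.2.2.2.1⟩),
        mem_image_of_mem _ (mem_nbrs.2 ⟨e.2.2, hwit.2.2.2.2.1⟩)⟩
    have key := hN B (f ∘ j) (by simpa using hSN) ?_ ?_ ?_
    · rw [hBA, Fintype.card_coe] at key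
      have himage' : ((B.image (f ∘ j)).card : ℝ) ≤ S.card * C ^ 2 := by exact_mod_cast himage
      calc (A.card : ℝ) ≤ 2 * ε * S.card ^ 2 + (B.image (f ∘ j)).card * (ε * S.card) := key
        _ ≤ 2 * ε * S.card ^ 2 + (S.card * C ^ 2) * (ε * S.card) := by gcongr
        _ = (ε * (2 + C ^ 2)) * S.card ^ 2 := by ring
        _ = δ * S.card ^ 2 := by rw [div_mul_cancel₀ _ (by positivity)]
        _ ≤ _ := le_add_of_nonneg_right (by positivity)
    · intro e he h
      have := (mem_isolatedEdges.1 (hB.1 he)).1.2.1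
      rw [h] at this
      exact lt_irrefl _ this
    · intro e he e' he' hf hlt
      obtain ⟨⟨⟨hu, hv⟩, hc, ha, -⟩, -⟩ := mem_isolatedEdges.1 (hB.1 he)
      have hwe := hw _ (hB.1 he)
      have hwe' := hw _ (hB.1 he')
      obtain ⟨hf1, hf2⟩ := Prod.mk.inj hf
      obtain ⟨hf2, hf3⟩ := Prod.mk.inj hf2
      constructor
      · intro h
        refine hwe'.2.2.2.2.2.1 e.1.1 e.1.2 hf2 (mem_isolatedEdges.1 (hB.1 h)).1.2.2.1
          (lexKey_lt_left (show (e.1.1 : V) < e'.1.1 from hlt) _ _) ?_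
        have := hwe.2.2.2.1
        rwa [hf1] at this
      · intro h
        have h := (mem_isolatedEdges.1 (hB.1 h)).1.2.1
        rw [← hf3] at h
        exact lt_asymm h hc
    · have haux : ∀ e ∈ B, ∀ e' ∈ B, (f ∘ j) e = (f ∘ j) e' → e.1 = e'.1 → ¬ e.2 < e'.2 := by
        intro e he e' he' hf heq hlt
        have hwe := hw _ (hB.1 he)
        have hwe' := hw _ (hB.1 he')
        obtain ⟨hf1, hf2⟩ := Prod.mk.inj hf
        obtain ⟨hf2, hf3⟩ := Prod.mk.inj hf2
        refine hwe'.2.2.2.2.2.2 e.2.1 e.2.2 hf3 ?_ (lexKey_lt_right _ (show (e.2.1 : V) < e'.2.1 from hlt)) ?_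
        · have := (mem_isolatedEdges.1 (hB.1 he)).1.2.2.1
          rwa [heq] at this
        · have := hwe.2.2.2.2.1
          rwa [hf1] at this
      intro e he e' he' hf heq
      refine Prod.ext heq (le_antisymm ?_ ?_)
      · exact not_lt.1 (haux e' he' e he hf.symm heq.symm)
      · exact not_lt.1 (haux e he e' he' hf heq)
  · have h1 : (A.card : ℝ) ≤ S.card * S.card := by
      exact_mod_cast (card_le_card hAS).trans (card_product _ _).le
    have h2 : (S.card : ℝ) ≤ N := by exact_mod_cast (not_le.1 hSN).le
    have h3 : (S.card : ℝ) * S.card ≤ N * S.card := mul_le_mul_of_nonneg_right h2 hn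
    have h4 : 0 ≤ δ * (S.card : ℝ) ^ 2 := by positivity
    linarith

/-- Kővári–Sós–Turán for 4-cycles: in a 4-cycle of split edges between two cells, the opposite edge
precedes the edge at the two larger vertices, contrary to the latter being split. Count pairs of
edges with a common right end and left ends in one cell, and use Cauchy–Schwarz. -/
theorem sq_card_splitEdges_lexKey_le {C : ℕ}
    (hC : ∀ v ∈ S, ((nbrs R S v).image cell).card ≤ C) :
    (splitEdges R S cell lexKey).card ^ 2 ≤
      (S.card * C) * ((splitEdges R S cell lexKey).card + 2 * (S.card * S.card * C)) := by
  classical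
  set B := splitEdges R S cell (lexKey : V → V → V ×ₗ V)
  let g : V × V → V × ι := fun e => (e.2, cell e.1)
  let N : V → Finset ι := fun v => (nbrs R S v).image cell
  let I : Finset (V × ι) := S.biUnion fun v => ({v} : Finset V) ×ˢ N v
  have hI : I.card ≤ S.card * C := by
    refine card_biUnion_le_card_mul _ _ _ fun v hv => ?_
    rw [card_product, card_singleton, one_mul]
    exact hC v hv
  have hBmem : ∀ e ∈ B, (e.1 ∈ S ∧ e.2 ∈ S) ∧ R.Adj e.1 e.2 := fun e he =>
    ⟨(mem_splitEdges.1 he).1.1, (mem_splitEdges.1 he).1.2.2.1⟩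
  have hg : ∀ e ∈ B, g e ∈ I := fun e he => by
    obtain ⟨⟨h1, h2⟩, h3⟩ := hBmem e he
    exact mem_biUnion.2 ⟨e.2, h2, mem_product.2 ⟨mem_singleton_self _,
      mem_image_of_mem _ (mem_nbrs.2 ⟨h1, h3.symm⟩)⟩⟩
  have hno : ∀ u u' v v', u' < u → v' < v → cell u' = cell u → cell v' = cell v →
      (u, v) ∈ B → (u', v) ∈ B → (u, v') ∈ B → (u', v') ∈ B → False := by
    intro u u' v v' hu hv hcu hcv h1 h2 h3 h4
    have := (mem_splitEdges.1 h1).2.2.2 u' (hBmem _ h2).1.1 hcu (hBmem _ h2).2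
      (lexKey_lt_left hu _ _) v' (hBmem _ h3).1.2 hcv (hBmem _ h3).2 (lexKey_lt_right _ hv)
      (hBmem _ h4).2
    exact not_le.2 (lexKey_lt_left hu v v') this
  let D : Finset ((V × V) × V × V) := (B ×ˢ B).filter fun p => g p.1 = g p.2
  let D' : Finset ((V × V) × V × V) := D.filter fun p => p.1.1 < p.2.1
  have hDsum : D.card = ∑ i ∈ I, (B.filter fun e => g e = i).card ^ 2 := by
    rw [card_eq_sum_card_fiberwise (f := fun p => g p.1) (t := I)
      fun p hp => hg _ (mem_product.1 (mem_filter.1 hp).1).1]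
    refine sum_congr rfl fun i _ => ?_
    rw [sq, ← card_product]
    congr 1
    ext p
    simp only [mem_filter, mem_product]
    constructor
    · rintro ⟨⟨⟨h1, h2⟩, h3⟩, h4⟩
      exact ⟨⟨h1, h4⟩, h2, h3 ▸ h4⟩
    · rintro ⟨⟨h1, h2⟩, h3, h4⟩
      exact ⟨⟨⟨h1, h3⟩, h2.trans h4.symm⟩, h2⟩
  have hCS : B.card ^ 2 ≤ I.card * D.card := by
    rw [hDsum, card_eq_sum_card_fiberwise (f := g) (t := I) hg]
    exact sq_sum_le_card_mul_sum_sq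
  have hD' : D'.card ≤ S.card * S.card * C := by
    let J : Finset ((V × V) × ι) := (S ×ˢ S).biUnion fun p => ({p} : Finset (V × V)) ×ˢ N p.1
    have hJ : J.card ≤ S.card * S.card * C := by
      rw [← card_product]
      refine card_biUnion_le_card_mul _ _ _ fun p hp => ?_
      rw [card_product, card_singleton, one_mul]
      exact hC p.1 (mem_product.1 hp).1
    -- Two left ends have at most one common right end in a given cell, as two would give a 4-cycle.
    refine le_trans (card_le_card_of_injOn (fun p => ((p.1.1, p.2.1), cell p.1.2)) ?_ ?_) hJ
    · intro p hp
      have hp := mem_product.1 (mem_filter.1 (mem_filter.1 hp).1).1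
      obtain ⟨⟨h1, h2⟩, h3⟩ := hBmem _ hp.1
      obtain ⟨⟨h4, h5⟩, h6⟩ := hBmem _ hp.2
      exact mem_biUnion.2 ⟨(p.1.1, p.2.1), mem_product.2 ⟨h1, h4⟩, mem_product.2
        ⟨mem_singleton_self _, mem_image_of_mem _ (mem_nbrs.2 ⟨h2, h3⟩)⟩⟩
    · rintro ⟨⟨u', v⟩, ⟨u, v₂⟩⟩ hp ⟨⟨x', y⟩, ⟨x, y₂⟩⟩ hq heq
      obtain ⟨hp, hlt⟩ := mem_filter.1 hp
      obtain ⟨hp, hgp⟩ := mem_filter.1 hp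
      obtain ⟨hq, -⟩ := mem_filter.1 hq
      obtain ⟨hq, hgq⟩ := mem_filter.1 hq
      obtain ⟨hp1, hp2⟩ := mem_product.1 hp
      obtain ⟨hq1, hq2⟩ := mem_product.1 hq
      simp only [Prod.mk.injEq, g] at heq hgp hgq hlt hp1 hp2 hq1 hq2
      obtain ⟨⟨rfl, rfl⟩, hc⟩ := heq
      obtain ⟨rfl, hc1⟩ := hgp
      obtain ⟨rfl, -⟩ := hgq
      rcases lt_trichotomy v y with h | h | h
      · exact (hno u u' y v hlt h hc1 hc hq2 hq1 hp2 hp1).elim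
      · rw [h]
      · exact (hno u u' v y hlt h hc1 hc.symm hp2 hp1 hq2 hq1).elim
  have hD : D.card ≤ B.card + 2 * D'.card := by
    have hsub : D ⊆ (B.image fun e => (e, e)) ∪ (D' ∪ D'.image Prod.swap) := by
      rintro ⟨⟨u', v⟩, ⟨u, v₂⟩⟩ hp
      obtain ⟨hp', hgp⟩ := mem_filter.1 hp
      obtain ⟨hp1, hp2⟩ := mem_product.1 hp'
      simp only [Prod.mk.injEq, g] at hgp hp1 hp2
      obtain ⟨rfl, hc⟩ := hgp
      rcases lt_trichotomy u' u with h | rfl | h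
      · exact mem_union_right _ (mem_union_left _ (mem_filter.2 ⟨hp, h⟩))
      · exact mem_union_left _ (mem_image_of_mem _ hp1)
      · refine mem_union_right _ (mem_union_right _ (mem_image.2 ⟨((u, v), (u', v)), ?_, rfl⟩))
        refine mem_filter.2 ⟨mem_filter.2 ⟨mem_product.2 ⟨hp2, hp1⟩, ?_⟩, h⟩
        exact Prod.ext rfl hc.symm
    refine (card_le_card hsub).trans ((card_union_le _ _).trans ?_)
    refine Nat.add_le_add card_image_le ((card_union_le _ _).trans ?_)
    rw [two_mul]
    exact Nat.add_le_add_left card_image_le _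
  calc B.card ^ 2 ≤ I.card * D.card := hCS
    _ ≤ (S.card * C) * (B.card + 2 * (S.card * S.card * C)) :=
      Nat.mul_le_mul hI (hD.trans (Nat.add_le_add_left (Nat.mul_le_mul_left 2 hD') _))

theorem card_splitEdges_lexKey_le {C : ℕ} (hC : ∀ v ∈ S, ((nbrs R S v).image cell).card ≤ C)
    {δ : ℝ} (hδ : 0 < δ) : ((splitEdges R S cell lexKey).card : ℝ) ≤
      δ * S.card ^ 2 + C * (1 + 2 * C) / δ * S.card := by
  have h := sq_card_splitEdges_lexKey_le (R := R) (S := S) (cell := cell) hC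
  set B := splitEdges R S cell (lexKey : V → V → V ×ₗ V)
  have hBS : B.card ≤ S.card * S.card := by
    rw [← card_product]
    exact card_le_card fun e he => mem_product.2 (mem_splitEdges.1 he).1.1
  have h' : B.card ^ 2 ≤ (S.card * C) * (S.card * S.card + 2 * (S.card * S.card * C)) :=
    h.trans (Nat.mul_le_mul_left _ (Nat.add_le_add_right hBS _))
  have h'' : (B.card : ℝ) ^ 2 ≤
      (S.card * C) * (S.card * S.card + 2 * (S.card * S.card * C)) := by exact_mod_cast h'
  refine abs_le_of_sq_le_sq' ?_ (by positivity) |>.2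
  refine h''.trans ?_
  -- The cubic bound for the square factors as `x * y`, with `x` and `y` the two terms of the claim,
  -- and `x * y ≤ (x + y) ^ 2`.
  have hx : (S.card * C : ℝ) * (S.card * S.card + 2 * (S.card * S.card * C)) =
      (δ * S.card ^ 2) * (C * (1 + 2 * C) / δ * S.card) := by
    field_simp
  rw [hx]
  have h1 : 0 ≤ δ * (S.card : ℝ) ^ 2 := by positivity
  have h2 : 0 ≤ C * (1 + 2 * C) / δ * (S.card : ℝ) := by positivity
  nlinarith

/-- If every cell is a clique and every neighbourhood meets at most `C` cells, the second Betti
number of the clique complex is subquadratic. -/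
theorem exists_homologyRank_three_flag_le (C : ℕ) {δ : ℝ} (hδ : 0 < δ) :
    ∃ K : ℝ, 0 ≤ K ∧ ∀ {V ι : Type} [LinearOrder V] [LinearOrder ι] {R : SimpleGraph V}
      {S : Finset V} {cell : V → ι} (k : Type u) [Field k],
      (∀ x ∈ S, ∀ y ∈ S, cell x = cell y → x ≠ y → R.Adj x y) →
      (∀ v ∈ S, ((nbrs R S v).image cell).card ≤ C) →
      (homologyRank k 3 (flag R S) : ℝ) ≤ δ * S.card ^ 2 + K * S.card := by
  have hδ' : 0 < δ / (2 * (C + 1)) := by positivity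
  obtain ⟨K, hK0, hK⟩ := exists_card_isolatedEdges_lexKey_le C hδ'
  set K' : ℝ := C * (1 + 2 * C) / (δ / (2 * (C + 1)))
  have hK'0 : 0 ≤ K' := by positivity
  refine ⟨2 ^ C + C * (K + K'), by positivity, ?_⟩
  intro V ι _ _ R S cell k _ hcell hC
  have h := homologyRank_three_flag_le (k := k) (κ := (lexKey : V → V → V ×ₗ V)) (S := S)
    (fun u _ v _ u' _ v' _ h => Prod.mk.inj (toLex_inj.1 h)) hcell hC
  have h1 := hK hC
  have h2 := card_splitEdges_lexKey_le hC hδ'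
  have h3 := card_badEdges_le (R := R) (S := S) (cell := cell) (lexKey : V → V → V ×ₗ V)
  have h' : (homologyRank k 3 (flag R S) : ℝ) ≤ 2 ^ C * S.card +
      C * ((isolatedEdges R S cell (lexKey : V → V → V ×ₗ V)).card +
        (splitEdges R S cell (lexKey : V → V → V ×ₗ V)).card) := by
    exact_mod_cast h.trans (Nat.add_le_add_left (Nat.mul_le_mul_left _ h3) _)
  refine h'.trans ?_
  have hC' : (0 : ℝ) ≤ C := Nat.cast_nonneg _
  have hlt : C * (2 * (δ / (2 * (C + 1)))) ≤ δ := by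
    rw [mul_div_assoc', mul_div_assoc', div_le_iff₀ (by positivity)]
    nlinarith
  have hn : (0 : ℝ) ≤ (S.card : ℝ) ^ 2 := by positivity
  calc _ ≤ 2 ^ C * (S.card : ℝ) + C * ((δ / (2 * (C + 1)) * S.card ^ 2 + K * S.card) +
        (δ / (2 * (C + 1)) * S.card ^ 2 + K' * S.card)) := by gcongr
    _ = (C * (2 * (δ / (2 * (C + 1))))) * S.card ^ 2 + (2 ^ C + C * (K + K')) * S.card := by ring
    _ ≤ _ := by gcongr

end Lexicographic

end Rips

namespace Rips

/-! ### Planar configurations of cells -/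

section Planar

variable {α : Type*} {X Y : α → ℝ}

/-- The squared distance in the coordinates `X`, `Y`. -/
def sqDist (X Y : α → ℝ) (p q : α) : ℝ := (X p - X q) ^ 2 + (Y p - Y q) ^ 2

/-- Two points are almost vertically above each other. -/
def NearVertical (X Y : α → ℝ) (p q : α) : Prop := |X q - X p| ≤ 0.06 * |Y q - Y p|

theorem NearVertical.symm {p q : α} (h : NearVertical X Y p q) : NearVertical X Y q p := by
  unfold NearVertical at h ⊢
  rwa [abs_sub_comm, abs_sub_comm (Y p)]

theorem NearVertical.of_lt {p q : α} (h : NearVertical X Y p q) (hY : Y p < Y q) :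
    -(0.06 * (Y q - Y p)) ≤ X q - X p ∧ X q - X p ≤ 0.06 * (Y q - Y p) := by
  unfold NearVertical at h
  rw [abs_of_pos (sub_pos.2 hY)] at h
  exact abs_le.1 h

/-- `V` lies one unit to the right of `U`. -/
def OppositeCells (X Y : α → ℝ) (U V : Set α) : Prop :=
  ∀ u ∈ U, ∀ v ∈ V, (0.95 ≤ X v - X u ∧ X v - X u ≤ 1.05) ∧ -0.05 ≤ Y v - Y u ∧ Y v - Y u ≤ 0.05

variable {U V W : Set α}

/-- The slope `0.06` of `NearVertical` comes from `0.1 / 1.9 < 0.06`. -/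
theorem le_mul_abs_of_mul_add_mul_nonneg {x y a b : ℝ} (ha : 1.9 ≤ a) (hb : |b| ≤ 0.1)
    (h : 0 ≤ x * a + y * b) : -x ≤ 0.06 * |y| := by
  have h1 : y * b ≤ |y| * 0.1 :=
    (le_abs_self _).trans (by rw [abs_mul]; exact mul_le_mul_of_nonneg_left hb (abs_nonneg _))
  by_contra! hx
  have h2 : 0 < -x := lt_of_le_of_lt (by positivity) hx
  nlinarith

theorem neg_sub_le_of_sqDist_le (h : OppositeCells X Y U V) {x v v' : α} (hx : x ∈ U)
    (hv : v ∈ V) (hv' : v' ∈ V) (hD : sqDist X Y x v ≤ sqDist X Y x v') :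
    -(X v' - X v) ≤ 0.06 * |Y v' - Y v| := by
  have h1 := h x hx v hv
  have h2 := h x hx v' hv'
  unfold sqDist at hD
  refine le_mul_abs_of_mul_add_mul_nonneg (a := X v + X v' - 2 * X x)
    (b := Y v + Y v' - 2 * Y x) (by linarith) (abs_le.2 ⟨by linarith, by linarith⟩) ?_
  linarith

/-- Seen from `U`, a point of `V` that is clearly further to the right is further away. Two points
of `U` can disagree about which of `v`, `v'` is nearer only if these are almost vertically aligned.
-/
theorem OppositeCells.nearVertical_right (h : OppositeCells X Y U V) {x y v v' : α} (hx : x ∈ U)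
    (hy : y ∈ U) (hv : v ∈ V) (hv' : v' ∈ V) (h1 : sqDist X Y x v ≤ sqDist X Y x v')
    (h2 : sqDist X Y y v' ≤ sqDist X Y y v) : NearVertical X Y v v' := by
  have h3 := neg_sub_le_of_sqDist_le h hx hv hv' h1
  have h4 := neg_sub_le_of_sqDist_le h hy hv' hv h2
  rw [abs_sub_comm] at h4
  exact abs_le.2 ⟨by linarith, by linarith⟩

theorem OppositeCells.neg_swap (h : OppositeCells X Y U V) :
    OppositeCells (fun p => -X p) Y V U := fun v hv u hu => by
  have := h u hu v hv
  exact ⟨⟨by linarith, by linarith⟩, by linarith, by linarith⟩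

theorem OppositeCells.neg_right (h : OppositeCells X Y U V) :
    OppositeCells X (fun p => -Y p) U V := fun u hu v hv => by
  have := h u hu v hv
  exact ⟨⟨by linarith, by linarith⟩, by linarith, by linarith⟩

theorem OppositeCells.nearVertical_left (h : OppositeCells X Y U V) {u u' v v' : α} (hu : u ∈ U)
    (hu' : u' ∈ U) (hv : v ∈ V) (hv' : v' ∈ V) (h1 : sqDist X Y u v ≤ sqDist X Y u' v)
    (h2 : sqDist X Y u' v' ≤ sqDist X Y u v') : NearVertical X Y u u' := by
  have h3 := h.neg_swap.nearVertical_right hv hv' hu hu'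
    (by unfold sqDist at *; linarith) (by unfold sqDist at *; linarith)
  unfold NearVertical at *
  rwa [show -X u' - -X u = -(X u' - X u) by ring, abs_neg] at h3

theorem inner_nonneg_of_sqDist_le {x y v v' : α} (h1 : sqDist X Y x v ≤ sqDist X Y x v')
    (h2 : sqDist X Y y v' ≤ sqDist X Y y v) :
    0 ≤ (X y - X x) * (X v' - X v) + (Y y - Y x) * (Y v' - Y v) := by
  unfold sqDist at *
  linarith

theorem eq_of_nearVertical {p q : α} (hXY : ∀ p q, X p = X q → Y p = Y q → p = q)
    (h : NearVertical X Y p q) (hY : Y p = Y q) : p = q := by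
  refine hXY p q ?_ hY
  unfold NearVertical at h
  rw [hY, sub_self, abs_zero, mul_zero] at h
  linarith [abs_nonpos_iff.1 h]

/-- `W` lies below the midpoint of `U` and `V`, as the third vertex of a regular triangle. -/
def BelowCells (X Y : α → ℝ) (U V W : Set α) : Prop :=
  (∀ u ∈ U, ∀ w ∈ W, (0.4 ≤ X w - X u ∧ X w - X u ≤ 0.6) ∧
    -0.95 ≤ Y w - Y u ∧ Y w - Y u ≤ -0.75) ∧
  ∀ v ∈ V, ∀ w ∈ W, (-0.6 ≤ X w - X v ∧ X w - X v ≤ -0.4) ∧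
    -0.95 ≤ Y w - Y v ∧ Y w - Y v ≤ -0.75

theorem BelowCells.sqDist_le (h : BelowCells X Y U V W) {v p w : α} (hv : v ∈ V) (hp : p ∈ V)
    (hw : w ∈ W) (hvp : NearVertical X Y v p) (hY : Y v < Y p) :
    sqDist X Y v w ≤ sqDist X Y p w := by
  have h1 := h.2 v hv w hw
  have h2 := h.2 p hp w hw
  have h3 := hvp.of_lt hY
  unfold sqDist
  linarith [mul_nonneg (sub_nonneg.2 hY.le) (show 0 ≤ 1.9 - (Y v + Y p - 2 * Y w) by linarith), mul_nonneg (sub_nonneg.2 hY.le) (show 0 ≤ 1.2 - (X v + X p - 2 * X w) by linarith), mul_nonneg (sub_nonneg.2 hY.le) (show 0 ≤ Y v + Y p - 2 * Y w - 1.5 by linarith),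
    mul_nonneg (show 0 ≤ X p - X v + 0.06 * (Y p - Y v) by linarith)
      (show 0 ≤ X v + X p - 2 * X w by linarith)]

/-- Since `u` is nearer to `v` but further from `w` than `a`, it lies above `a`, with bounded
inverse slope (`2.4 > 1.9 / 0.8`). As `p` is almost vertically above `v`, the product of `u - a` and
`p - v` is then positive, whereas the preference of `a` for `p` and of `u` for `v` makes it
nonpositive. -/
theorem false_of_common_right (h : OppositeCells X Y U V) (h' : BelowCells X Y U V W)
    {u a v p w : α} (hu : u ∈ U) (ha : a ∈ U) (hv : v ∈ V) (hp : p ∈ V) (hw : w ∈ W)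
    (hY : Y v < Y p) (h1 : sqDist X Y u v ≤ sqDist X Y a v)
    (h2 : sqDist X Y a w < sqDist X Y u w) (h3 : sqDist X Y a p ≤ sqDist X Y a v)
    (h4 : sqDist X Y u v ≤ sqDist X Y u p) : False := by
  have hnv := (h.nearVertical_right hu ha hv hp h4 h3).of_lt hY
  have hin := inner_nonneg_of_sqDist_le h4 h3
  have hu1 := h u hu v hv
  have ha1 := h a ha v hv
  have hu2 := h'.1 u hu w hw
  have ha2 := h'.1 a ha w hw
  obtain ⟨s, hs⟩ : ∃ s, s = X u - X a := ⟨_, rfl⟩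
  obtain ⟨t, ht⟩ : ∃ t, t = Y u - Y a := ⟨_, rfl⟩
  have e1 : s * (2 * X v - X u - X a) + t * (2 * Y v - Y u - Y a) ≥ 0 := by
    subst hs ht
    unfold sqDist at h1
    linarith
  have e2 : s * (2 * X w - X u - X a) + t * (2 * Y w - Y u - Y a) < 0 := by
    subst hs ht
    unfold sqDist at h2
    linarith
  have hsl := le_mul_abs_of_mul_add_mul_nonneg (by linarith) (abs_le.2 ⟨by linarith, by linarith⟩)
    e1
  have ht0 : 0 < t := by
    by_contra! ht0
    rw [abs_of_nonpos ht0] at hsl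
    nlinarith [mul_nonneg (show 0 ≤ s - 0.06 * t by linarith)
      (show 0 ≤ 2 * X w - X u - X a by linarith),
      mul_nonneg (neg_nonneg.2 ht0) (show 0 ≤ -1.5 - (2 * Y w - Y u - Y a) by linarith),
      mul_nonneg (neg_nonneg.2 ht0) (show 0 ≤ 1.2 - (2 * X w - X u - X a) by linarith)]
  rw [abs_of_pos ht0] at hsl
  have hs2 : s ≤ 2.4 * t := by
    by_contra! hs2
    nlinarith [mul_nonneg (show 0 ≤ s - 2.4 * t by linarith)
      (show 0 ≤ 2 * X w - X u - X a by linarith),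
      mul_nonneg ht0.le (show 0 ≤ 1.9 + (2 * Y w - Y u - Y a) by linarith),
      mul_nonneg ht0.le (show 0 ≤ (2 * X w - X u - X a) - 0.8 by linarith)]
  have hin' : s * (X p - X v) + t * (Y p - Y v) ≤ 0 := by
    subst hs ht
    linarith
  have hb : |s * (X p - X v)| ≤ (2.4 * t) * (0.06 * (Y p - Y v)) := by
    rw [abs_mul]
    refine mul_le_mul (abs_le.2 ⟨by linarith, hs2⟩) (abs_le.2 hnv) (abs_nonneg _) (by positivity)
  nlinarith [abs_le.1 hb, mul_pos ht0 (sub_pos.2 hY)]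

/-- For `c` the middle point `v₂` is the furthest of the three, so it bulges to the right of the
segment from `v₁` to `p`. For `u` it is the nearest, which forces `u - c` to point almost
horizontally to the right, hence towards `w`. -/
theorem sqDist_le_of_middle (h : OppositeCells X Y U V) (h' : BelowCells X Y U V W)
    {u c v₁ v₂ p w : α} (hu : u ∈ U) (hc : c ∈ U) (hv₁ : v₁ ∈ V) (hv₂ : v₂ ∈ V) (hp : p ∈ V)
    (hw : w ∈ W) (hY₁ : Y v₁ < Y v₂) (hY₂ : Y v₂ < Y p)
    (h1 : sqDist X Y c p ≤ sqDist X Y c v₁) (h2 : sqDist X Y c v₁ ≤ sqDist X Y c v₂)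
    (h3 : sqDist X Y u v₂ ≤ sqDist X Y u v₁) (h4 : sqDist X Y u v₂ ≤ sqDist X Y u p) :
    sqDist X Y u w ≤ sqDist X Y c w := by
  have n1 := (h.nearVertical_right hc hu hv₁ hv₂ h2 h3).of_lt hY₁
  have n2 := (h.nearVertical_right hu hc hv₂ hp h4 (h1.trans h2)).of_lt hY₂
  have i1 := inner_nonneg_of_sqDist_le h2 h3
  have i2 := inner_nonneg_of_sqDist_le h4 (h1.trans h2)
  have hu2 := h'.1 u hu w hw
  have hc2 := h'.1 c hc w hw
  have hcv := h c hc v₂ hv₂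
  obtain ⟨s, hs⟩ : ∃ s, s = X u - X c := ⟨_, rfl⟩
  obtain ⟨t, ht⟩ : ∃ t, t = Y u - Y c := ⟨_, rfl⟩
  obtain ⟨a, ha⟩ : ∃ a, a = X v₂ - X v₁ := ⟨_, rfl⟩
  obtain ⟨y, hy⟩ : ∃ y, y = Y v₂ - Y v₁ := ⟨_, rfl⟩
  obtain ⟨b, hb⟩ : ∃ b, b = X p - X v₂ := ⟨_, rfl⟩
  obtain ⟨z, hz⟩ : ∃ z, z = Y p - Y v₂ := ⟨_, rfl⟩
  rw [← ha, ← hy] at n1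
  rw [← hb, ← hz] at n2
  have hy0 : 0 < y := by linarith
  have hz0 : 0 < z := by linarith
  have i1' : 0 ≤ s * a + t * y := by subst hs ht ha hy; linarith
  have i2' : s * b + t * z ≤ 0 := by subst hs ht hb hz; linarith
  have hpos : 0 < z * a - y * b := by
    have e1 : 0 ≤ 2 * (a * (X v₂ - X c) + y * (Y v₂ - Y c)) - (a ^ 2 + y ^ 2) := by
      subst ha hy
      unfold sqDist at h2
      linarith
    have e2 : 0 ≤ -2 * (b * (X v₂ - X c) + z * (Y v₂ - Y c)) - (b ^ 2 + z ^ 2) := by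
      subst hb hz
      unfold sqDist at h1 h2
      linarith
    have e3 : z * (a ^ 2 + y ^ 2) + y * (b ^ 2 + z ^ 2) ≤ 2 * ((z * a - y * b) * (X v₂ - X c)) := by
      linarith [mul_nonneg hz0.le e1, mul_nonneg hy0.le e2]
    have e4 : 0 < z * (a ^ 2 + y ^ 2) + y * (b ^ 2 + z ^ 2) := by positivity
    by_contra! h0
    linarith [mul_nonneg (neg_nonneg.2 h0) (show 0 ≤ X v₂ - X c by linarith)]
  have hs0 : 0 ≤ s := by
    by_contra! h0
    linarith [mul_nonneg hz0.le i1', mul_nonneg hy0.le (neg_nonneg.2 i2'),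
      mul_pos (neg_pos.2 h0) hpos]
  have ht1 : t ≤ 0.06 * s := by
    by_contra! h0
    linarith [mul_pos (sub_pos.2 h0) hz0, mul_nonneg hs0 (show 0 ≤ b + 0.06 * z by linarith)]
  have e : s * (2 * X w - X u - X c) + t * (2 * Y w - Y u - Y c) ≥ 0 := by
    have ht2 : -(0.06 * s) ≤ t := by
      by_contra! h0
      linarith [mul_pos (show 0 < -(0.06 * s) - t by linarith) hy0,
        mul_nonneg hs0 (show 0 ≤ 0.06 * y - a by linarith)]
    linarith [mul_nonneg hs0 (show 0 ≤ (2 * X w - X u - X c) - 0.8 by linarith),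
      mul_nonneg (show 0 ≤ 0.06 * s - t by linarith)
        (show 0 ≤ -(2 * Y w - Y u - Y c) by linarith),
      mul_nonneg hs0 (show 0 ≤ 1.9 + (2 * Y w - Y u - Y c) by linarith)]
  subst hs ht
  unfold sqDist
  linarith

end Planar

end Rips

namespace Rips

/-! ### Injections on mutually nearest pairs and on split pairs. -/

section PlanarInjection

variable {α L : Type*} [LinearOrder L] {X Y : α → ℝ} {κ : α → α → L} {U V W : Set α}

/-- `u` and `v` are mutually nearest, in the order of `κ`, among the points of `U` and `V` in the
unit disc around `w`. -/
structure MutuallyNearest (X Y : α → ℝ) (κ : α → α → L) (U V : Set α) (u v w : α) : Prop where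
  left_mem : u ∈ U
  right_mem : v ∈ V
  left_le : sqDist X Y u w ≤ 1
  right_le : sqDist X Y v w ≤ 1
  le_left : ∀ u' ∈ U, sqDist X Y u' w ≤ 1 → κ u v ≤ κ u' v
  le_right : ∀ v' ∈ V, sqDist X Y v' w ≤ 1 → κ u v ≤ κ u v'

/-- The points of `V` above `v` in the unit disc around `w` which some point of `U` in this disc
prefers to `v`. -/
def preferredAbove (X Y : α → ℝ) (κ : α → α → L) (U V : Set α) (v w : α) : Set α :=
  {p | p ∈ V ∧ sqDist X Y p w ≤ 1 ∧ Y v < Y p ∧ ∃ a ∈ U, sqDist X Y a w ≤ 1 ∧ κ a p < κ a v}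

variable (hXY : ∀ p q, X p = X q → Y p = Y q → p = q)
  (hκ : ∀ u v u' v', κ u v ≤ κ u' v' → sqDist X Y u v ≤ sqDist X Y u' v')
  (hκ' : ∀ u v u' v', κ u v = κ u' v' → u = u' ∧ v = v')

include hκ' in
theorem MutuallyNearest.left_unique {u u' v w : α} (h : MutuallyNearest X Y κ U V u v w)
    (h' : MutuallyNearest X Y κ U V u' v w) : u = u' :=
  (hκ' _ _ _ _ (le_antisymm (h.le_left _ h'.left_mem h'.left_le)
    (h'.le_left _ h.left_mem h.left_le))).1

include hXY hκ in
theorem MutuallyNearest.right_eq_of_eq (hUV : OppositeCells X Y U V) {u u' v v' w w' : α}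
    (h : MutuallyNearest X Y κ U V u v w) (h' : MutuallyNearest X Y κ U V u' v' w')
    (hv' : sqDist X Y v' w ≤ 1) (hv : sqDist X Y v w' ≤ 1) (hY : Y v = Y v') : v = v' :=
  eq_of_nearVertical hXY (hUV.nearVertical_right h.left_mem h'.left_mem h.right_mem h'.right_mem
    (hκ _ _ _ _ (h.le_right _ h'.right_mem hv')) (hκ _ _ _ _ (h'.le_right _ h.right_mem hv))) hY

include hXY hκ hκ' in
theorem MutuallyNearest.eq_of_preferredAbove_eq_empty (hUV : OppositeCells X Y U V)
    {u u' v v' w : α} (h : MutuallyNearest X Y κ U V u v w)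
    (h' : MutuallyNearest X Y κ U V u' v' w) (he : preferredAbove X Y κ U V v w = ∅)
    (he' : preferredAbove X Y κ U V v' w = ∅) : u = u' ∧ v = v' := by
  have aux : ∀ {u u' v v' : α}, MutuallyNearest X Y κ U V u v w →
      MutuallyNearest X Y κ U V u' v' w → preferredAbove X Y κ U V v w = ∅ → ¬ Y v < Y v' := by
    intro u u' v v' h h' he hlt
    have hmem : v' ∉ preferredAbove X Y κ U V v w := by simp [he]
    refine hmem ⟨h'.right_mem, h'.right_le, hlt, u', h'.left_mem, h'.left_le, ?_⟩
    refine lt_of_le_of_ne (h'.le_right _ h.right_mem h.right_le) fun heq => ?_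
    rw [(hκ' _ _ _ _ heq).2] at hlt
    exact lt_irrefl _ hlt
  have hY : Y v = Y v' := le_antisymm (not_lt.1 (aux h' h he')) (not_lt.1 (aux h h' he))
  obtain rfl := h.right_eq_of_eq hXY hκ hUV h' h'.right_le h.right_le hY
  exact ⟨h.left_unique hκ' h', rfl⟩

-- If `u'` preceded `u`, it would lie outside the disc around `w`, hence further from `w` than the
-- point `a` that prefers `p` to `v`; `false_of_common_right` excludes this.
include hκ in
theorem MutuallyNearest.not_lt_left (hUV : OppositeCells X Y U V) (hW : BelowCells X Y U V W)
    {u u' v w w' p : α} (hw : w ∈ W) (h : MutuallyNearest X Y κ U V u v w)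
    (h' : MutuallyNearest X Y κ U V u' v w') (hp : p ∈ preferredAbove X Y κ U V v w)
    (hp' : p ∈ preferredAbove X Y κ U V v w') : ¬ κ u' v < κ u v := by
  intro hlt
  obtain ⟨hpV, -, hY, a, ha, haw, hlt'⟩ := hp
  have hu' : 1 < sqDist X Y u' w := by
    by_contra! hle
    exact not_le.2 hlt (h.le_left _ h'.left_mem hle)
  exact false_of_common_right hUV hW h'.left_mem ha h.right_mem hpV hw hY
    (hκ _ _ _ _ (hlt.le.trans (h.le_left _ ha haw))) (haw.trans_lt hu') (hκ _ _ _ _ hlt'.le)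
    (hκ _ _ _ _ (h'.le_right _ hpV hp'.2.1))

include hκ in
theorem MutuallyNearest.sqDist_le_one_of_mem (hUV : OppositeCells X Y U V)
    (hW : BelowCells X Y U V W) {u v w w₀ p : α} (h : MutuallyNearest X Y κ U V u v w)
    (hp : p ∈ preferredAbove X Y κ U V v w) (hw₀ : w₀ ∈ W) (hpw : sqDist X Y p w₀ ≤ 1) :
    sqDist X Y v w₀ ≤ 1 := by
  obtain ⟨hpV, hpw', hY, a, ha, haw, hlt⟩ := hp
  exact (hW.sqDist_le h.right_mem hpV hw₀ (hUV.nearVertical_right h.left_mem ha h.right_mem hpV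
    (hκ _ _ _ _ (h.le_right _ hpV hpw')) (hκ _ _ _ _ hlt.le)) hY).trans hpw

-- Suppose `v` is below `v'`. As `p` is the lowest preferred point, no point of `U` in the disc
-- around `w` prefers `v'` to `v`. Then `sqDist_le_of_middle` puts `u'` into this disc, although
-- `u'` prefers `v'`.
include hκ hκ' in
theorem MutuallyNearest.not_lt_of_isLeast (hUV : OppositeCells X Y U V)
    (hW : BelowCells X Y U V W) {u u' v v' w w' p : α} (hw : w ∈ W) (hw' : w' ∈ W)
    (h : MutuallyNearest X Y κ U V u v w) (h' : MutuallyNearest X Y κ U V u' v' w')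
    (hp : p ∈ preferredAbove X Y κ U V v w)
    (hmin : ∀ q ∈ preferredAbove X Y κ U V v w, Y p ≤ Y q)
    (hp' : p ∈ preferredAbove X Y κ U V v' w') : ¬ Y v < Y v' := by
  intro hlt
  have hv' := h'.sqDist_le_one_of_mem hκ hUV hW hp' hw hp.2.1
  have hv := h.sqDist_le_one_of_mem hκ hUV hW hp hw' hp'.2.1
  have hall : ∀ a ∈ U, sqDist X Y a w ≤ 1 → κ a v ≤ κ a v' := by
    intro a ha haw
    by_contra! hcon
    exact not_lt.2 (hmin v' ⟨h'.right_mem, hv', hlt, a, ha, haw, hcon⟩) hp'.2.2.1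
  obtain ⟨hpV, -, hY, c, hc, hcw, hcp⟩ := hp
  have hle := sqDist_le_of_middle hUV hW h'.left_mem hc h.right_mem h'.right_mem hpV hw hlt
    hp'.2.2.1 (hκ _ _ _ _ hcp.le) (hκ _ _ _ _ (hall c hc hcw))
    (hκ _ _ _ _ (h'.le_right _ h.right_mem hv)) (hκ _ _ _ _ (h'.le_right _ hpV hp'.2.1))
  have heq := le_antisymm (hall u' h'.left_mem (hle.trans hcw)) (h'.le_right _ h.right_mem hv)
  rw [(hκ' _ _ _ _ heq).2] at hlt
  exact lt_irrefl _ hlt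

include hXY hκ hκ' in
/-- Mutually nearest pairs are determined by one of their witnesses or by a point of `V` in the
unit disc around the witness. -/
theorem exists_injOn_of_mutuallyNearest (hUV : OppositeCells X Y U V) (hW : BelowCells X Y U V W)
    (hV : V.Finite) (T : Set (α × α)) (f : α × α → α)
    (hT : ∀ e ∈ T, f e ∈ W ∧ MutuallyNearest X Y κ U V e.1 e.2 (f e)) :
    ∃ g : α × α → α ⊕ α, Set.InjOn g T ∧
      ∀ e ∈ T, g e = Sum.inl (f e) ∨ ∃ p ∈ V, sqDist X Y p (f e) ≤ 1 ∧ g e = Sum.inr p := by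
  classical
  let P : α × α → Set α := fun e => preferredAbove X Y κ U V e.2 (f e)
  have hP : ∀ e, ∃ p, (P e).Nonempty → p ∈ P e ∧ ∀ q ∈ P e, Y p ≤ Y q := fun e => by
    by_cases he : (P e).Nonempty
    · obtain ⟨p, hp⟩ := Set.exists_min_image (P e) Y (hV.subset fun _ h => h.1) he
      exact ⟨p, fun _ => hp⟩
    · exact ⟨e.1, fun h => (he h).elim⟩
  choose m hm using hP
  -- The code of a pair is its lowest preferred point above `v`, or the witness if there is none.
  refine ⟨fun e => if (P e).Nonempty then Sum.inr (m e) else Sum.inl (f e), ?_, ?_⟩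
  · rintro ⟨u, v⟩ he ⟨u', v'⟩ he' heq
    obtain ⟨hw, h⟩ := hT _ he
    obtain ⟨hw', h'⟩ := hT _ he'
    by_cases hne : (P (u, v)).Nonempty <;> by_cases hne' : (P (u', v')).Nonempty <;>
      simp only [hne, hne', if_true, if_false, reduceCtorEq] at heq
    · have heq := Sum.inr.inj heq
      obtain ⟨hp, hmin1⟩ := hm _ hne
      obtain ⟨hp', hmin2⟩ := hm _ hne'
      rw [← heq] at hp' hmin2
      have hY : Y v = Y v' := le_antisymm
        (not_lt.1 (h'.not_lt_of_isLeast hκ hκ' hUV hW hw' hw h hp' hmin2 hp))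
        (not_lt.1 (h.not_lt_of_isLeast hκ hκ' hUV hW hw hw' h' hp hmin1 hp'))
      obtain rfl : v = v' := h.right_eq_of_eq hXY hκ hUV h'
        (h'.sqDist_le_one_of_mem hκ hUV hW hp' hw hp.2.1)
        (h.sqDist_le_one_of_mem hκ hUV hW hp hw' hp'.2.1) hY
      have h1 := h.not_lt_left hκ hUV hW hw h' hp hp'
      have h2 := h'.not_lt_left hκ hUV hW hw' h hp' hp
      exact Prod.ext (hκ' _ _ _ _ (le_antisymm (not_lt.1 h1) (not_lt.1 h2))).1 rfl
    · have heq := Sum.inl.inj heq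
      dsimp only at h h'
      rw [← heq] at h'
      obtain ⟨rfl, rfl⟩ := h.eq_of_preferredAbove_eq_empty hXY hκ hκ' hUV h'
        (Set.not_nonempty_iff_eq_empty.1 hne)
        (by rw [heq]; exact Set.not_nonempty_iff_eq_empty.1 hne')
      rfl
  · intro e he
    by_cases hne : (P e).Nonempty
    · exact Or.inr ⟨m e, (hm _ hne).1.1, (hm _ hne).1.2.1, by simp [hne]⟩
    · exact Or.inl (by simp [hne])

/-- The pairs at distance at most one whose common neighbours preceding them are mutually
nonadjacent. -/
structure SplitPair (X Y : α → ℝ) (κ : α → α → L) (U V : Set α) (u v : α) : Prop where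
  left_mem : u ∈ U
  right_mem : v ∈ V
  le_one : sqDist X Y u v ≤ 1
  exists_left : ∃ u' ∈ U, κ u' v < κ u v
  exists_right : ∃ v' ∈ V, κ u v' < κ u v
  le : ∀ u' ∈ U, κ u' v < κ u v → ∀ v' ∈ V, κ u v' < κ u v → sqDist X Y u' v' ≤ 1 →
    κ u v ≤ κ u' v'

/-- The preceding neighbours of `u` lie below `v` and those of `v` lie above `u`. -/
def IsUpward (Y : α → ℝ) (κ : α → α → L) (U V : Set α) (u v : α) : Prop :=
  (∀ u' ∈ U, κ u' v < κ u v → Y u < Y u') ∧ ∀ v' ∈ V, κ u v' < κ u v → Y v' < Y v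

theorem sqDist_neg_right (p q : α) : sqDist X (fun p => -Y p) p q = sqDist X Y p q := by
  unfold sqDist
  ring

theorem SplitPair.neg_right {u v : α} (h : SplitPair X Y κ U V u v) :
    SplitPair X (fun p => -Y p) κ U V u v where
  left_mem := h.left_mem
  right_mem := h.right_mem
  le_one := by rw [sqDist_neg_right]; exact h.le_one
  exists_left := h.exists_left
  exists_right := h.exists_right
  le u' hu' hu v' hv' hv hle := h.le u' hu' hu v' hv' hv (by rwa [sqDist_neg_right] at hle)

include hκ in
theorem SplitPair.sqDist_le {u v u' v' : α} (h : SplitPair X Y κ U V u v) (hu' : u' ∈ U)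
    (hu : κ u' v < κ u v) (hv' : v' ∈ V) (hv : κ u v' < κ u v) :
    sqDist X Y u v ≤ sqDist X Y u' v' := by
  by_cases hle : sqDist X Y u' v' ≤ 1
  · exact hκ _ _ _ _ (h.le u' hu' hu v' hv' hv hle)
  · exact h.le_one.trans (not_le.1 hle).le

include hκ in
theorem SplitPair.nearVertical_right (hUV : OppositeCells X Y U V) {u v v' : α}
    (h : SplitPair X Y κ U V u v) (hv' : v' ∈ V) (hv : κ u v' < κ u v) :
    NearVertical X Y v' v := by
  obtain ⟨u', hu', hu⟩ := h.exists_left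
  exact hUV.nearVertical_right h.left_mem hu' hv' h.right_mem (hκ _ _ _ _ hv.le)
    ((hκ _ _ _ _ hu.le).trans (h.sqDist_le hκ hu' hu hv' hv))

include hκ in
theorem SplitPair.nearVertical_left (hUV : OppositeCells X Y U V) {u v u' : α}
    (h : SplitPair X Y κ U V u v) (hu' : u' ∈ U) (hu : κ u' v < κ u v) :
    NearVertical X Y u' u := by
  obtain ⟨v', hv', hv⟩ := h.exists_right
  exact hUV.nearVertical_left hu' h.left_mem h.right_mem hv' (hκ _ _ _ _ hu.le)
    ((hκ _ _ _ _ hv.le).trans (h.sqDist_le hκ hu' hu hv' hv))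

theorem mul_add_mul_neg_of_nearVertical {p q r s : α} (h : NearVertical X Y p q)
    (h' : NearVertical X Y r s) (hY : Y p < Y q) (hY' : Y s < Y r) :
    (X q - X p) * (X s - X r) + (Y q - Y p) * (Y s - Y r) < 0 := by
  have h1 := abs_le.2 (h.of_lt hY)
  have h2 := abs_le.2 (h'.symm.of_lt hY')
  have h3 : |(X q - X p) * (X r - X s)| ≤ (0.06 * (Y q - Y p)) * (0.06 * (Y r - Y s)) := by
    rw [abs_mul]
    exact mul_le_mul h1 h2 (abs_nonneg _) (mul_nonneg (by norm_num) (sub_nonneg.2 hY.le))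
  have h4 := mul_pos (sub_pos.2 hY) (sub_pos.2 hY')
  linarith [(abs_le.1 h3).1]

-- The points `u`, `u'` disagree about `v`, `v'`, so `u' - u` and `v - v'` have nonnegative product.
-- Both are almost vertical, so they point the same way.
include hXY hκ in
theorem SplitPair.lt_of_lt (hUV : OppositeCells X Y U V) {u v u' v' : α}
    (h : SplitPair X Y κ U V u v) (hu' : u' ∈ U) (hu : κ u' v < κ u v) (hv' : v' ∈ V)
    (hv : κ u v' < κ u v) : Y u < Y u' ↔ Y v' < Y v := by
  have aux : ∀ {Y : α → ℝ}, (∀ p q, X p = X q → Y p = Y q → p = q) →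
      (∀ u v u' v', κ u v ≤ κ u' v' → sqDist X Y u v ≤ sqDist X Y u' v') →
      OppositeCells X Y U V → SplitPair X Y κ U V u v → Y u < Y u' → Y v' < Y v := by
    intro Y hXY hκ hUV h hlt
    have nv := h.nearVertical_right hκ hUV hv' hv
    have nu := h.nearVertical_left hκ hUV hu' hu
    have hin := inner_nonneg_of_sqDist_le (hκ _ _ _ _ hv.le)
      ((hκ _ _ _ _ hu.le).trans (h.sqDist_le hκ hu' hu hv' hv))
    by_contra! hle
    rcases hle.lt_or_eq with hle | heq
    · exact not_lt.2 hin (mul_add_mul_neg_of_nearVertical nu.symm nv hlt hle)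
    · rw [eq_of_nearVertical hXY nv heq.symm] at hv
      exact lt_irrefl _ hv
  refine ⟨aux hXY hκ hUV h, fun hlt => ?_⟩
  by_contra! hle
  rcases hle.lt_or_eq with hle | heq
  · have := aux (Y := fun p => -Y p) (fun p q h1 h2 => hXY p q h1 (neg_inj.1 h2))
      (fun _ _ _ _ h => by simpa only [sqDist_neg_right] using hκ _ _ _ _ h) hUV.neg_right
      h.neg_right (neg_lt_neg hle)
    exact lt_asymm hlt (neg_lt_neg_iff.1 this)
  · rw [eq_of_nearVertical hXY (h.nearVertical_left hκ hUV hu' hu) heq] at hu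
    exact lt_irrefl _ hu

include hXY hκ in
theorem SplitPair.isUpward_or (hUV : OppositeCells X Y U V) {u v : α}
    (h : SplitPair X Y κ U V u v) :
    IsUpward Y κ U V u v ∨ IsUpward (fun p => -Y p) κ U V u v := by
  obtain ⟨u₀, hu₀, hu⟩ := h.exists_left
  obtain ⟨v₀, hv₀, hv⟩ := h.exists_right
  have hne : ∀ v' ∈ V, κ u v' < κ u v → Y v ≠ Y v' := by
    intro v' hv' hv heq
    rw [eq_of_nearVertical hXY (h.nearVertical_right hκ hUV hv' hv) heq.symm] at hv
    exact lt_irrefl _ hv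
  have hne' : ∀ u' ∈ U, κ u' v < κ u v → Y u ≠ Y u' := by
    intro u' hu' hu heq
    rw [eq_of_nearVertical hXY (h.nearVertical_left hκ hUV hu' hu) heq.symm] at hu
    exact lt_irrefl _ hu
  by_cases hlt : Y u < Y u₀
  · have h1 : ∀ v' ∈ V, κ u v' < κ u v → Y v' < Y v := fun v' hv' hv' =>
      (h.lt_of_lt hXY hκ hUV hu₀ hu ‹_› hv').1 hlt
    exact Or.inl ⟨fun u' hu' hu'' => (h.lt_of_lt hXY hκ hUV hu' hu'' hv₀ hv).2 (h1 v₀ hv₀ hv), h1⟩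
  · have h1 : ∀ v' ∈ V, κ u v' < κ u v → Y v < Y v' := fun v' hv'' hv' =>
      lt_of_le_of_ne (not_lt.1 fun h2 => hlt ((h.lt_of_lt hXY hκ hUV hu₀ hu hv'' hv').2 h2))
        (hne v' hv'' hv')
    refine Or.inr ⟨fun u' hu' hu'' => neg_lt_neg (lt_of_le_of_ne (not_lt.1 fun h2 => ?_)
      (hne' u' hu' hu'').symm), fun v' hv' hv'' => neg_lt_neg (h1 v' hv' hv'')⟩
    exact lt_asymm (h1 v₀ hv₀ hv) ((h.lt_of_lt hXY hκ hUV hu' hu'' hv₀ hv).1 h2)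

-- Take `u₁` preceding `u` for `v`. If it also precedes `u` for `v'`, the edge `u₁v` violates the
-- split condition at `uv'`. Otherwise `u` and `u₁` disagree about `v` and `v'`, although `u₁` is
-- above `u` and `v` is below `v'`.
include hκ in
theorem SplitPair.not_lt_of_isUpward (hUV : OppositeCells X Y U V) {u v v' : α}
    (h : SplitPair X Y κ U V u v) (h' : SplitPair X Y κ U V u v') (hup : IsUpward Y κ U V u v)
    (hup' : IsUpward Y κ U V u v') : ¬ κ u v < κ u v' := by
  intro hlt
  obtain ⟨u₁, hu₁, hu⟩ := h.exists_left
  have hD := hκ _ _ _ _ hu.le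
  by_cases hlt' : κ u₁ v' < κ u v'
  · exact not_le.2 (hu.trans hlt) (h'.le u₁ hu₁ hlt' v h.right_mem hlt (hD.trans h.le_one))
  · have hneg := mul_add_mul_neg_of_nearVertical (h.nearVertical_left hκ hUV hu₁ hu).symm
      (h'.nearVertical_right hκ hUV h.right_mem hlt).symm (hup.1 u₁ hu₁ hu)
      (hup'.2 v h.right_mem hlt)
    have hle := hκ _ _ _ _ (not_lt.1 hlt')
    unfold sqDist at hle hD
    linarith

include hXY hκ hκ' in
/-- Split pairs with a given first point are determined by their direction. -/
theorem exists_injOn_of_splitPair (hUV : OppositeCells X Y U V) :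
    ∃ g : α → α → Bool, ∀ u v v', SplitPair X Y κ U V u v → SplitPair X Y κ U V u v' →
      g u v = g u v' → v = v' := by
  classical
  refine ⟨fun u v => decide (IsUpward Y κ U V u v), fun u v v' h h' hg => ?_⟩
  have aux : ∀ {Y : α → ℝ},
      (∀ u v u' v', κ u v ≤ κ u' v' → sqDist X Y u v ≤ sqDist X Y u' v') →
      OppositeCells X Y U V → SplitPair X Y κ U V u v → SplitPair X Y κ U V u v' →
      IsUpward Y κ U V u v → IsUpward Y κ U V u v' → v = v' := by
    intro Y hκ hUV h h' hup hup'
    exact (hκ' _ _ _ _ (le_antisymm (not_lt.1 (h'.not_lt_of_isUpward hκ hUV h hup' hup))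
      (not_lt.1 (h.not_lt_of_isUpward hκ hUV h' hup hup')))).2
  have hg : IsUpward Y κ U V u v ↔ IsUpward Y κ U V u v' := decide_eq_decide.1 hg
  by_cases hup : IsUpward Y κ U V u v
  · exact aux hκ hUV h h' hup (hg.1 hup)
  · refine aux (Y := fun p => -Y p)
      (fun _ _ _ _ h => by simpa only [sqDist_neg_right] using hκ _ _ _ _ h) hUV.neg_right
      h.neg_right h'.neg_right ((h.isUpward_or hXY hκ hUV).resolve_left hup)
      ((h'.isUpward_or hXY hκ hUV).resolve_left fun h => hup (hg.2 h))

end PlanarInjection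

end Rips

namespace Rips

/-! ### The plane -/

/-- Two points are adjacent if they are at distance at most one. -/
def ripsGraph (V : Type*) [PseudoMetricSpace V] : SimpleGraph V where
  Adj x y := x ≠ y ∧ dist x y ≤ 1
  symm := ⟨fun _ _ h => ⟨h.1.symm, (dist_comm _ _).trans_le h.2⟩⟩
  loopless := ⟨fun _ h => h.1 rfl⟩

/-- The order of pairs by distance, with ties broken lexicographically. -/
noncomputable def distKey {V : Type*} [PseudoMetricSpace V] (u v : V) : ℝ ×ₗ V ×ₗ V :=
  toLex (dist u v, lexKey u v)

section DistKey

variable {V : Type*} [MetricSpace V] [LinearOrder V]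

theorem dist_le_of_distKey_le {u v u' v' : V} (h : distKey u v ≤ distKey u' v') :
    dist u v ≤ dist u' v' := by
  rcases Prod.Lex.toLex_le_toLex.1 h with h | h
  · exact h.le
  · exact h.1.le

omit [LinearOrder V] in
theorem distKey_injective {u v u' v' : V} (h : distKey u v = distKey u' v') : u = u' ∧ v = v' :=
  Prod.mk.inj (toLex_inj.1 (Prod.mk.inj (toLex_inj.1 h)).2)

end DistKey

/-! ### Adapted coordinates for a pair or triple of cells. -/

section Coordinates

theorem exists_coordinates {u v : EuclideanSpace ℝ (Fin 2)} (h : u ≠ v) :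
    ∃ X Y : EuclideanSpace ℝ (Fin 2) → ℝ, (∀ p q, sqDist X Y p q = dist p q ^ 2) ∧
      X v - X u = dist u v ∧ Y v = Y u := by
  have hl : dist u v ≠ 0 := (dist_pos.2 h).ne'
  have hsq : ∀ p q : EuclideanSpace ℝ (Fin 2), dist p q ^ 2 = (p 0 - q 0) ^ 2 + (p 1 - q 1) ^ 2 := by
    intro p q
    rw [EuclideanSpace.dist_eq, Real.sq_sqrt (Finset.sum_nonneg fun _ _ => sq_nonneg _),
      Fin.sum_univ_two, Real.dist_eq, Real.dist_eq, sq_abs, sq_abs]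
  have huv := hsq u v
  refine ⟨fun p => ((v 0 - u 0) * p 0 + (v 1 - u 1) * p 1) / dist u v,
    fun p => ((v 0 - u 0) * p 1 - (v 1 - u 1) * p 0) / dist u v, fun p q => ?_, ?_, ?_⟩
  · rw [hsq, sqDist, ← sub_div, ← sub_div, div_pow, div_pow, ← add_div, div_eq_iff (pow_ne_zero 2 hl),
      huv]
    ring
  · rw [← sub_div, div_eq_iff hl, ← sq, huv]
    ring
  · dsimp only
    congr 1
    ring

variable {α : Type*} [PseudoMetricSpace α] {X Y : α → ℝ}

theorem abs_sub_le_dist_of_sqDist_eq (h : ∀ p q, sqDist X Y p q = dist p q ^ 2) (p q : α) :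
    |X p - X q| ≤ dist p q ∧ |Y p - Y q| ≤ dist p q := by
  have h1 := h p q
  unfold sqDist at h1
  exact ⟨abs_le_of_sq_le_sq (by linarith [sq_nonneg (Y p - Y q)]) dist_nonneg,
    abs_le_of_sq_le_sq (by linarith [sq_nonneg (X p - X q)]) dist_nonneg⟩

theorem oppositeCells_of_coordinates (h : ∀ p q, sqDist X Y p q = dist p q ^ 2) {U V : Set α}
    (hU : ∀ x ∈ U, ∀ y ∈ U, dist x y ≤ 1 / 200) (hV : ∀ x ∈ V, ∀ y ∈ V, dist x y ≤ 1 / 200)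
    {u v : α} (hu : u ∈ U) (hv : v ∈ V) (h1 : 0.99 ≤ dist u v) (h2 : dist u v ≤ 1)
    (hX : X v - X u = dist u v) (hY : Y v = Y u) : OppositeCells X Y U V := by
  intro u' hu' v' hv'
  have h3 := abs_sub_le_dist_of_sqDist_eq h u' u
  have h4 := abs_sub_le_dist_of_sqDist_eq h v' v
  have h5 := hU u' hu' u hu
  have h6 := hV v' hv' v hv
  obtain ⟨a1, a2⟩ := abs_le.1 (h3.1.trans h5)
  obtain ⟨a3, a4⟩ := abs_le.1 (h3.2.trans h5)
  obtain ⟨a5, a6⟩ := abs_le.1 (h4.1.trans h6)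
  obtain ⟨a7, a8⟩ := abs_le.1 (h4.2.trans h6)
  exact ⟨⟨by linarith, by linarith⟩, by linarith, by linarith⟩

theorem belowCells_of_coordinates (h : ∀ p q, sqDist X Y p q = dist p q ^ 2) {U V W : Set α}
    (hU : ∀ x ∈ U, ∀ y ∈ U, dist x y ≤ 1 / 200) (hV : ∀ x ∈ V, ∀ y ∈ V, dist x y ≤ 1 / 200)
    (hW : ∀ x ∈ W, ∀ y ∈ W, dist x y ≤ 1 / 200)
    {u v w : α} (hu : u ∈ U) (hv : v ∈ V) (hw : w ∈ W) (h1 : 0.99 ≤ dist u v) (h2 : dist u v ≤ 1)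
    (h3 : 0.99 ≤ dist w u) (h4 : dist w u ≤ 1) (h5 : 0.99 ≤ dist w v) (h6 : dist w v ≤ 1)
    (hX : X v - X u = dist u v) (hY : Y v = Y u) (hwu : Y w ≤ Y u) : BelowCells X Y U V W := by
  obtain ⟨a, ha⟩ : ∃ a, a = X w - X u := ⟨_, rfl⟩
  obtain ⟨b, hb⟩ : ∃ b, b = Y u - Y w := ⟨_, rfl⟩
  obtain ⟨l, hl⟩ : ∃ l, l = dist u v := ⟨_, rfl⟩
  rw [← hl] at h1 h2 hX
  have e1 : a ^ 2 + b ^ 2 = dist w u ^ 2 := by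
    rw [← h w u, sqDist, ha, hb]
    ring
  have e2 : (a - l) ^ 2 + b ^ 2 = dist w v ^ 2 := by
    rw [← h w v, sqDist, ha, hb, hY, ← hX]
    ring
  have hb0 : 0 ≤ b := by linarith
  have q1 := pow_le_pow_left₀ (by norm_num) h3 2
  have q2 := pow_le_pow_left₀ dist_nonneg h4 2
  have q3 := pow_le_pow_left₀ (by norm_num) h5 2
  have q4 := pow_le_pow_left₀ dist_nonneg h6 2
  rw [← e1] at q1 q2
  rw [← e2] at q3 q4
  norm_num at q1 q2 q3 q4
  have a1 : 0.48 ≤ a := by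
    by_contra! hlt
    have := mul_le_mul_of_nonneg_left (show 2 * a - l ≤ -0.03 by linarith)
      (show 0 ≤ l by linarith)
    linarith
  have a2 : a ≤ 0.52 := by
    by_contra! hlt
    have := mul_le_mul_of_nonneg_left (show 0.04 ≤ 2 * a - l by linarith)
      (show 0 ≤ l by linarith)
    linarith
  have a3 := pow_le_pow_left₀ (by norm_num) a1 2
  have a4 := pow_le_pow_left₀ (by linarith) a2 2
  have b1 : 0.8 ≤ b := by
    by_contra! hlt
    have := pow_le_pow_left₀ hb0 hlt.le 2
    norm_num at *
    linarith
  have b2 : b ≤ 0.9 := by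
    by_contra! hlt
    have := pow_le_pow_left₀ (by norm_num) hlt.le 2
    norm_num at *
    linarith
  constructor
  · intro u' hu' w' hw'
    have h3 := abs_sub_le_dist_of_sqDist_eq h u' u
    have h4 := abs_sub_le_dist_of_sqDist_eq h w' w
    have h5 := hU u' hu' u hu
    have h6 := hW w' hw' w hw
    obtain ⟨c1, c2⟩ := abs_le.1 (h3.1.trans h5)
    obtain ⟨c3, c4⟩ := abs_le.1 (h3.2.trans h5)
    obtain ⟨c5, c6⟩ := abs_le.1 (h4.1.trans h6)
    obtain ⟨c7, c8⟩ := abs_le.1 (h4.2.trans h6)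
    exact ⟨⟨by linarith, by linarith⟩, by linarith, by linarith⟩
  · intro v' hv' w' hw'
    have h3 := abs_sub_le_dist_of_sqDist_eq h v' v
    have h4 := abs_sub_le_dist_of_sqDist_eq h w' w
    have h5 := hV v' hv' v hv
    have h6 := hW w' hw' w hw
    obtain ⟨c1, c2⟩ := abs_le.1 (h3.1.trans h5)
    obtain ⟨c3, c4⟩ := abs_le.1 (h3.2.trans h5)
    obtain ⟨c5, c6⟩ := abs_le.1 (h4.1.trans h6)
    obtain ⟨c7, c8⟩ := abs_le.1 (h4.2.trans h6)
    exact ⟨⟨by linarith, by linarith⟩, by linarith, by linarith⟩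

theorem eq_of_coordinates {α : Type*} [MetricSpace α] {X Y : α → ℝ}
    (h : ∀ p q, sqDist X Y p q = dist p q ^ 2) (p q : α) (hX : X p = X q) (hY : Y p = Y q) :
    p = q := by
  have h1 := h p q
  rw [sqDist, hX, hY, sub_self, sub_self] at h1
  exact dist_eq_zero.1 (pow_eq_zero_iff two_ne_zero |>.1 (by linarith))

theorem sqDist_le_of_coordinates (h : ∀ p q, sqDist X Y p q = dist p q ^ 2) {p q p' q' : α}
    (hle : dist p q ≤ dist p' q') : sqDist X Y p q ≤ sqDist X Y p' q' := by
  rw [h, h]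
  exact pow_le_pow_left₀ dist_nonneg hle 2

theorem sqDist_le_one_iff (h : ∀ p q, sqDist X Y p q = dist p q ^ 2) {p q : α} :
    sqDist X Y p q ≤ 1 ↔ dist p q ≤ 1 := by
  rw [h]
  exact sq_le_one_iff₀ dist_nonneg

end Coordinates

/-! ### From bad edges in the plane to the planar configurations. -/

section PlaneCount

open Finset

variable {ι : Type*} [LinearOrder ι] [LinearOrder (EuclideanSpace ℝ (Fin 2))]
  {S : Finset (EuclideanSpace ℝ (Fin 2))} {cell : EuclideanSpace ℝ (Fin 2) → ι}

-- Some pair in these cells is at distance above `1`, and each cell contributes at most `1 / 200`.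
-- So critical edges have almost unit length.
omit [LinearOrder (EuclideanSpace ℝ (Fin 2))] in
theorem le_dist_of_not_fullyAdjacent {V ι : Type*} [PseudoMetricSpace V] {S : Finset V}
    {cell : V → ι} (hcell : ∀ x ∈ S, ∀ y ∈ S, cell x = cell y → dist x y ≤ 1 / 200) {u v : V}
    (hu : u ∈ S) (hv : v ∈ S) (h : ¬ FullyAdjacent (ripsGraph V) S cell u v) :
    0.99 ≤ dist u v := by
  unfold FullyAdjacent at h
  push Not at h
  obtain ⟨x, hx, y, hy, hxu, hyv, hne, hadj⟩ := h
  have h1 : 1 < dist x y := by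
    by_contra! hle
    exact hadj ⟨hne, hle⟩
  have h2 := hcell x hx u hu hxu
  have h3 := hcell v hv y hy hyv.symm
  linarith [dist_triangle4 x u v y]

theorem exists_direction_of_splitEdges
    (hcell : ∀ x ∈ S, ∀ y ∈ S, cell x = cell y → dist x y ≤ 1 / 200) (a b : ι) :
    ∃ g : EuclideanSpace ℝ (Fin 2) → EuclideanSpace ℝ (Fin 2) → Bool, ∀ u v v',
      cell u = a → cell v = b → cell v' = b →
      (u, v) ∈ splitEdges (ripsGraph _) S cell distKey →
      (u, v') ∈ splitEdges (ripsGraph _) S cell distKey → g u v = g u v' → v = v' := by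
  by_cases hex : ∃ u v, cell u = a ∧ cell v = b ∧ (u, v) ∈ splitEdges (ripsGraph _) S cell distKey
  · obtain ⟨u₀, v₀, hu₀, hv₀, he⟩ := hex
    obtain ⟨⟨⟨hu₀S, hv₀S⟩, hlt, hadj, hfull⟩, -⟩ := mem_splitEdges.1 he
    obtain ⟨X, Y, hXY, hX, hY⟩ := exists_coordinates hadj.1
    have hab : a ≠ b := by
      rintro rfl
      exact hlt.ne (hu₀.trans hv₀.symm)
    have hU : ∀ c, ∀ x ∈ {x | x ∈ S ∧ cell x = c}, ∀ y ∈ {x | x ∈ S ∧ cell x = c},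
        dist x y ≤ 1 / 200 := fun c x hx y hy => hcell x hx.1 y hy.1 (hx.2.trans hy.2.symm)
    -- One split edge fixes the coordinate frame for all split edges between these two cells.
    obtain ⟨g, hg⟩ := exists_injOn_of_splitPair (κ := distKey) (eq_of_coordinates hXY)
      (fun u v u' v' h => sqDist_le_of_coordinates hXY (dist_le_of_distKey_le h))
      (fun u v u' v' h => distKey_injective h)
      (oppositeCells_of_coordinates hXY (hU a) (hU b) ⟨hu₀S, hu₀⟩ ⟨hv₀S, hv₀⟩
        (le_dist_of_not_fullyAdjacent hcell hu₀S hv₀S hfull) hadj.2 hX hY)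
    have hsplit : ∀ u v, cell u = a → cell v = b →
        (u, v) ∈ splitEdges (ripsGraph _) S cell distKey →
        SplitPair X Y distKey {x | x ∈ S ∧ cell x = a} {x | x ∈ S ∧ cell x = b} u v := by
      intro u v hu hv he
      obtain ⟨⟨⟨huS, hvS⟩, -, hadj, -⟩, ⟨u', hu'S, hu', -, hu''⟩, ⟨v', hv'S, hv', -, hv''⟩, hs⟩ :=
        mem_splitEdges.1 he
      have hne : ∀ {x y}, cell x = a → cell y = b → x ≠ y := by
        rintro x y hx hy rfl
        exact hab (hx.symm.trans hy)
      refine ⟨⟨huS, hu⟩, ⟨hvS, hv⟩, (sqDist_le_one_iff hXY).2 hadj.2,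
        ⟨u', ⟨hu'S, hu'.trans hu⟩, hu''⟩, ⟨v', ⟨hv'S, hv'.trans hv⟩, hv''⟩, ?_⟩
      intro x hx hxlt y hy hylt hle
      exact hs x hx.1 (hx.2.trans hu.symm) ⟨hne hx.2 hv, (dist_le_of_distKey_le hxlt.le).trans hadj.2⟩
        hxlt y hy.1 (hy.2.trans hv.symm) ⟨hne hu hy.2, (dist_le_of_distKey_le hylt.le).trans hadj.2⟩
        hylt ⟨hne hx.2 hy.2, (sqDist_le_one_iff hXY).1 hle⟩
    exact ⟨g, fun u v v' hu hv hv' h h' hgg => hg u v v' (hsplit u v hu hv h) (hsplit u v' hu hv' h')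
      hgg⟩
  · exact ⟨fun _ _ => true, fun u v v' hu hv _ h => (hex ⟨u, v, hu, hv, h⟩).elim⟩

theorem card_splitEdges_distKey_le
    (hcell : ∀ x ∈ S, ∀ y ∈ S, cell x = cell y → dist x y ≤ 1 / 200) {C : ℕ}
    (hC : ∀ v ∈ S, ((S.filter fun x => dist v x ≤ 2).image cell).card ≤ C) :
    (splitEdges (ripsGraph _) S cell distKey).card ≤ S.card * (C * 2) := by
  choose g hg using exists_direction_of_splitEdges hcell
  let f : EuclideanSpace ℝ (Fin 2) × EuclideanSpace ℝ (Fin 2) →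
    EuclideanSpace ℝ (Fin 2) × ι × Bool :=
    fun e => (e.1, cell e.2, g (cell e.1) (cell e.2) e.1 e.2)
  let I : Finset (EuclideanSpace ℝ (Fin 2) × ι × Bool) := S.biUnion fun u =>
    ({u} : Finset (EuclideanSpace ℝ (Fin 2))) ×ˢ
      (((S.filter fun x => dist u x ≤ 2).image cell) ×ˢ (univ : Finset Bool))
  have hI : I.card ≤ S.card * (C * 2) := by
    refine card_biUnion_le_card_mul _ _ _ fun u hu => ?_
    rw [card_product, card_product, card_singleton, one_mul, card_univ, Fintype.card_bool]
    exact Nat.mul_le_mul_right _ (hC u hu)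
  refine (card_le_card_of_injOn f ?_ ?_).trans hI
  · rintro ⟨u, v⟩ he
    obtain ⟨⟨⟨hu, hv⟩, -, hadj, -⟩, -⟩ := mem_splitEdges.1 he
    exact mem_biUnion.2 ⟨u, hu, mem_product.2 ⟨mem_singleton_self _, mem_product.2
      ⟨mem_image_of_mem _ (mem_filter.2 ⟨hv, hadj.2.trans one_le_two⟩), mem_univ _⟩⟩⟩
  · rintro ⟨u, v⟩ he ⟨u', v'⟩ he' heq
    obtain ⟨h1, heq⟩ := Prod.mk.inj heq
    obtain ⟨h2, h3⟩ := Prod.mk.inj heq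
    dsimp only at h1 h2 h3
    subst h1
    rw [← h2] at h3
    rw [hg _ _ u v v' rfl rfl h2.symm he he' h3]

theorem exists_injection_of_isolatedWitness
    (hcell : ∀ x ∈ S, ∀ y ∈ S, cell x = cell y → dist x y ≤ 1 / 200)
    (T : Set (EuclideanSpace ℝ (Fin 2) × EuclideanSpace ℝ (Fin 2)))
    (f : EuclideanSpace ℝ (Fin 2) × EuclideanSpace ℝ (Fin 2) → EuclideanSpace ℝ (Fin 2))
    (hT : ∀ e ∈ T, e ∈ isolatedEdges (ripsGraph _) S cell distKey ∧
      IsolatedWitness (ripsGraph _) S cell distKey e.1 e.2 (f e) ∧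
      ¬ FullyAdjacent (ripsGraph _) S cell (f e) e.1 ∧
      ¬ FullyAdjacent (ripsGraph _) S cell (f e) e.2) (a b c : ι)
    (hT' : ∀ e ∈ T, cell e.1 = a ∧ cell e.2 = b ∧ cell (f e) = c) :
    ∃ g : EuclideanSpace ℝ (Fin 2) × EuclideanSpace ℝ (Fin 2) →
      EuclideanSpace ℝ (Fin 2) ⊕ EuclideanSpace ℝ (Fin 2), Set.InjOn g T ∧
      ∀ e ∈ T, g e = Sum.inl (f e) ∨
        ∃ p ∈ S, cell p = b ∧ dist p (f e) ≤ 1 ∧ g e = Sum.inr p := by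
  rcases T.eq_empty_or_nonempty with rfl | ⟨⟨u₀, v₀⟩, he₀⟩
  · exact ⟨fun e => Sum.inl e.1, by simp, by simp⟩
  obtain ⟨hiso, hwit, hful, hfur⟩ := hT _ he₀
  obtain ⟨hu₀, hv₀, hw₀⟩ := hT' _ he₀
  obtain ⟨⟨⟨hu₀S, hv₀S⟩, -, hadj, hfull⟩, -⟩ := mem_isolatedEdges.1 hiso
  obtain ⟨hw₀S, -, -, hwu, hwv, -, -⟩ := hwit
  generalize f (u₀, v₀) = w₀ at *
  dsimp only at hu₀ hv₀ hw₀ hful hfur hwu hwv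
  -- Reflecting if necessary puts the witness below the edge, as `BelowCells` requires.
  obtain ⟨X, Y, hXY, hX, hY, hYw⟩ : ∃ X Y : EuclideanSpace ℝ (Fin 2) → ℝ,
      (∀ p q, sqDist X Y p q = dist p q ^ 2) ∧ X v₀ - X u₀ = dist u₀ v₀ ∧ Y v₀ = Y u₀ ∧
      Y w₀ ≤ Y u₀ := by
    obtain ⟨X, Y, hXY, hX, hY⟩ := exists_coordinates hadj.1
    rcases le_total (Y w₀) (Y u₀) with h | h
    · exact ⟨X, Y, hXY, hX, hY, h⟩
    · exact ⟨X, fun p => -Y p, fun p q => by rw [sqDist_neg_right, hXY], hX,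
        congrArg Neg.neg hY, neg_le_neg h⟩
  have hU : ∀ c, ∀ x ∈ {x | x ∈ S ∧ cell x = c}, ∀ y ∈ {x | x ∈ S ∧ cell x = c},
      dist x y ≤ 1 / 200 := fun c x hx y hy => hcell x hx.1 y hy.1 (hx.2.trans hy.2.symm)
  have h1 := le_dist_of_not_fullyAdjacent hcell hu₀S hv₀S hfull
  have hopp := oppositeCells_of_coordinates hXY (hU a) (hU b) ⟨hu₀S, hu₀⟩ ⟨hv₀S, hv₀⟩ h1 hadj.2
    hX hY
  have hbel := belowCells_of_coordinates hXY (hU a) (hU b) (hU c) ⟨hu₀S, hu₀⟩ ⟨hv₀S, hv₀⟩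
    ⟨hw₀S, hw₀⟩ h1 hadj.2 (le_dist_of_not_fullyAdjacent hcell hw₀S hu₀S hful) hwu.2
    (le_dist_of_not_fullyAdjacent hcell hw₀S hv₀S hfur) hwv.2 hX hY hYw
  obtain ⟨g, hg, hg'⟩ := exists_injOn_of_mutuallyNearest (κ := distKey) (eq_of_coordinates hXY)
    (fun u v u' v' h => sqDist_le_of_coordinates hXY (dist_le_of_distKey_le h))
    (fun u v u' v' h => distKey_injective h) hopp hbel (S.finite_toSet.subset fun x hx => hx.1) T f
    (by
      rintro ⟨u, v⟩ he
      obtain ⟨hiso, hwit, -, -⟩ := hT _ he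
      obtain ⟨hu, hv, hw⟩ := hT' _ he
      obtain ⟨⟨⟨huS, hvS⟩, hlt, hadj, -⟩, -⟩ := mem_isolatedEdges.1 hiso
      obtain ⟨hwS, hne1, hne2, hwu, hwv, hl, hr⟩ := hwit
      dsimp only at hu hv hne1 hne2 hwu hwv hl hr
      have hne : ∀ {x y}, cell x ≠ cell y → x ≠ y := fun h h' => h (congrArg cell h')
      refine ⟨⟨hwS, hw⟩, ⟨⟨huS, hu⟩, ⟨hvS, hv⟩, ?_, ?_, ?_, ?_⟩⟩
      · rw [sqDist_le_one_iff hXY, dist_comm]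
        exact hwu.2
      · rw [sqDist_le_one_iff hXY, dist_comm]
        exact hwv.2
      · intro u' hu' hle
        by_contra! hcon
        rw [sqDist_le_one_iff hXY, dist_comm] at hle
        have hcu : cell u' = cell u := hu'.2.trans hu.symm
        exact hl u' hu'.1 hcu ⟨hne (hcu ▸ hlt.ne), (dist_le_of_distKey_le hcon.le).trans hadj.2⟩ hcon
          ⟨hne (hcu ▸ hne1), hle⟩
      · intro v' hv' hle
        by_contra! hcon
        rw [sqDist_le_one_iff hXY, dist_comm] at hle
        have hcv : cell v' = cell v := hv'.2.trans hv.symm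
        exact hr v' hv'.1 hcv ⟨hne (hcv ▸ hlt.ne), (dist_le_of_distKey_le hcon.le).trans hadj.2⟩ hcon
          ⟨hne (hcv ▸ hne2), hle⟩)
  refine ⟨g, hg, fun e he => (hg' e he).imp_right ?_⟩
  rintro ⟨p, hp, hle, hgp⟩
  exact ⟨p, hp.1, hp.2, (sqDist_le_one_iff hXY).1 hle, hgp⟩

end PlaneCount

end Rips

namespace Rips

/-! ### Linear bounds in the plane. -/

section PlaneBound

open Finset

/-- An edge with a witness whose cell is fully adjacent to that of an endpoint is determined by the
other endpoint and the cell of this one. -/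
theorem IsolatedWitness.left_unique {V ι L : Type*} [LinearOrder L] {R : SimpleGraph V}
    {S : Finset V} {cell : V → ι} {κ : V → V → L}
    (hκ : ∀ u v u' v', κ u v = κ u' v' → u = u' ∧ v = v') {u u' v w w' : V}
    (h : IsolatedWitness R S cell κ u v w) (h' : IsolatedWitness R S cell κ u' v w')
    (hu : u ∈ S) (hu' : u' ∈ S) (hR : R.Adj u v) (hR' : R.Adj u' v) (hc : cell u = cell u')
    (hf : FullyAdjacent R S cell w u) (hf' : FullyAdjacent R S cell w' u') : u = u' := by
  have aux : ∀ {u u' w}, IsolatedWitness R S cell κ u v w → u' ∈ S → R.Adj u' v →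
      cell u' = cell u → FullyAdjacent R S cell w u → ¬ κ u' v < κ u v := by
    intro u u' w h hu' hR' hc hf hlt
    refine h.2.2.2.2.2.1 u' hu' hc hR' hlt (hf w h.1 u' hu' rfl hc ?_)
    rintro rfl
    exact h.2.1 hc
  exact (hκ _ _ _ _ (le_antisymm (not_lt.1 (aux h hu' hR' hc.symm hf))
    (not_lt.1 (aux h' hu hR hc hf')))).1

theorem IsolatedWitness.right_unique {V ι L : Type*} [LinearOrder L] {R : SimpleGraph V}
    {S : Finset V} {cell : V → ι} {κ : V → V → L}
    (hκ : ∀ u v u' v', κ u v = κ u' v' → u = u' ∧ v = v') {u v v' w w' : V}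
    (h : IsolatedWitness R S cell κ u v w) (h' : IsolatedWitness R S cell κ u v' w')
    (hv : v ∈ S) (hv' : v' ∈ S) (hR : R.Adj u v) (hR' : R.Adj u v') (hc : cell v = cell v')
    (hf : FullyAdjacent R S cell w v) (hf' : FullyAdjacent R S cell w' v') : v = v' := by
  have aux : ∀ {v v' w}, IsolatedWitness R S cell κ u v w → v' ∈ S → R.Adj u v' →
      cell v' = cell v → FullyAdjacent R S cell w v → ¬ κ u v' < κ u v := by
    intro v v' w h hv' hR' hc hf hlt
    refine h.2.2.2.2.2.2 v' hv' hc hR' hlt (hf w h.1 v' hv' rfl hc ?_)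
    rintro rfl
    exact h.2.2.1 hc
  exact (hκ _ _ _ _ (le_antisymm (not_lt.1 (aux h hv' hR' hc.symm hf))
    (not_lt.1 (aux h' hv hR hc hf')))).2

variable {ι : Type*} [LinearOrder ι] [LinearOrder (EuclideanSpace ℝ (Fin 2))]
  {S : Finset (EuclideanSpace ℝ (Fin 2))} {cell : EuclideanSpace ℝ (Fin 2) → ι}

theorem card_isolatedEdges_distKey_le
    (hcell : ∀ x ∈ S, ∀ y ∈ S, cell x = cell y → dist x y ≤ 1 / 200) {C : ℕ}
    (hC : ∀ v ∈ S, ((S.filter fun x => dist v x ≤ 2).image cell).card ≤ C) :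
    (isolatedEdges (ripsGraph _) S cell distKey).card ≤ S.card * (2 * C + 2 * C ^ 2) := by
  classical
  obtain ⟨f, hf⟩ := exists_isolatedWitness_choice (R := ripsGraph _) (S := S) (cell := cell) distKey
  set A := isolatedEdges (ripsGraph _) S cell distKey
  have hA : ∀ {u v}, (u, v) ∈ A → (u ∈ S ∧ v ∈ S) ∧ (ripsGraph _).Adj u v := fun h =>
    ⟨(mem_isolatedEdges.1 h).1.1, (mem_isolatedEdges.1 h).1.2.2.1⟩
  have hκ : ∀ u v u' v' : EuclideanSpace ℝ (Fin 2), distKey u v = distKey u' v' → u = u' ∧ v = v' :=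
    fun u v u' v' h => distKey_injective h
  let N : EuclideanSpace ℝ (Fin 2) → Finset ι := fun v => (S.filter fun x => dist v x ≤ 2).image cell
  have hN : ∀ {v x}, x ∈ S → dist v x ≤ 2 → cell x ∈ N v := fun hx h =>
    mem_image_of_mem _ (mem_filter.2 ⟨hx, h⟩)
  let I₁ : Finset (EuclideanSpace ℝ (Fin 2) × ι) := S.biUnion fun v => {v} ×ˢ N v
  let I₂ : Finset (EuclideanSpace ℝ (Fin 2) × ι × ι) := S.biUnion fun v => {v} ×ˢ (N v ×ˢ N v)
  have hI₁ : I₁.card ≤ S.card * C := by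
    refine card_biUnion_le_card_mul _ _ _ fun v hv => ?_
    rw [card_product, card_singleton, one_mul]
    exact hC v hv
  have hI₂ : I₂.card ≤ S.card * C ^ 2 := by
    refine card_biUnion_le_card_mul _ _ _ fun v hv => ?_
    rw [card_product, card_product, card_singleton, one_mul, sq]
    exact Nat.mul_le_mul (hC v hv) (hC v hv)
  have mem_I₁ : ∀ {v i}, v ∈ S → i ∈ N v → (v, i) ∈ I₁ := fun hv hi =>
    mem_biUnion.2 ⟨_, hv, mem_product.2 ⟨mem_singleton_self _, hi⟩⟩
  have mem_I₂ : ∀ {v i j}, v ∈ S → i ∈ N v → j ∈ N v → (v, i, j) ∈ I₂ := fun hv hi hj =>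
    mem_biUnion.2 ⟨_, hv, mem_product.2 ⟨mem_singleton_self _, mem_product.2 ⟨hi, hj⟩⟩⟩
  -- If the witness cell is fully adjacent to the cell of `u` (or of `v`), the edge is determined by
  -- the other endpoint and that cell. In `A₃` all three cells are pairwise at nearly unit distance.
  let A₁ := A.filter fun e => FullyAdjacent (ripsGraph _) S cell (f e) e.1
  let A₂ := A.filter fun e => FullyAdjacent (ripsGraph _) S cell (f e) e.2
  let A₃ := A.filter fun e => ¬ FullyAdjacent (ripsGraph _) S cell (f e) e.1 ∧
    ¬ FullyAdjacent (ripsGraph _) S cell (f e) e.2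
  have hA₁ : A₁.card ≤ S.card * C := by
    refine (card_le_card_of_injOn (fun e => (e.2, cell e.1)) ?_ ?_).trans hI₁
    · rintro ⟨u, v⟩ he
      obtain ⟨⟨hu, hv⟩, hR⟩ := hA (mem_filter.1 he).1
      refine mem_I₁ hv (hN hu ?_)
      rw [dist_comm]
      exact hR.2.trans one_le_two
    · rintro ⟨u, v⟩ he ⟨u', v'⟩ he' heq
      obtain ⟨he, hfull⟩ := mem_filter.1 he
      obtain ⟨he', hfull'⟩ := mem_filter.1 he'
      obtain ⟨h1, h2⟩ := Prod.mk.inj heq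
      dsimp only at h1 h2
      subst h1
      exact Prod.ext ((hf (u, v) he).left_unique hκ (hf (u', v) he') (hA he).1.1 (hA he').1.1 (hA he).2 (hA he').2 h2
        hfull hfull') rfl
  have hA₂ : A₂.card ≤ S.card * C := by
    refine (card_le_card_of_injOn (fun e => (e.1, cell e.2)) ?_ ?_).trans hI₁
    · rintro ⟨u, v⟩ he
      obtain ⟨⟨hu, hv⟩, hR⟩ := hA (mem_filter.1 he).1
      exact mem_I₁ hu (hN hv (hR.2.trans one_le_two))
    · rintro ⟨u, v⟩ he ⟨u', v'⟩ he' heq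
      obtain ⟨he, hfull⟩ := mem_filter.1 he
      obtain ⟨he', hfull'⟩ := mem_filter.1 he'
      obtain ⟨h1, h2⟩ := Prod.mk.inj heq
      dsimp only at h1 h2
      subst h1
      exact Prod.ext rfl ((hf (u, v) he).right_unique hκ (hf (u, v') he') (hA he).1.2 (hA he').1.2 (hA he).2 (hA he').2 h2
        hfull hfull')
  have hA₃ : A₃.card ≤ S.card * C ^ 2 + S.card * C ^ 2 := by
    have hA₃' : ∀ e ∈ A₃, e ∈ A ∧ ¬ FullyAdjacent (ripsGraph _) S cell (f e) e.1 ∧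
      ¬ FullyAdjacent (ripsGraph _) S cell (f e) e.2 := fun e he => mem_filter.1 he
    have hG : ∀ t : ι × ι × ι, ∃ g : EuclideanSpace ℝ (Fin 2) × EuclideanSpace ℝ (Fin 2) →
        EuclideanSpace ℝ (Fin 2) ⊕ EuclideanSpace ℝ (Fin 2),
        Set.InjOn g {e | e ∈ A₃ ∧ cell e.1 = t.1 ∧ cell e.2 = t.2.1 ∧ cell (f e) = t.2.2} ∧
        ∀ e ∈ {e | e ∈ A₃ ∧ cell e.1 = t.1 ∧ cell e.2 = t.2.1 ∧ cell (f e) = t.2.2},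
          g e = Sum.inl (f e) ∨ ∃ p ∈ S, cell p = t.2.1 ∧ dist p (f e) ≤ 1 ∧ g e = Sum.inr p :=
      fun t => exists_injection_of_isolatedWitness hcell _ f
        (fun e he => ⟨(hA₃' e he.1).1, hf _ (hA₃' e he.1).1, (hA₃' e he.1).2⟩)
        _ _ _ fun e he => he.2
    choose G hGinj hG using hG
    let t : EuclideanSpace ℝ (Fin 2) × EuclideanSpace ℝ (Fin 2) → ι × ι × ι :=
      fun e => (cell e.1, cell e.2, cell (f e))
    let h : EuclideanSpace ℝ (Fin 2) × EuclideanSpace ℝ (Fin 2) →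
        (EuclideanSpace ℝ (Fin 2) × ι × ι) ⊕ (EuclideanSpace ℝ (Fin 2) × ι × ι) :=
      -- Each code is stored with the two cells it does not reveal: a witness has its own cell, and
      -- a point `p` lies in the cell of `v`. The distance from `p` to `u` can exceed `1`, which is
      -- why cells are counted within radius `2`.
      fun e => (G (t e) e).map (fun w => (w, cell e.1, cell e.2)) fun p => (p, cell e.1, cell (f e))
    have hGt : ∀ e ∈ A₃, G (t e) e = Sum.inl (f e) ∨
        ∃ p ∈ S, cell p = cell e.2 ∧ dist p (f e) ≤ 1 ∧ G (t e) e = Sum.inr p :=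
      fun e he => hG (t e) e ⟨he, rfl, rfl, rfl⟩
    have hinj : ∀ e ∈ A₃, ∀ e' ∈ A₃, t e = t e' → G (t e) e = G (t e') e' → e = e' := by
      intro e he e' he' ht hGe
      rw [← ht] at hGe
      exact hGinj (t e) ⟨he, rfl, rfl, rfl⟩ ⟨he', congrArg Prod.fst ht.symm,
        congrArg (fun x => x.2.1) ht.symm, congrArg (fun x => x.2.2) ht.symm⟩ hGe
    refine (card_le_card_of_injOn (t := I₂.disjSum I₂) h ?_ ?_).trans ?_
    · intro e he
      obtain ⟨he', -⟩ := mem_filter.1 he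
      obtain ⟨⟨hu, hv⟩, -⟩ := hA (u := e.1) (v := e.2) he'
      obtain ⟨hw, -, -, hwu, hwv, -, -⟩ := hf e he'
      rcases hGt e he with h1 | ⟨p, hp, hpc, hpd, h1⟩
      · simp only [h, h1, Sum.map_inl, mem_coe, inl_mem_disjSum]
        exact mem_I₂ hw (hN hu (hwu.2.trans one_le_two)) (hN hv (hwv.2.trans one_le_two))
      · simp only [h, h1, Sum.map_inr, mem_coe, inr_mem_disjSum]
        refine mem_I₂ hp (hN hu ?_) (hN hw (hpd.trans one_le_two))
        linarith [dist_triangle p (f e) e.1, hwu.2]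
    · intro e he e' he' heq
      rcases hGt e he with h1 | ⟨p, hp, hpc, hpd, h1⟩ <;>
        rcases hGt e' he' with h2 | ⟨p', hp', hpc', hpd', h2⟩ <;>
        simp only [h, h1, h2, Sum.map_inl, Sum.map_inr, reduceCtorEq, Sum.inl.injEq, Sum.inr.injEq,
          Prod.mk.injEq] at heq
      · obtain ⟨h3, h4, h5⟩ := heq
        exact hinj e he e' he' (by simp only [t, h3, h4, h5]) (by rw [h1, h2, h3])
      · obtain ⟨h3, h4, h5⟩ := heq
        refine hinj e he e' he' ?_ (by rw [h1, h2, h3])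
        simp only [t, h4, h5, ← hpc, ← hpc', h3]
    · rw [card_disjSum]
      exact Nat.add_le_add hI₂ hI₂
  have hcover : A ⊆ A₁ ∪ (A₂ ∪ A₃) := by
    intro e he
    simp only [A₁, A₂, A₃, mem_union, mem_filter]
    tauto
  refine (card_le_card hcover).trans ((card_union_le _ _).trans ?_)
  have := card_union_le A₂ A₃
  nlinarith

/-- In the plane the second Betti number of the Rips complex grows at most linearly. -/
theorem homologyRank_three_flag_ripsGraph_le (k : Type u) [Field k]
    (hcell : ∀ x ∈ S, ∀ y ∈ S, cell x = cell y → dist x y ≤ 1 / 200) {C : ℕ}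
    (hC : ∀ v ∈ S, ((S.filter fun x => dist v x ≤ 2).image cell).card ≤ C) :
    homologyRank k 3 (flag (ripsGraph _) S) ≤ (2 ^ C + C * (4 * C + 2 * C ^ 2)) * S.card := by
  have hbad := (card_badEdges_le (R := ripsGraph _) (S := S) (cell := cell) distKey).trans
    (Nat.add_le_add (card_isolatedEdges_distKey_le hcell hC) (card_splitEdges_distKey_le hcell hC))
  refine (homologyRank_three_flag_le (cell := cell) (κ := distKey) (C := C)
    (fun u _ v _ u' _ v' _ h => distKey_injective h) ?_ ?_).trans
    ((Nat.add_le_add_left (Nat.mul_le_mul_left _ hbad) _).trans (by nlinarith))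
  · exact fun x hx y hy h hne => ⟨hne, (hcell x hx y hy h).trans (by norm_num)⟩
  · refine fun v hv => (card_le_card (image_subset_image fun x hx => ?_)).trans (hC v hv)
    obtain ⟨hx, hadj⟩ := mem_nbrs.1 hx
    exact mem_filter.2 ⟨hx, hadj.2.trans one_le_two⟩

end PlaneBound

end Rips

namespace Rips

/-! ### Cubical cells -/

section Grid

open Finset

/-- The cell of `x` in the cubical grid of width `h`. -/
noncomputable def gridCell {d : ℕ} (h : ℝ) (x : EuclideanSpace ℝ (Fin d)) : Lex (Fin d → ℤ) :=
  toLex fun i => ⌊x i / h⌋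

variable {d : ℕ}

theorem abs_coord_sub_le_dist (x y : EuclideanSpace ℝ (Fin d)) (i : Fin d) :
    |x i - y i| ≤ dist x y := by
  rw [dist_eq_norm]
  exact PiLp.norm_apply_le (x - y) i

theorem dist_le_of_gridCell_eq {h : ℝ} (hh : 0 < h) {x y : EuclideanSpace ℝ (Fin d)}
    (hxy : gridCell h x = gridCell h y) : dist x y ≤ d * h := by
  have hcoord : ∀ i, |x i - y i| ≤ h := fun i => by
    have h1 := (Int.abs_sub_lt_one_of_floor_eq_floor (congrFun (toLex_inj.1 hxy) i)).le
    rw [← sub_div, abs_div, abs_of_pos hh, div_le_one hh] at h1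
    exact h1
  rw [EuclideanSpace.dist_eq]
  refine Real.sqrt_le_iff.2 ⟨by positivity, ?_⟩
  calc ∑ i, dist (x i) (y i) ^ 2 ≤ ∑ _i : Fin d, h ^ 2 := sum_le_sum fun i _ => by
        rw [Real.dist_eq]
        exact pow_le_pow_left₀ (abs_nonneg _) (hcoord i) 2
    _ = d * h ^ 2 := by simp
    _ ≤ d ^ 2 * h ^ 2 := by
      refine mul_le_mul_of_nonneg_right ?_ (sq_nonneg h)
      exact_mod_cast Nat.le_self_pow two_ne_zero d
    _ = (d * h) ^ 2 := (mul_pow _ _ _).symm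

theorem card_image_gridCell_le {h : ℝ} (hh : 0 < h) (S : Finset (EuclideanSpace ℝ (Fin d)))
    (v : EuclideanSpace ℝ (Fin d)) :
    ((S.filter fun x => dist v x ≤ 2).image (gridCell h)).card ≤ (2 * ⌈2 / h + 1⌉₊ + 1) ^ d := by
  set M := ⌈2 / h + 1⌉₊
  have hsub : (S.filter fun x => dist v x ≤ 2).image (gridCell h) ⊆
      (Fintype.piFinset fun i => Icc (⌊v i / h⌋ - (M : ℤ)) (⌊v i / h⌋ + M)).image toLex := by
    intro c hc
    obtain ⟨x, hx, rfl⟩ := mem_image.1 hc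
    refine mem_image_of_mem _ (Fintype.mem_piFinset.2 fun i => ?_)
    have h1 : |v i / h - x i / h| ≤ 2 / h := by
      rw [← sub_div, abs_div, abs_of_pos hh]
      exact div_le_div_of_nonneg_right
        ((abs_coord_sub_le_dist v x i).trans (mem_filter.1 hx).2) hh.le
    have hM : 2 / h + 1 ≤ M := Nat.le_ceil _
    obtain ⟨h2, h3⟩ := abs_le.1 h1
    have h4 := Int.floor_le (x i / h)
    have h5 := Int.lt_floor_add_one (x i / h)
    have h6 := Int.floor_le (v i / h)
    have h7 := Int.lt_floor_add_one (v i / h)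
    refine mem_Icc.2 ⟨?_, ?_⟩
    · have : ((⌊v i / h⌋ - M : ℤ) : ℝ) ≤ (⌊x i / h⌋ : ℤ) := by
        push_cast
        linarith
      exact_mod_cast this
    · have : ((⌊x i / h⌋ : ℤ) : ℝ) ≤ (⌊v i / h⌋ + M : ℤ) := by
        push_cast
        linarith
      exact_mod_cast this
  refine (card_le_card hsub).trans (card_image_le.trans ?_)
  rw [Fintype.card_piFinset]
  refine (prod_le_prod' (g := fun _ => 2 * M + 1) fun i _ => ?_).trans (by simp)
  rw [Int.card_Icc]
  omega

theorem exists_cells (d : ℕ) {ε : ℝ} (hε : 0 < ε) :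
    ∃ (ι : Type) (_ : LinearOrder ι) (cell : EuclideanSpace ℝ (Fin d) → ι) (C : ℕ),
      (∀ x y, cell x = cell y → dist x y ≤ ε) ∧
      ∀ (S : Finset (EuclideanSpace ℝ (Fin d))) (v : EuclideanSpace ℝ (Fin d)),
        ((S.filter fun x => dist v x ≤ 2).image cell).card ≤ C := by
  -- The denominator `d + 1` rather than `d` also covers dimension zero.
  have hh : 0 < ε / (d + 1) := by positivity
  refine ⟨_, inferInstance, gridCell (ε / (d + 1)), _, fun x y hxy => (dist_le_of_gridCell_eq hh hxy).trans ?_,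
    fun S v => by
      convert card_image_gridCell_le hh S v⟩
  rw [mul_div_assoc', div_le_iff₀ (by positivity)]
  nlinarith

end Grid

/-! ### Higher Betti numbers -/

section Recursion

open Finset

variable {V : Type*} [LinearOrder V] {k : Type u} [Field k]

/-- Bounds for the homology of the neighbourhoods of the vertices bound the homology one dimension
higher. -/
theorem homologyRank_flag_le_card_mul {G : SimpleGraph V} {m : ℕ} {B : ℝ} (S : Finset V)
    (hB : ∀ T ⊆ S, (homologyRank k m (flag G T) : ℝ) ≤ B) :
    (homologyRank k (m + 1) (flag G S) : ℝ) ≤ S.card * B := by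
  induction S using Finset.induction_on with
  | empty => simp [homologyRank_flag_empty]
  | insert v S hv ih =>
    have h := homologyRank_flag_le_erase (k := k) G (mem_insert_self v S) m
    rw [erase_insert hv] at h
    have h1 := ih fun T hT => hB T (hT.trans (subset_insert v S))
    have h2 := hB (nbrs G (insert v S) v) fun w hw => (mem_nbrs.1 hw).1
    rw [card_insert_of_notMem hv]
    have h3 : (homologyRank k (m + 1) (flag G (insert v S)) : ℝ) ≤
        homologyRank k (m + 1) (flag G S) + homologyRank k m (flag G (nbrs G (insert v S) v)) := by
      exact_mod_cast h
    push_cast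
    linarith

theorem homologyRank_flag_le_of_monotone {G : SimpleGraph V} {m : ℕ} {b : ℕ → ℝ}
    (hb : Monotone b) (h : ∀ S, (homologyRank k m (flag G S) : ℝ) ≤ b S.card) (S : Finset V) :
    (homologyRank k (m + 1) (flag G S) : ℝ) ≤ S.card * b S.card :=
  homologyRank_flag_le_card_mul S fun T hT => (h T).trans (hb (card_le_card hT))

end Recursion

/-! ### Rips complexes -/

section Rips

theorem ripsComplex_one_eq_flag {V : Type*} [MetricSpace V] (S : Finset V) :
    ripsComplex 1 S = flag (ripsGraph V) S := by
  ext F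
  refine and_congr_right fun _ => and_congr_right fun _ => ⟨fun h x hx y hy hne => ⟨hne, ?_⟩,
    fun h => Metric.diam_le_of_forall_dist_le zero_le_one fun x hx y hy => ?_⟩
  · exact (Metric.dist_le_diam_of_mem F.finite_toSet.isBounded hx hy).trans h
  · rcases eq_or_ne x y with rfl | hne
    · simp
    · exact (h hx hy hne).2

theorem exists_homologyRank_ripsGraph_le (d : ℕ) [LinearOrder (EuclideanSpace ℝ (Fin d))] (p : ℕ)
    (hp : 2 ≤ p) {δ : ℝ} (hδ : 0 < δ) : ∃ K : ℝ, 0 ≤ K ∧ ∀ (k : Type u) [Field k]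
      (S : Finset (EuclideanSpace ℝ (Fin d))),
      (homologyRank k (p + 1) (flag (ripsGraph _) S) : ℝ) ≤
        δ * S.card ^ p + K * S.card ^ (p - 1) := by
  induction p, hp using Nat.le_induction with
  | base =>
    obtain ⟨ι, _, cell, C, h1, h2⟩ := exists_cells d one_pos
    obtain ⟨K, hK0, hK⟩ := exists_homologyRank_three_flag_le.{u} C hδ
    refine ⟨K, hK0, fun k _ S => ?_⟩
    rw [show 2 - 1 = 1 from rfl, pow_one]
    refine hK (R := ripsGraph _) (S := S) (cell := cell) k
      (fun x _ y _ hxy hne => ⟨hne, h1 x y hxy⟩) fun v _ => ?_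
    refine (Finset.card_le_card (Finset.image_subset_image fun x hx => ?_)).trans (h2 S v)
    obtain ⟨hx, hadj⟩ := mem_nbrs.1 hx
    exact Finset.mem_filter.2 ⟨hx, hadj.2.trans one_le_two⟩
  | succ p hp ih =>
    obtain ⟨K, hK0, hK⟩ := ih
    refine ⟨K, hK0, fun k _ S => ?_⟩
    have hmono : Monotone fun n : ℕ => δ * (n : ℝ) ^ p + K * (n : ℝ) ^ (p - 1) := by
      intro a b hab
      dsimp only
      gcongr
    refine (homologyRank_flag_le_of_monotone hmono (hK k) S).trans (le_of_eq ?_)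
    obtain ⟨q, rfl⟩ : ∃ q, p = q + 1 := ⟨p - 1, by omega⟩
    simp only [Nat.add_sub_cancel]
    ring

theorem exists_homologyRank_ripsGraph_plane_le [LinearOrder (EuclideanSpace ℝ (Fin 2))] (p : ℕ)
    (hp : 2 ≤ p) : ∃ D : ℝ, 0 ≤ D ∧ ∀ (k : Type u) [Field k]
      (S : Finset (EuclideanSpace ℝ (Fin 2))),
      (homologyRank k (p + 1) (flag (ripsGraph _) S) : ℝ) ≤ D * S.card ^ (p - 1) := by
  induction p, hp using Nat.le_induction with
  | base =>
    obtain ⟨ι, _, cell, C, h1, h2⟩ := exists_cells 2 (show (0 : ℝ) < 1 / 200 by norm_num)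
    refine ⟨(2 ^ C + C * (4 * C + 2 * C ^ 2) : ℕ), Nat.cast_nonneg _, fun k _ S => ?_⟩
    rw [show 2 - 1 = 1 from rfl, pow_one]
    exact_mod_cast homologyRank_three_flag_ripsGraph_le (cell := cell) k
      (fun x _ y _ hxy => h1 x y hxy) fun v _ => h2 S v
  | succ p hp ih =>
    obtain ⟨D, hD0, hD⟩ := ih
    refine ⟨D, hD0, fun k _ S => ?_⟩
    have hmono : Monotone fun n : ℕ => D * (n : ℝ) ^ (p - 1) := by
      intro a b hab
      dsimp only
      gcongr
    refine (homologyRank_flag_le_of_monotone hmono (hD k) S).trans (le_of_eq ?_)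
    obtain ⟨q, rfl⟩ : ∃ q, p = q + 1 := ⟨p - 1, by omega⟩
    simp only [Nat.add_sub_cancel]
    ring

theorem maxBetti_le_of_monotone {k : Type u} [Field k] {p d : ℕ} {b : ℕ → ℝ} (hb : Monotone b)
    (h : ∀ S : Finset (EuclideanSpace ℝ (Fin d)), letI := lexOrder d
      (homologyRank k (p + 1) (flag (ripsGraph _) S) : ℝ) ≤ b S.card) (n : ℕ) :
    (maxBetti k p d n : ℝ) ≤ b n := by
  obtain ⟨S, hS, hSb⟩ := (isGreatest_maxBetti k p d n).1
  rw [← hSb, ripsBetti, ripsComplex_one_eq_flag]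
  exact (h S).trans (hb hS)

end Rips

end Rips

/-! ### The theorem. -/

theorem mainTheorem5 (p : ℕ) (hp : 2 ≤ p) :
    (∀ (d : ℕ) (δ : ℝ), 0 < δ → ∃ N : ℕ, ∀ n : ℕ, N ≤ n → ∀ (k : Type u) [Field k],
      (Rips.maxBetti k p d n : ℝ) < δ * (n : ℝ) ^ p) ∧
    (∃ D : ℝ, ∀ (n : ℕ) (k : Type u) [Field k],
      (Rips.maxBetti k p 2 n : ℝ) ≤ D * (n : ℝ) ^ (p - 1)) := by
  constructor
  · intro d δ hδ
    let := Rips.lexOrder d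
    obtain ⟨K, hK0, hK⟩ := Rips.exists_homologyRank_ripsGraph_le.{u} d p hp (half_pos hδ)
    -- Half of `δ` is kept to absorb the term of order `n ^ (p - 1)`. Neither `K` nor `N` depends on
    -- the field.
    obtain ⟨N, hN⟩ := exists_nat_gt (K / (δ / 2))
    refine ⟨N, fun n hn k _ => ?_⟩
    have hmono : Monotone fun n : ℕ => δ / 2 * (n : ℝ) ^ p + K * (n : ℝ) ^ (p - 1) := by
      intro a b hab
      dsimp only
      gcongr
    refine (Rips.maxBetti_le_of_monotone hmono (hK k) n).trans_lt ?_
    have hNn : (N : ℝ) ≤ n := by exact_mod_cast hn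
    have hKn : K < δ / 2 * n := by
      rw [div_lt_iff₀ (half_pos hδ)] at hN
      nlinarith
    have hn0 : (0 : ℝ) < n := by
      by_contra! h0
      nlinarith
    obtain ⟨q, rfl⟩ : ∃ q, p = q + 1 := ⟨p - 1, by omega⟩
    rw [Nat.add_sub_cancel]
    have := mul_lt_mul_of_pos_right hKn (pow_pos hn0 q)
    calc δ / 2 * (n : ℝ) ^ (q + 1) + K * (n : ℝ) ^ q
        < δ / 2 * (n : ℝ) ^ (q + 1) + δ / 2 * n * (n : ℝ) ^ q := by gcongr
      _ = δ * (n : ℝ) ^ (q + 1) := by ring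
  · let := Rips.lexOrder 2
    obtain ⟨D, hD0, hD⟩ := Rips.exists_homologyRank_ripsGraph_plane_le.{u} p hp
    refine ⟨D, fun n k _ => ?_⟩
    have hmono : Monotone fun n : ℕ => D * (n : ℝ) ^ (p - 1) := by
      intro a b hab
      dsimp only
      gcongr
    exact Rips.maxBetti_le_of_monotone hmono (hD k) n
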